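/- Let $K$ be a number field with ring of integers $\mathcal{O}_K$. **Growth rates.** Let $X$ be a proper $K$-scheme, $L$ an ample line bundle on $X$ and $U\subset X$ an open subset. A *model* of $(X,L,U)$ consists of a proper flat $\mathcal{O}_K$-scheme $\mathcal{X}$, a Hermitian line bundle $\bar{\mathcal{L}}$ on $\mathcal{X}$ (a line bundle $\mathcal{L}$ with, for each embedding $\sigma\colon K\to\mathbb{C}$, a continuous metric $\|\cdot\|_\sigma$ on $\mathcal{L}_{|\mathcal{X}_\sigma(\mathbb{C})}$, compatibly with complex conjugation) and an open subset $\mathcal{U}\subset\mathcal{X}$, with generic fibres $X$, $L$, $U$. The height of $P\in\mathcal{X}(K)$, extended to $\mathcal{P}\in\mathcal{X}(\mathcal{O}_K)$, is $$h_{\bar{\mathcal{L}}}(P)=\frac{1}{[K:\mathbb{Q}]}\Bigl(\log\#(\mathcal{P}^*\mathcal{L}/s\mathcal{O}_K)-\sum_{\sigma\colon K\to\mathbb{C}}\log\|s\|_\sigma\Bigr)$$ for any non-zero section $s$ of $\mathcal{P}^*\mathcal{L}$. For a subring $R\subset K$ containing $\mathcal{O}_K$, put $$\operatorname{gr}(\mathcal{X},\bar{\mathcal{L}},\mathcal{U},R)=\limsup_{c\to+\infty}\frac{\log\max\{1,\#\{P\in\mathcal{U}(R):h_{\bar{\mathcal{L}}}(P)\le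 c\}\}}{c}.$$ The *growth rate of integral points* of $U$ is $$\operatorname{gr}^{\mathrm{int}}_K(X,L,U)=\sup_S\operatorname{gr}(\mathcal{X},\bar{\mathcal{L}},\mathcal{U},\mathcal{O}_{K,S}),$$ where $S$ ranges over the finite sets of places of $K$ containing the Archimedean ones; it does not depend on the model. **Twists.** Let $f\colon Y\to X$ be a finite surjective morphism of integral projective varieties over $K$, and $G=\operatorname{Aut}(f)$ the group of automorphisms of $Y$ over $X$. The morphism $f$ is *Galois* if $G$ acts transitively on $Y_{\bar x}$ for every geometric point $\bar x$ of $X$. Let $H^1(K,G)$ be the set of isomorphism classes of principal $G$-bundles over $\operatorname{Spec}K$. For $t\in H^1(K,G)$ the class of $P$, let $Y_t$ be the categorical quotient of $Y\times_K P$ by the diagonal action of $G$, and $f_t\colon Y_t\to X$ the morphism induced by $f$. **Proposition.** Let $f\colon Y\to X$ be a finite surjective Galois morphism between integral projective varieties over $K$, $U$ an open subset of $X$ over which $f$ is étale, and $L$ an ample line bundle on $X$. Then $$\operatorname{gr}^{\mathrm{int}}_K(X,L,U)\le\sup_{t\in H^1(K,\operatorname{Aut}(f))}\operatorname{gr}^{\mathrm{int}}_K\bigl(Y_t,f_t^*L,f_t^{-1}(U)\bigr).$$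 More precisely, for every model $(\mathcal{X},\bar{\mathcal{L}},\mathcal{U})$ of $(X,L,U)$ and every finite set $S$ of places of $K$ containing the Archimedean ones, there is a single $t\in H^1(K,\operatorname{Aut}(f))$ with $$\operatorname{gr}(\mathcal{X},\bar{\mathcal{L}},\mathcal{U},\mathcal{O}_{K,S})\le\operatorname{gr}^{\mathrm{int}}_K\bigl(Y_t,f_t^*L,f_t^{-1}(U)\bigr).$$ -/

import Mathlib

open CategoryTheory CategoryTheory.Limits AlgebraicGeometry NumberField
open scoped Topology

noncomputable section

namespace GrowthRates

attribute [local instance] MvPolynomial.gradedAlgebra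

/-! ### Line bundles on schemes -/

section LineBundles

universe u

variable {X Y : Scheme.{u}}

/-- A line bundle: an `𝒪_X`-module which is locally isomorphic to `𝒪_X`. -/
def IsLineBundle (L : X.Modules) : Prop :=
  ∀ x : X, ∃ U : X.Opens, x ∈ U ∧
    Nonempty (L.restrict U.ι ≅ SheafOfModules.unit (U : Scheme.{u}).ringCatSheaf)

/-- The pull-back `f^* s ∈ Γ(V, f^* L)` of a section `s ∈ Γ(U, L)` along `f : Y ⟶ X`, where
`V ⊆ f⁻¹ U`. -/
def pullbackSection (f : Y ⟶ X) (L : X.Modules) (U : X.Opens) (V : Y.Opens) (h : V ≤ f ⁻¹ᵁ U)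
    (s : Γ(L, U)) : Γ((Scheme.Modules.pullback f).obj L, V) :=
  ((Scheme.Modules.pullback f).obj L).presheaf.map (homOfLE h).op
    ((((Scheme.Modules.pullbackPushforwardAdjunction f).unit.app L).app U) s)

/-- The tensor product `L ⊗ M` of `𝒪_X`-modules: the sheafification of the presheaf
`U ↦ L(U) ⊗ M(U)`. -/
def tensor (L M : X.Modules) : X.Modules :=
  (PresheafOfModules.sheafification (𝟙 X.ringCatSheaf.obj)).obj
    (PresheafOfModules.Monoidal.tensorObj (R := X.presheaf)
      ((Scheme.Modules.toPresheafOfModules X).obj L)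
      ((Scheme.Modules.toPresheafOfModules X).obj M))

/-- The tensor power `L^{⊗ n}`. -/
def tensorPow (L : X.Modules) : ℕ → X.Modules
  | 0 => SheafOfModules.unit X.ringCatSheaf
  | n + 1 => tensor (tensorPow L n) L

/-- The locus `X_s` where a global section `s` of `L` does not vanish, that is, where its value
in the fibre `L ⊗ κ(x)` is non-zero. -/
def nonvanishingLocus (L : X.Modules) (s : Γ(L, ⊤)) : Set X :=
  {x | pullbackSection (X.fromSpecResidueField x) L ⊤ ⊤ le_rfl s ≠ 0}

/-- A line bundle `L` on a quasi-compact scheme `X` is ample if every point of `X` lies in an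
affine open subset of the form `X_s`, where `s` is a global section of some `L^{⊗ n}`, `n ≥ 1`. -/
structure IsAmple (L : X.Modules) : Prop where
  isLineBundle : IsLineBundle L
  compactSpace : CompactSpace X
  exists_section : ∀ x : X, ∃ n : ℕ, 1 ≤ n ∧ ∃ (s : Γ(tensorPow L n, ⊤)) (W : X.Opens),
    x ∈ W ∧ IsAffineOpen W ∧ (W : Set X) = nonvanishingLocus (tensorPow L n) s

end LineBundles

/-! ### Projective schemes over a field, Galois morphisms -/

/-- The projective space of dimension `n` over `K`. -/
abbrev projectiveSpace (K : Type) [Field K] (n : ℕ) : Scheme.{0} :=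
  Proj (MvPolynomial.homogeneousSubmodule (Fin (n + 1)) K)

/-- The structure morphism of the projective space. -/
def projectiveSpaceToSpec (K : Type) [Field K] (n : ℕ) :
    projectiveSpace K n ⟶ Spec (.of K) :=
  Proj.toSpecZero (MvPolynomial.homogeneousSubmodule (Fin (n + 1)) K) ≫
    Spec.map (CommRingCat.ofHom
      (algebraMap K (MvPolynomial.homogeneousSubmodule (Fin (n + 1)) K 0)))

/-- A `K`-scheme is projective if it is a closed subscheme of a projective space. -/
def IsProjective {K : Type} [Field K] {X : Scheme.{0}} (p : X ⟶ Spec (.of K)) : Prop :=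
  ∃ (n : ℕ) (i : X ⟶ projectiveSpace K n), IsClosedImmersion i ∧
    i ≫ projectiveSpaceToSpec K n = p

/-- The group `Aut(f)` of automorphisms `g` of `Y` such that `f ∘ g = f`. -/
abbrev AutOver {X Y : Scheme.{0}} (f : Y ⟶ X) : Type := Aut (Over.mk f)

/-- The tautological action of `Aut(f)` on `Y`. -/
def autAction {X Y : Scheme.{0}} (f : Y ⟶ X) : AutOver f →* Aut Y :=
  (Over.forget X).mapAut (Over.mk f)

lemma autAction_comp {X Y : Scheme.{0}} (f : Y ⟶ X) (g : AutOver f) :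
    (autAction f g).hom ≫ f = f :=
  Over.w g.hom

lemma autAction_comp_of_comp {X Y S : Scheme.{0}} {f : Y ⟶ X} {pX : X ⟶ S} {pY : Y ⟶ S}
    (hf : f ≫ pX = pY) (g : AutOver f) : (autAction f g).hom ≫ pY = pY := by
  rw [← hf, ← Category.assoc, autAction_comp]

/-- A morphism `f : Y ⟶ X` (to be used for finite surjective morphisms) is Galois if, for each
geometric point `x` of `X`, the group `Aut(f)` acts transitively on the geometric fibre of `f`
at `x`. -/
def IsGaloisCover {X Y : Scheme.{0}} (f : Y ⟶ X) : Prop :=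
  ∀ (Ω : Type) [Field Ω] [IsAlgClosed Ω] (x : Spec (.of Ω) ⟶ X) (y y' : Spec (.of Ω) ⟶ Y),
    y ≫ f = x → y' ≫ f = x → ∃ g : AutOver f, y ≫ (autAction f g).hom = y'

/-! ### Principal bundles and twists -/

section Twists

variable (G : Type) [Group G] (S : Scheme.{0})

/-- A principal `G`-bundle over `S`. An action of `G` is a homomorphism to the automorphism group;
in `Aut P` the product `g * h` is `h` followed by `g`, so these are left actions. -/
structure PrincipalBundle where
  /-- The total space. -/
  P : Scheme.{0}
  /-- The structure morphism. -/
  π : P ⟶ S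
  /-- The action of `G`. -/
  act : G →* Aut P
  act_comp : ∀ g, (act g).hom ≫ π = π
  flat : Flat π
  surjective : Surjective π
  locallyOfFinitePresentation : LocallyOfFinitePresentation π
  quasiCompact : QuasiCompact π
  quasiSeparated : QuasiSeparated π
  /-- The morphism `G × P ⟶ P ×_S P`, `(g, p) ↦ (g p, p)`, is an isomorphism. -/
  isIso : IsIso (Sigma.desc (f := fun _ : G ↦ P) (fun g ↦
    pullback.lift (f := π) (g := π) (act g).hom (𝟙 P) (by simp [act_comp])))

/-- Principal `G`-bundles over `S` up to equivariant isomorphism over `S`. -/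
instance principalBundleSetoid : Setoid (PrincipalBundle G S) where
  r P Q := ∃ e : P.P ≅ Q.P, e.hom ≫ Q.π = P.π ∧
    ∀ g, (P.act g).hom ≫ e.hom = e.hom ≫ (Q.act g).hom
  iseqv :=
    { refl := fun P ↦ ⟨Iso.refl _, by simp, by simp⟩
      symm := by
        rintro P Q ⟨e, h, h'⟩
        refine ⟨e.symm, by simp [← h], fun g ↦ ?_⟩
        rw [Iso.symm_hom, ← cancel_epi e.hom, ← Category.assoc, ← h' g]
        simp
      trans := by
        rintro P Q R ⟨e, h, h'⟩ ⟨e', k, k'⟩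
        refine ⟨e ≪≫ e', by simp [h, k], fun g ↦ ?_⟩
        rw [Iso.trans_hom, ← Category.assoc, h' g, Category.assoc, k' g, Category.assoc] }

/-- The set `H¹(S, G)` of isomorphism classes of principal `G`-bundles over `S`. -/
def H1 : Type 1 := Quotient (principalBundleSetoid G S)

variable {G S}

/-- A principal bundle in the class `t`. -/
def H1.bundle (t : H1 G S) : PrincipalBundle G S := Quotient.out t

/-- The diagonal action of `g ∈ G` on `Y ×_S P`. -/
def diagonalAction {Y : Scheme.{0}} (p : Y ⟶ S) (ρ : G →* Aut Y)
    (hρ : ∀ g, (ρ g).hom ≫ p = p) (B : PrincipalBundle G S) (g : G) :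
    pullback p B.π ⟶ pullback p B.π :=
  pullback.map p B.π p B.π (ρ g).hom (B.act g).hom (𝟙 S) (by simp [hρ])
    (by simp [B.act_comp])

/-- The twist of an `S`-scheme `Y` with an action of `G` by a principal `G`-bundle `B`: a
categorical quotient (among `S`-schemes) of `Y ×_S B` by the diagonal action of `G`. -/
structure Twist {Y : Scheme.{0}} (p : Y ⟶ S) (ρ : G →* Aut Y)
    (hρ : ∀ g, (ρ g).hom ≫ p = p) (B : PrincipalBundle G S) where
  /-- The twist. -/
  T : Scheme.{0}
  /-- Its structure morphism. -/
  str : T ⟶ S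
  /-- The quotient morphism. -/
  q : pullback p B.π ⟶ T
  q_str : q ≫ str = pullback.fst p B.π ≫ p
  invariant : ∀ g, diagonalAction p ρ hρ B g ≫ q = q
  universal : ∀ (Z : Scheme.{0}) (z : Z ⟶ S) (h : pullback p B.π ⟶ Z),
    h ≫ z = pullback.fst p B.π ≫ p → (∀ g, diagonalAction p ρ hρ B g ≫ h = h) →
    ∃! k : T ⟶ Z, k ≫ z = str ∧ q ≫ k = h

lemma Twist.exists_map {Y : Scheme.{0}} {p : Y ⟶ S} {ρ : G →* Aut Y}
    {hρ : ∀ g, (ρ g).hom ≫ p = p} {B : PrincipalBundle G S} (T : Twist p ρ hρ B)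
    {X : Scheme.{0}} (pX : X ⟶ S) (f : Y ⟶ X) (hf : f ≫ pX = p)
    (hinv : ∀ g, (ρ g).hom ≫ f = f) :
    ∃! k : T.T ⟶ X, k ≫ pX = T.str ∧ T.q ≫ k = pullback.fst p B.π ≫ f :=
  T.universal X pX (pullback.fst p B.π ≫ f) (by simp [hf]) fun g ↦ by
    rw [diagonalAction, pullback.map, pullback.lift_fst_assoc, Category.assoc, hinv]

/-- The morphism from the twist of `Y` to `X` induced by a `G`-invariant morphism `f : Y ⟶ X` of
`S`-schemes. -/
def Twist.map {Y : Scheme.{0}} {p : Y ⟶ S} {ρ : G →* Aut Y}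
    {hρ : ∀ g, (ρ g).hom ≫ p = p} {B : PrincipalBundle G S} (T : Twist p ρ hρ B)
    {X : Scheme.{0}} (pX : X ⟶ S) (f : Y ⟶ X) (hf : f ≫ pX = p)
    (hinv : ∀ g, (ρ g).hom ≫ f = f) : T.T ⟶ X :=
  (T.exists_map pX f hf hinv).choose

/-- The twist `Y_t` of `Y` by a class `t ∈ H¹(S, Aut(f))`, for a morphism `f : Y ⟶ X` of
`S`-schemes. -/
abbrev CoverTwist {X Y : Scheme.{0}} {pX : X ⟶ S} {pY : Y ⟶ S} (f : Y ⟶ X) (hf : f ≫ pX = pY)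
    (t : H1 (AutOver f) S) : Type 1 :=
  Twist pY (autAction f) (autAction_comp_of_comp hf) t.bundle

/-- The twist `f_t : Y_t ⟶ X` of the `Aut(f)`-invariant morphism `f`. -/
abbrev CoverTwist.toBase {X Y : Scheme.{0}} {pX : X ⟶ S} {pY : Y ⟶ S} {f : Y ⟶ X}
    {hf : f ≫ pX = pY} {t : H1 (AutOver f) S} (T : CoverTwist f hf t) : T.T ⟶ X :=
  Twist.map T pX f hf (autAction_comp f)

end Twists

/-! ### Hermitian line bundles and heights -/

section Heights

variable {K : Type} [Field K]

variable (K) in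
/-- `Spec 𝒪_K`. -/
abbrev specInt : Scheme.{0} := Spec (.of (𝓞 K))

/-- The morphism `Spec ℂ ⟶ Spec 𝒪_K` given by an embedding `σ : K → ℂ`. -/
def specEmbedding (σ : K →+* ℂ) : Spec (.of ℂ) ⟶ specInt K :=
  Spec.map (CommRingCat.ofHom (σ.comp (algebraMap (𝓞 K) K)))

/-- The complex conjugation on `Spec ℂ`. -/
def specConj : Spec (.of ℂ) ⟶ Spec (.of ℂ) :=
  Spec.map (CommRingCat.ofHom (starRingEnd ℂ))

lemma specConj_comp_specEmbedding (σ : K →+* ℂ) :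
    specConj ≫ specEmbedding σ = specEmbedding (ComplexEmbedding.conjugate σ) := by
  rw [specConj, specEmbedding, specEmbedding, ← Spec.map_comp]
  rfl

variable {X : Scheme.{0}} (str : X ⟶ specInt K)

/-- The set `X_σ(ℂ)` of complex points of an `𝒪_K`-scheme `X` with respect to an embedding
`σ : K → ℂ`. -/
def ComplexPoints (σ : K →+* ℂ) : Type :=
  {x : Spec (.of ℂ) ⟶ X // x ≫ str = specEmbedding σ}

variable {str}

/-- The complex point `x` lies in the open subset `U`. -/
def ComplexPoints.Mem {σ : K →+* ℂ} (x : ComplexPoints str σ) (U : X.Opens) : Prop :=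
  ⊤ ≤ x.1 ⁻¹ᵁ U

/-- The value `f(x) ∈ ℂ` of a function `f` on `U` at a complex point `x` of `U`. -/
def ComplexPoints.eval {σ : K →+* ℂ} (x : ComplexPoints str σ) {U : X.Opens} (h : x.Mem U)
    (f : Γ(X, U)) : ℂ :=
  (Scheme.ΓSpecIso (.of ℂ)).hom ((x.1.appLE U ⊤ h) f)

/-- The analytic topology on `X_σ(ℂ)` (for `X` locally of finite type), generated by the subsets
`{x ∈ U_σ(ℂ) : f(x) ∈ W}` for `U` Zariski-open, `f` a function on `U` and `W ⊆ ℂ` open. -/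
instance (σ : K →+* ℂ) : TopologicalSpace (ComplexPoints str σ) :=
  TopologicalSpace.generateFrom
    {V | ∃ (U : X.Opens) (f : Γ(X, U)) (W : Set ℂ), IsOpen W ∧
      V = {x | ∃ h : x.Mem U, x.eval h f ∈ W}}

/-- The complex conjugate of a complex point. -/
def ComplexPoints.conj {σ : K →+* ℂ} (x : ComplexPoints str σ) :
    ComplexPoints str (ComplexEmbedding.conjugate σ) :=
  ⟨specConj ≫ x.1, by rw [Category.assoc, x.2, specConj_comp_specEmbedding]⟩

lemma ComplexPoints.Mem.conj {σ : K →+* ℂ} {x : ComplexPoints str σ} {U : X.Opens}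
    (h : x.Mem U) : x.conj.Mem U :=
  fun _ _ ↦ h (Set.mem_univ _)

/-- The fibre of `L` at a complex point `x`, that is, the global sections of `x^* L`. -/
abbrev ComplexPoints.fiber {σ : K →+* ℂ} (x : ComplexPoints str σ) (L : X.Modules) : Type :=
  Γ((Scheme.Modules.pullback x.1).obj L, ⊤)

/-- The value at a complex point `x` of `U` of a section of `L` over `U`. -/
def ComplexPoints.value {σ : K →+* ℂ} (x : ComplexPoints str σ) (L : X.Modules) {U : X.Opens}
    (h : x.Mem U) (s : Γ(L, U)) : x.fiber L :=
  pullbackSection x.1 L U ⊤ h s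

variable (str)

/-- A Hermitian line bundle on an `𝒪_K`-scheme: a line bundle together with, for every embedding
`σ : K → ℂ`, a continuous metric on the line bundle it induces on `X_σ(ℂ)`, compatibly with complex
conjugation. -/
structure HermitianLineBundle where
  /-- The underlying line bundle. -/
  L : X.Modules
  isLineBundle : IsLineBundle L
  /-- The norm on the fibre of `L` at a complex point. -/
  norm : ∀ (σ : K →+* ℂ) (x : ComplexPoints str σ), x.fiber L → ℝ
  norm_add_le : ∀ σ x v w, norm σ x (v + w) ≤ norm σ x v + norm σ x w
  norm_smul : ∀ σ x (a : Γ(Spec (.of ℂ), ⊤)) (v : x.fiber L),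
    norm σ x (a • v) = ‖((Scheme.ΓSpecIso (.of ℂ)).hom a : ℂ)‖ * norm σ x v
  eq_zero_of_norm : ∀ σ x v, norm σ x v = 0 → v = 0
  continuous_norm : ∀ (σ : K →+* ℂ) (U : X.Opens) (s : Γ(L, U)),
    Continuous fun x : {x : ComplexPoints str σ // x.Mem U} ↦ norm σ x.1 (x.1.value L x.2 s)
  norm_conj : ∀ (σ : K →+* ℂ) (x : ComplexPoints str σ) (U : X.Opens) (h : x.Mem U)
    (s : Γ(L, U)), norm _ x.conj (x.conj.value L h.conj s) = norm σ x (x.value L h s)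

variable {str}

/-- An `𝒪_K`-valued point of an `𝒪_K`-scheme. -/
abbrev IntPoint (str : X ⟶ specInt K) : Type := {P : specInt K ⟶ X // P ≫ str = 𝟙 _}

/-- The complex point `σ^* P` given by an `𝒪_K`-point `P` and an embedding `σ`. -/
def IntPoint.complexPoint (P : IntPoint str) (σ : K →+* ℂ) : ComplexPoints str σ :=
  ⟨specEmbedding σ ≫ P.1, by rw [Category.assoc, P.2, Category.comp_id]⟩

/-- The `𝒪_K`-module of global sections of `P^* L`. -/
abbrev IntPoint.sections (P : IntPoint str) (L : X.Modules) : Type :=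
  Γ((Scheme.Modules.pullback P.1).obj L, ⊤)

/-- The norm `‖s‖_σ` of a section `s` of the pull-back of a Hermitian line bundle along an
`𝒪_K`-point. -/
def HermitianLineBundle.sectionNorm (H : HermitianLineBundle str) (P : IntPoint str)
    (σ : K →+* ℂ) (s : P.sections H.L) : ℝ :=
  H.norm σ (P.complexPoint σ)
    ((((Scheme.Modules.pullbackComp (specEmbedding σ) P.1).hom.app H.L).app ⊤)
      (pullbackSection (specEmbedding σ) _ ⊤ ⊤ le_rfl s))

variable [NumberField K]

/-- The Arakelov degree of the pull-back `P^* H` of a Hermitian line bundle `H` along an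
`𝒪_K`-point `P`, namely `log #(P^* L / s 𝒪_K) - ∑_σ log ‖s‖_σ` for a non-zero section `s` of
`P^* L`. It does not depend on the choice of `s`. -/
def HermitianLineBundle.degree (H : HermitianLineBundle str) (P : IntPoint str) : ℝ :=
  let s : P.sections H.L := Classical.epsilon fun s ↦ s ≠ 0
  Real.log (Nat.card (P.sections H.L ⧸ Submodule.span Γ(specInt K, ⊤) {s})) -
    ∑ σ : K →+* ℂ, Real.log (H.sectionNorm P σ s)

/-- The morphism `Spec R ⟶ Spec 𝒪_K`, for a subring `R` of `K` containing `𝒪_K`. -/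
def specSubringToInt (R : Subalgebra (𝓞 K) K) : Spec (.of R) ⟶ specInt K :=
  Spec.map (CommRingCat.ofHom (algebraMap (𝓞 K) R))

/-- The morphism `Spec K ⟶ Spec R`, for a subring `R` of `K` containing `𝒪_K`. -/
def specFieldToSubring (R : Subalgebra (𝓞 K) K) : Spec (.of K) ⟶ Spec (.of R) :=
  Spec.map (CommRingCat.ofHom (algebraMap R K))

variable (K) in
/-- The generic point `Spec K ⟶ Spec 𝒪_K`. -/
def specFieldToInt : Spec (.of K) ⟶ specInt K :=
  Spec.map (CommRingCat.ofHom (algebraMap (𝓞 K) K))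

open Classical in
/-- The height of a `K`-point `P` of `X` with respect to a Hermitian line bundle: the normalized
degree of the pull-back along the `𝒪_K`-point extending `P`. For `X` proper over `𝒪_K`, such an
extension exists and is unique. -/
def HermitianLineBundle.height (H : HermitianLineBundle str) (P : Spec (.of K) ⟶ X) : ℝ :=
  if h : ∃ Q : IntPoint str, specFieldToInt K ≫ Q.1 = P then
    H.degree h.choose / Module.finrank ℚ K
  else 0

/-- The set `U(R)` of `R`-points of an open subset `U` of an `𝒪_K`-scheme, for a subring `R` of
`K` containing `𝒪_K`. -/
def RingPoints (str : X ⟶ specInt K) (U : X.Opens) (R : Subalgebra (𝓞 K) K) : Type :=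
  {P : Spec (.of R) ⟶ (U : Scheme.{0}) // P ≫ U.ι ≫ str = specSubringToInt R}

/-- The `K`-point of `X` given by an `R`-point of `U`. -/
def RingPoints.generic {U : X.Opens} {R : Subalgebra (𝓞 K) K} (P : RingPoints str U R) :
    Spec (.of K) ⟶ X :=
  specFieldToSubring R ≫ P.1 ≫ U.ι

/-- The counting function `log⁺ # {P ∈ U(R) : h(P) ≤ c}`. -/
def HermitianLineBundle.count (H : HermitianLineBundle str) (U : X.Opens)
    (R : Subalgebra (𝓞 K) K) (c : ℝ) : EReal :=
  ENNReal.log (max 1 (({P : RingPoints str U R | H.height P.generic ≤ c}.encard : ℕ∞) : ENNReal))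

/-- The growth rate of `R`-points of `U`. -/
def HermitianLineBundle.growth (H : HermitianLineBundle str) (U : X.Opens)
    (R : Subalgebra (𝓞 K) K) : EReal :=
  Filter.limsup (fun c : ℝ ↦ H.count U R c / (c : EReal)) Filter.atTop

end Heights

/-! ### Growth rates of integral points -/

section Growth

variable {K : Type} [Field K] [NumberField K] {X : Scheme.{0}}

/-- A model of `(X, L, U)`, where `X` is a `K`-scheme, `L` a line bundle on `X` and `U` an open
subset of `X`: a proper and flat `𝒪_K`-scheme, a Hermitian line bundle and an open subset on it,
whose generic fibres are `X`, `L` and `U`. -/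
structure Model (p : X ⟶ Spec (.of K)) (L : X.Modules) (U : X.Opens) where
  /-- The `𝒪_K`-scheme. -/
  𝒳 : Scheme.{0}
  /-- Its structure morphism. -/
  str : 𝒳 ⟶ specInt K
  isProper : IsProper str
  flat : Flat str
  /-- The identification of `X` with the generic fibre. -/
  j : X ⟶ 𝒳
  isPullback : IsPullback j p str (specFieldToInt K)
  /-- The Hermitian line bundle. -/
  ℒ : HermitianLineBundle str
  iso : Nonempty ((Scheme.Modules.pullback j).obj ℒ.L ≅ L)
  /-- The open subset. -/
  𝒰 : 𝒳.Opens
  preimage : j ⁻¹ᵁ 𝒰 = U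

/-- The growth rate of the `S`-integral points of a model, for the finite set of places of `K`
consisting of `S` and of the Archimedean ones. -/
def Model.growth {p : X ⟶ Spec (.of K)} {L : X.Modules} {U : X.Opens} (M : Model p L U)
    (S : Finset (IsDedekindDomain.HeightOneSpectrum (𝓞 K))) : EReal :=
  M.ℒ.growth M.𝒰 ((S : Set (IsDedekindDomain.HeightOneSpectrum (𝓞 K))).integer K)

/-- The growth rate of integral points of `U` with respect to `X` and `L`: the supremum, over all
finite sets of places `S` containing the Archimedean ones, of the growth rate of the `S`-integral
points of a model. As it does not depend on the model, the supremum is also taken over all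
models. -/
def grint (p : X ⟶ Spec (.of K)) (L : X.Modules) (U : X.Opens) : EReal :=
  ⨆ (M : Model p L U) (S : Finset (IsDedekindDomain.HeightOneSpectrum (𝓞 K))), M.growth S

end Growth

end GrowthRates

end

/-!
The statement is a form of the Chevalley–Weil theorem. Let `P` be an `S`-integral point of a model
`𝒰` of `U`, with generic point `x`. Since `f` is Galois, and étale over `U`, the fibre of `f` at
`x` is the spectrum of a Galois algebra over `K` with group `G = Aut(f)`
(`isGaloisExtension_fibre`), that is, a principal `G`-bundle, and `x` lifts to a rational point of
the twist of `Y` by the class of this bundle (`CoverTwist.exists_lift`).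

Only finitely many classes occur for fixed `S` (`finite_setOf_bundle_fibre`). The freeness of the
action of `G` on a ring is witnessed by elements `x i`, `y i` such that `∑ x i * σ g (y i)` is `1`
for `g = 1` and `0` otherwise. Such elements exist over the members of a finite affine cover of
`𝒰`, with bounded denominators. They restrict to the fibres at integral points and show that these
fibres are unramified outside a fixed finite set of primes (`exists_finset_isIntegralAtPrime`).
The different of the corresponding Galois extensions `E/K` is then bounded in terms of their
degree (`differentIdeal_dvd_of_forall_prime`), so that there are only finitely many of them by
Hermite's theorem, and a Galois algebra is determined by one of these fields and a map from the
Galois group to `G` (`finite_setOf_orbitRange`).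

The twist by each of these classes exists as the relative spectrum of an algebra of invariants and
is finite over `X` (`exists_coverTwist`). A finite morphism `a : T ⟶ X` extends to a finite
morphism from a flat model of `T` to the given model of `X` (`exists_finite_extension`), along
which integral points lift as soon as their generic points do (`RingPoints.exists_lift`). The
pull-back of the Hermitian line bundle does not change heights
(`HermitianLineBundle.height_pullback`). For this the degree is shown not to depend on the section
that computes it (`degreeOf_eq`, by the product formula). Hence the points which lift to `T` are
at most as many as the points of bounded height of a model of `T` (`Model.exists_pullback`).

The counting function of the model is thus at most a finite sum of counting functions of models of
twists, and its exponential rate of growth is at most that of one of them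
(`exists_limsup_log_le`).
-/

namespace GrowthRates

/-! ### Ramification and finiteness of fields -/

section Ramification

open scoped nonZeroDivisors Pointwise

/-- In a Dedekind domain divisibility of ideals may be tested on prime powers. -/
theorem ideal_dvd_of_forall_prime_pow_dvd {R : Type*} [CommRing R] [IsDedekindDomain R]
    {I J : Ideal R} (hI : I ≠ 0)
    (h : ∀ (P : Ideal R) (m : ℕ), Prime P → P ^ m ∣ I → P ^ m ∣ J) : I ∣ J := by
  classical
  induction I using UniqueFactorizationMonoid.induction_on_coprime with
  | h0 => exact absurd rfl hI
  | h1 hx => exact hx.dvd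
  | hpr i hp => exact h _ i hp dvd_rfl
  | hcp hxy hx hy =>
    have hx0 := left_ne_zero_of_mul hI
    have hy0 := right_ne_zero_of_mul hI
    exact hxy.mul_dvd (hx hx0 fun P m hP hd ↦ h P m hP (hd.mul_right _))
      (hy hy0 fun P m hP hd ↦ h P m hP (hd.mul_left _))

/-- The element `z` of a `K`-algebra is integral at the prime `𝔭` of `𝓞 K`: it becomes integral
after multiplication by some `s ∉ 𝔭`. -/
def IsIntegralAtPrime {K L : Type*} [Field K] [CommRing L] [Algebra K L] (𝔭 : Ideal (𝓞 K)) (z : L) :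
    Prop :=
  ∃ s : 𝓞 K, s ∉ 𝔭 ∧ IsIntegral ℤ (algebraMap K L s * z)

variable {K E : Type*} [Field K] [NumberField K] [Field E] [NumberField E] [Algebra K E]

/-- Membership in the different in terms of traces: `b` lies in the different of `E/K` if and only
if it multiplies the trace dual of `𝓞 E` into `𝓞 E`. -/
theorem mem_differentIdeal_iff {b : 𝓞 E} : b ∈ differentIdeal (𝓞 K) (𝓞 E) ↔
    ∀ x : E, (∀ a : 𝓞 E, IsIntegral ℤ (Algebra.trace K E (x * a))) →
      IsIntegral ℤ ((b : E) * x) := by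
  have h1 : b ∈ differentIdeal (𝓞 K) (𝓞 E) ↔
      (b : E) ∈ (1 / Submodule.traceDual (𝓞 K) K 1 : Submodule (𝓞 E) E) := by
    rw [← coeSubmodule_differentIdeal (𝓞 K) K (𝓞 E)]
    refine ⟨fun h ↦ ⟨b, h, rfl⟩, fun ⟨c, hc, h⟩ ↦ ?_⟩
    rwa [← (FaithfulSMul.algebraMap_injective (𝓞 E) E) h]
  rw [h1, Submodule.mem_div_iff_forall_mul_mem]
  refine forall_congr' fun x ↦ imp_congr ?_ ?_
  · rw [Submodule.mem_traceDual]
    simp only [Submodule.mem_one, Algebra.traceForm_apply, RingHom.mem_range, forall_exists_index,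
      forall_apply_eq_imp_iff]
    refine forall_congr' fun a ↦ ?_
    rw [← IsIntegrallyClosed.isIntegral_iff (R := 𝓞 K)]
    exact ⟨fun h ↦ isIntegral_trans _ h, fun h ↦ h.tower_top⟩
  · rw [Submodule.mem_one, ← IsIntegrallyClosed.isIntegral_iff (R := 𝓞 E)]
    exact ⟨fun h ↦ isIntegral_trans _ h, fun h ↦ h.tower_top⟩

/-- If the extension of an ideal `𝔞` of `𝓞 K` divides the different of `E/K`, then `[E : K] ∈ 𝔞`:
elements `y ∈ 𝔞⁻¹` lie in the trace dual of `𝓞 E`, so that `Tr(y) = [E : K] y` is integral. This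
bounds the exponents of the different at wildly ramified primes. -/
theorem dvd_finrank_of_map_dvd_differentIdeal {𝔞 : Ideal (𝓞 K)} (h𝔞 : 𝔞 ≠ ⊥)
    (h : 𝔞.map (algebraMap (𝓞 K) (𝓞 E)) ∣ differentIdeal (𝓞 K) (𝓞 E)) :
    𝔞 ∣ Ideal.span {(Module.finrank K E : 𝓞 K)} := by
  have hI : 𝔞.map (algebraMap (𝓞 K) (𝓞 E)) ≠ ⊥ := by
    rwa [Ne, Ideal.map_eq_bot_iff_of_injective (FaithfulSMul.algebraMap_injective (𝓞 K) (𝓞 E))]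
  have h1 := (differentialIdeal_le_iff (K := K) (L := E) hI).mp (Ideal.le_of_dvd h)
  have h𝔞' : (𝔞 : FractionalIdeal (𝓞 K)⁰ K) ≠ 0 := by simpa using h𝔞
  have h2 : ∀ y ∈ ((𝔞 : FractionalIdeal (𝓞 K)⁰ K)⁻¹),
      (Module.finrank K E : K) * y ∈ (1 : FractionalIdeal (𝓞 K)⁰ K) := by
    intro y hy
    have hy' : algebraMap K E y ∈ ((𝔞.map (algebraMap (𝓞 K) (𝓞 E)) :
        FractionalIdeal (𝓞 E)⁰ E)⁻¹) := by
      rw [FractionalIdeal.mem_inv_iff (by simpa using hI)]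
      rw [FractionalIdeal.mem_inv_iff h𝔞'] at hy
      rintro _ ⟨b, hb, rfl⟩
      simp only [SetLike.mem_coe] at hb
      refine Submodule.span_induction (p := fun b _ ↦ algebraMap K E y * algebraMap (𝓞 E) E b ∈
        (1 : FractionalIdeal (𝓞 E)⁰ E)) ?_ ?_ ?_ ?_ hb
      · rintro _ ⟨c, hc, rfl⟩
        obtain ⟨d, hd⟩ := (FractionalIdeal.mem_one_iff _).mp (hy _ ⟨c, hc, rfl⟩)
        refine (FractionalIdeal.mem_one_iff _).mpr ⟨algebraMap (𝓞 K) (𝓞 E) d, ?_⟩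
        have := congrArg (algebraMap K E) hd
        rw [map_mul] at this
        exact this
      · simp
      · intro u v _ _ hu hv
        rw [map_add, mul_add]
        exact Submodule.add_mem _ hu hv
      · intro a u _ hu
        have := Submodule.smul_mem (1 : FractionalIdeal (𝓞 E)⁰ E).coeToSubmodule a hu
        rwa [Algebra.smul_def, mul_left_comm, ← map_mul] at this
    have h3 := h1 ⟨_, hy', rfl⟩
    rw [FractionalIdeal.mem_one_iff]
    rw [Submodule.mem_one] at h3
    obtain ⟨z, hz⟩ := h3
    refine ⟨z, hz.trans ?_⟩
    simp [Algebra.trace_algebraMap]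
  rw [Ideal.dvd_span_singleton]
  have h3 : FractionalIdeal.spanSingleton (𝓞 K)⁰ (Module.finrank K E : K) *
      (𝔞 : FractionalIdeal (𝓞 K)⁰ K)⁻¹ ≤ 1 := by
    rw [FractionalIdeal.mul_le]
    intro i hi j hj
    obtain ⟨z, rfl⟩ := (FractionalIdeal.mem_spanSingleton _).mp hi
    rw [smul_mul_assoc]
    exact Submodule.smul_mem (1 : FractionalIdeal (𝓞 K)⁰ K).coeToSubmodule z (h2 j hj)
  have h4 : FractionalIdeal.spanSingleton (𝓞 K)⁰ (Module.finrank K E : K) ≤ 𝔞 := by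
    have := mul_le_mul_left h3 (𝔞 : FractionalIdeal (𝓞 K)⁰ K)
    rwa [mul_assoc, inv_mul_cancel₀ h𝔞', mul_one, one_mul] at this
  obtain ⟨z, hz, hz'⟩ := h4 (FractionalIdeal.mem_spanSingleton_self _ _)
  have : z = (Module.finrank K E : 𝓞 K) :=
    FaithfulSMul.algebraMap_injective (𝓞 K) K (hz'.trans (by simp))
  exact this ▸ hz

/-- The different of a Galois extension is invariant under the Galois group. -/
theorem smul_differentIdeal (σ : Gal(E/K)) :
    σ • differentIdeal (𝓞 K) (𝓞 E) = differentIdeal (𝓞 K) (𝓞 E) := by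
  have h : ∀ σ : Gal(E/K), σ • differentIdeal (𝓞 K) (𝓞 E) ≤ differentIdeal (𝓞 K) (𝓞 E) := by
    intro σ b hb
    rw [Ideal.mem_pointwise_smul_iff_inv_smul_mem, mem_differentIdeal_iff] at hb
    rw [mem_differentIdeal_iff]
    intro x hx
    have key (τ : Gal(E/K)) (a : 𝓞 E) : ((τ • a : 𝓞 E) : E) = τ (a : E) := rfl
    have := hb (σ⁻¹ x) fun a ↦ by
      have := hx (σ • a)
      rw [← Algebra.trace_eq_of_algEquiv σ⁻¹, map_mul, key, ← AlgEquiv.mul_apply,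
        inv_mul_cancel] at this
      exact this
    have h2 := this.map (σ.toAlgHom.restrictScalars ℤ)
    have h3 : (σ.toAlgHom.restrictScalars ℤ) ((σ⁻¹ • b : 𝓞 E) * σ⁻¹ x : E) = b * x := by
      change σ ((σ⁻¹ • b : 𝓞 E) * σ⁻¹ x : E) = b * x
      rw [key, map_mul, ← AlgEquiv.mul_apply, ← AlgEquiv.mul_apply, mul_inv_cancel]
      rfl
    rwa [h3] at h2
  refine (h σ).antisymm fun b hb ↦ ?_
  rw [Ideal.mem_pointwise_smul_iff_inv_smul_mem]
  exact h σ⁻¹ (Ideal.smul_mem_pointwise_smul _ _ _ hb)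

/-- If elements `x i`, `y i`, integral at `𝔭`, satisfy `∑ x i * y i = 1` and `∑ x i * σ (y i) = 0`
for `σ ≠ 1`, then `E/K` is unramified at `𝔭`, in the sense that the different contains an element of
`𝓞 K` outside `𝔭`. -/
theorem exists_mem_differentIdeal_of_isIntegralAtPrime [IsGalois K E] {𝔭 : Ideal (𝓞 K)} [𝔭.IsPrime]
    {ι : Type*} (T : Finset ι) (x y : ι → E)
    (hx : ∀ i ∈ T, IsIntegralAtPrime 𝔭 (x i)) (hy : ∀ i ∈ T, IsIntegralAtPrime 𝔭 (y i))
    (h1 : ∑ i ∈ T, x i * y i = 1) (h0 : ∀ σ : Gal(E/K), σ ≠ 1 → ∑ i ∈ T, x i * σ (y i) = 0) :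
    ∃ s : 𝓞 K, s ∉ 𝔭 ∧ algebraMap (𝓞 K) (𝓞 E) s ∈ differentIdeal (𝓞 K) (𝓞 E) := by
  classical
  choose! s hs hsx using hx
  choose! t ht hty using hy
  have hcast (u : 𝓞 K) : IsIntegral ℤ (algebraMap K E u) :=
    u.isIntegral_coe.map (Algebra.ofId K E |>.restrictScalars ℤ)
  refine ⟨∏ i ∈ T, (s i * t i), ?_, mem_differentIdeal_iff.mpr fun z hz ↦ ?_⟩
  · simp only [Ideal.IsPrime.prod_mem_iff, not_exists, not_and]
    exact fun i hi ↦ ‹𝔭.IsPrime›.mul_notMem (hs i hi) (ht i hi)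
  -- Expanding the trace as a sum over the Galois group shows that `x` and `y` are dual bases: an
  -- element `z` of the trace dual is a combination of the `x i` with coefficients `Tr (z * y i)`.
  have key : z = ∑ i ∈ T, x i * algebraMap K E (Algebra.trace K E (z * y i)) := by
    simp_rw [trace_eq_sum_automorphisms, Finset.mul_sum]
    rw [Finset.sum_comm]
    have : ∀ σ : Gal(E/K), ∑ i ∈ T, x i * σ (z * y i) = if σ = 1 then z else 0 := by
      intro σ
      simp_rw [map_mul, mul_left_comm _ (σ z), ← Finset.mul_sum]
      split_ifs with hσ
      · simp [hσ, h1]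
      · simp [h0 σ hσ]
    simp only [this, Finset.sum_ite_eq', Finset.mem_univ, if_true]
  have e : ((algebraMap (𝓞 K) (𝓞 E) (∏ i ∈ T, (s i * t i)) : 𝓞 E) : E) =
      algebraMap K E (∏ i ∈ T, (s i * t i) : 𝓞 K) := rfl
  rw [e, key, Finset.mul_sum]
  refine IsIntegral.sum _ fun i hi ↦ ?_
  rw [← Finset.mul_prod_erase T _ hi]
  have e2 : algebraMap K E ((s i * t i * ∏ j ∈ T.erase i, (s j * t j) : 𝓞 K) : K) *
      (x i * algebraMap K E (Algebra.trace K E (z * y i))) =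
      algebraMap K E (∏ j ∈ T.erase i, (s j * t j) : 𝓞 K) * (algebraMap K E (s i) * x i) *
      algebraMap K E (Algebra.trace K E (z * (algebraMap K E (t i) * y i))) := by
    rw [mul_left_comm z, ← Algebra.smul_def (t i : K), map_smul, smul_eq_mul,
      map_mul (algebraMap K E)]
    push_cast
    ring
  rw [e2]
  refine ((hcast _).mul (hsx i hi)).mul ?_
  exact (hz ⟨_, hty i hi⟩).map (Algebra.ofId K E |>.restrictScalars ℤ)

/-- If `E/K` is Galois and unramified outside `S`, its different divides the extension of `[E : K] *
∏ 𝔭 ∈ S, 𝔭` to `𝓞 E`, an ideal which depends on `E` only through its degree. -/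
theorem differentIdeal_dvd_of_forall_prime [IsGalois K E] (S : Finset (Ideal (𝓞 K)))
    (hS : ∀ 𝔭 : Ideal (𝓞 K), 𝔭.IsPrime → 𝔭 ≠ ⊥ → 𝔭 ∉ S →
      ∃ s : 𝓞 K, s ∉ 𝔭 ∧ algebraMap (𝓞 K) (𝓞 E) s ∈ differentIdeal (𝓞 K) (𝓞 E)) :
    differentIdeal (𝓞 K) (𝓞 E) ∣ (Ideal.span {(Module.finrank K E : 𝓞 K)} *
      ∏ 𝔭 ∈ S, 𝔭).map (algebraMap (𝓞 K) (𝓞 E)) := by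
  classical
  refine ideal_dvd_of_forall_prime_pow_dvd differentIdeal_ne_bot fun Q m hQ hm ↦ ?_
  rcases Nat.eq_zero_or_pos m with rfl | hmpos
  · simp
  have hQp : Q.IsPrime := Ideal.isPrime_of_prime hQ
  set 𝔭 := Q.under (𝓞 K) with h𝔭
  have hpp : 𝔭.IsPrime := inferInstance
  have hp0 : 𝔭 ≠ ⊥ := fun h0 ↦ hQ.ne_zero <| Ideal.eq_bot_of_comap_eq_bot (R := 𝓞 K) h0
  have hpS : 𝔭 ∈ S := by
    by_contra hpS
    obtain ⟨s, hs, hsD⟩ := hS 𝔭 hpp hp0 hpS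
    exact hs (Ideal.le_of_dvd ((dvd_pow_self Q hmpos.ne').trans hm) hsD)
  -- Let `e0` be the ramification index of `Q` and write `m = e0 * (m / e0) + m % e0`. As the
  -- different is Galois-invariant, it is divisible by the extension `J ^ (m / e0)` of
  -- `𝔭 ^ (m / e0)`, so `𝔭 ^ (m / e0)` divides the degree; the remaining factor
  -- `Q ^ (m % e0)` divides `J`.
  set J := 𝔭.map (algebraMap (𝓞 K) (𝓞 E)) with hJ
  have hJ0 : J ≠ 0 := by
    rwa [Ne, Ideal.zero_eq_bot, Ideal.map_eq_bot_iff_of_injective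
      (FaithfulSMul.algebraMap_injective (𝓞 K) (𝓞 E))]
  have hQJ : Q ∣ J := Ideal.dvd_iff_le.mpr Ideal.map_comap_le
  obtain ⟨e, he, he'⟩ := (FiniteMultiplicity.of_prime_left hQ hJ0).exists_eq_pow_mul_and_not_dvd
  have he0 : 0 < multiplicity Q J := by
    rw [← Nat.one_le_iff_ne_zero.trans Nat.pos_iff_ne_zero.symm]
    exact (FiniteMultiplicity.of_prime_left hQ hJ0).le_multiplicity_of_pow_dvd (by simpa using hQJ)
  generalize multiplicity Q J = e0 at he he0
  have hle : ∀ {P : Ideal (𝓞 E)} {k : ℕ}, Q ^ k ∣ P ↔ P ≤ Q ^ k := Ideal.dvd_iff_le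
  have hJk (k l : ℕ) (h : Q ^ l ∣ J ^ k) : l ≤ k * e0 := by
    have h2 : ¬ Q ∣ e ^ k := fun h3 ↦ he' (hQ.dvd_of_dvd_pow h3)
    rw [he, mul_pow, ← pow_mul, mul_comm e0] at h
    by_contra! hlt
    have h4 := (pow_dvd_pow Q (Nat.succ_le_of_lt hlt)).trans h
    rw [Nat.succ_eq_add_one, pow_succ] at h4
    exact h2 ((mul_dvd_mul_iff_left (pow_ne_zero _ hQ.ne_zero)).mp h4)
  have hgJ (g : Gal(E/K)) : g • J = J := by
    rw [Ideal.pointwise_smul_def, hJ, Ideal.map_map]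
    congr 1
    ext x
    simp
  have hJD : J ^ (m / e0) ∣ differentIdeal (𝓞 K) (𝓞 E) := by
    refine ideal_dvd_of_forall_prime_pow_dvd (pow_ne_zero _ hJ0) fun P l hP hl ↦ ?_
    rcases Nat.eq_zero_or_pos l with rfl | hlpos
    · simp
    have hPp : P.IsPrime := Ideal.isPrime_of_prime hP
    have hPJ : P ∣ J := hP.dvd_of_dvd_pow ((dvd_pow_self P hlpos.ne').trans hl)
    have hpm : 𝔭.IsMaximal := hpp.isMaximal hp0
    have hPu : 𝔭 = P.under (𝓞 K) := hpm.eq_of_le (Ideal.IsPrime.ne_top inferInstance)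
      (Ideal.map_le_iff_le_comap.mp (Ideal.dvd_iff_le.mp hPJ))
    -- The prime factors of `J` are conjugate to `Q`.
    obtain ⟨g, rfl⟩ := Algebra.IsInvariant.exists_smul_of_under_eq (𝓞 K) (𝓞 E) Gal(E/K) Q P hPu
    have h1 : Q ^ l ∣ J ^ (m / e0) := by
      rw [Ideal.dvd_iff_le] at hl ⊢
      rwa [← smul_pow', ← hgJ g, ← smul_pow', Ideal.pointwise_smul_le_pointwise_smul_iff] at hl
    have h2 : l ≤ m := (hJk _ _ h1).trans (Nat.div_mul_le_self _ _)
    have h3 := (pow_dvd_pow Q h2).trans hm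
    rw [Ideal.dvd_iff_le] at h3 ⊢
    rwa [← smul_pow', ← smul_differentIdeal g, Ideal.pointwise_smul_le_pointwise_smul_iff]
  have hn : 𝔭 ^ (m / e0) ∣ Ideal.span {(Module.finrank K E : 𝓞 K)} :=
    dvd_finrank_of_map_dvd_differentIdeal (E := E) (pow_ne_zero _ hp0) (by rwa [Ideal.map_pow])
  have hQJ' : Q ^ e0 ∣ J := ⟨e, he⟩
  rw [Ideal.map_mul]
  nth_rw 1 [← Nat.div_add_mod m e0]
  rw [pow_add]
  refine mul_dvd_mul ?_ ?_
  · refine (pow_mul Q e0 _ ▸ pow_dvd_pow_of_dvd hQJ' _).trans ?_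
    rw [hJ, ← Ideal.map_pow, Ideal.dvd_iff_le]
    exact Ideal.map_mono (Ideal.le_of_dvd hn)
  · refine ((pow_dvd_pow Q (Nat.mod_lt m he0).le).trans hQJ').trans ?_
    rw [hJ, Ideal.dvd_iff_le]
    exact Ideal.map_mono (Ideal.le_of_dvd (Finset.dvd_prod_of_mem _ hpS))

/-- The discriminant of a Galois extension of bounded degree which is unramified outside `S` is
bounded. -/
theorem natAbs_discr_le_of_forall_prime [IsGalois K E] (S : Finset (Ideal (𝓞 K))) (hS0 : ⊥ ∉ S)
    (hS : ∀ 𝔭 : Ideal (𝓞 K), 𝔭.IsPrime → 𝔭 ≠ ⊥ → 𝔭 ∉ S →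
      ∃ s : 𝓞 K, s ∉ 𝔭 ∧ algebraMap (𝓞 K) (𝓞 E) s ∈ differentIdeal (𝓞 K) (𝓞 E)) {n : ℕ}
    (hn : Module.finrank K E ≤ n) : (discr E).natAbs ≤
      ((n ^ Module.finrank ℚ K * ∏ 𝔭 ∈ S, 𝔭.absNorm) * (discr K).natAbs) ^ n := by
  have h := differentIdeal_dvd_of_forall_prime S hS
  have hpos : 0 < Module.finrank K E := Module.finrank_pos
  have h0 : ∀ 𝔭 ∈ S, 0 < Ideal.absNorm 𝔭 := fun 𝔭 h𝔭 ↦ Nat.pos_of_ne_zero <| by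
    rw [Ne, Ideal.absNorm_eq_zero_iff]
    exact fun h ↦ hS0 (h ▸ h𝔭)
  have h1 : 0 < Module.finrank K E ^ Module.finrank ℚ K * ∏ 𝔭 ∈ S, 𝔭.absNorm :=
    Nat.mul_pos (pow_pos hpos _) (Finset.prod_pos h0)
  have hnorm : Ideal.absNorm ((Ideal.span {(Module.finrank K E : 𝓞 K)} *
      ∏ 𝔭 ∈ S, 𝔭).map (algebraMap (𝓞 K) (𝓞 E))) =
      (Module.finrank K E ^ Module.finrank ℚ K * ∏ 𝔭 ∈ S, 𝔭.absNorm) ^ Module.finrank K E := by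
    rw [Ideal.absNorm_algebraMap, map_mul, Ideal.absNorm_span_singleton, map_prod]
    rw [← IsFractionRing.finrank_eq (𝓞 K) K (𝓞 E) E, ← map_natCast (algebraMap ℤ (𝓞 K)),
      Algebra.norm_algebraMap, ← RingOfIntegers.rank K]
    simp [Int.natAbs_pow]
  have hle := Nat.le_of_dvd (by rw [hnorm]; exact pow_pos h1 _) (Ideal.absNorm_dvd_absNorm_of_le
    (Ideal.dvd_iff_le.mp h))
  rw [hnorm] at hle
  rw [natAbs_discr_eq_absNorm_differentIdeal_mul_natAbs_discr_pow K (𝓞 K) E (𝓞 E)]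
  have hd : 1 ≤ (discr K).natAbs := Nat.pos_of_ne_zero (by simpa using discr_ne_zero K)
  calc _ ≤ _ * (discr K).natAbs ^ Module.finrank K E := by gcongr
    _ = ((Module.finrank K E ^ Module.finrank ℚ K * ∏ 𝔭 ∈ S, 𝔭.absNorm) *
          (discr K).natAbs) ^ Module.finrank K E := (mul_pow _ _ _).symm
    _ ≤ ((Module.finrank K E ^ Module.finrank ℚ K * ∏ 𝔭 ∈ S, 𝔭.absNorm) *
          (discr K).natAbs) ^ n := pow_le_pow_right₀ (Nat.mul_pos h1 hd) hn
    _ ≤ _ := by gcongr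

/-- The Hermite–Minkowski theorem for Galois extensions of a number field: there are only finitely
many of bounded degree which are unramified outside `S`. -/
theorem finite_setOf_intermediateField (Ω : Type*) [Field Ω] [Algebra K Ω]
    (S : Finset (Ideal (𝓞 K))) (hS0 : ⊥ ∉ S) (n : ℕ) :
    {F : IntermediateField K Ω | ∃ (_ : FiniteDimensional K F) (_ : IsGalois K F)
      (_ : NumberField F), Module.finrank K F ≤ n ∧
      ∀ 𝔭 : Ideal (𝓞 K), 𝔭.IsPrime → 𝔭 ≠ ⊥ → 𝔭 ∉ S →
        ∃ s : 𝓞 K, s ∉ 𝔭 ∧ algebraMap (𝓞 K) (𝓞 F) s ∈ differentIdeal (𝓞 K) (𝓞 F)}.Finite := by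
  have : CharZero Ω := charZero_of_injective_algebraMap (algebraMap K Ω).injective
  let N := ((n ^ Module.finrank ℚ K * ∏ 𝔭 ∈ S, 𝔭.absNorm) * (discr K).natAbs) ^ n
  have hfin := NumberField.finite_of_discr_bdd Ω N
  refine Set.Finite.of_finite_image (f := fun F ↦ F.restrictScalars ℚ)
    ((hfin.image Subtype.val).subset ?_) ?_
  · rintro _ ⟨F, ⟨_, _, hF, hle, hF'⟩, rfl⟩
    refine ⟨⟨F.restrictScalars ℚ, hF.to_finiteDimensional⟩, ?_, rfl⟩
    have := natAbs_discr_le_of_forall_prime S hS0 hF' hle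
    change |discr F| ≤ N
    rw [← Int.natCast_natAbs]
    exact_mod_cast this
  · exact fun F _ F' _ h ↦ IntermediateField.restrictScalars_injective ℚ h

end Ramification

/-! ### Galois extensions of rings -/

section GaloisExtensions

open TensorProduct

variable {G R C : Type} [Group G] [CommRing R] [CommRing C]

/-- The action `σ` of `G` on the ring `C` is free in the sense of Chase, Harrison and Rosenberg:
there are elements `x i`, `y i` with `∑ x i * σ g (y i) = 1` for `g = 1` and `0` for `g ≠ 1`. In
this form freeness is inherited by every equivariant homomorphism `C → C'`. -/
def IsFreeRingAction (σ : G → C →+* C) : Prop :=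
  ∃ (n : ℕ) (x y : Fin n → C), ∑ i, x i * y i = 1 ∧ ∀ g, g ≠ 1 → ∑ i, x i * σ g (y i) = 0

/-- A right action `σ` of the group `G` on the ring `C` (so that it corresponds to a left action on
`Spec C`) makes the ring homomorphism `φ : R → C` a Galois extension: `R` is the ring of invariants
and the action is free. -/
structure IsGaloisExtension (φ : R →+* C) (σ : G → C →+* C) : Prop where
  map_one : ∀ c, σ 1 c = c
  map_mul : ∀ g h c, σ (g * h) c = σ h (σ g c)
  map_base : ∀ g r, σ g (φ r) = φ r
  injective : Function.Injective φ
  exists_eq : ∀ c, (∀ g, σ g c = c) → ∃ r, φ r = c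
  free : IsFreeRingAction σ

namespace IsGaloisExtension

variable {φ : R →+* C} {σ : G → C →+* C} (h : IsGaloisExtension φ σ)
include h

theorem inv_apply (g : G) (c : C) : σ g⁻¹ (σ g c) = c := by
  rw [← h.map_mul, mul_inv_cancel, h.map_one]

/-- The trace, with values in the ring of invariants `R`. -/
theorem exists_trace [Fintype G] : ∃ t : C →+ R, ∀ c, φ (t c) = ∑ g, σ g c := by
  have h1 (c : C) : ∃ r, φ r = ∑ g, σ g c := by
    refine h.exists_eq _ fun k ↦ ?_
    rw [map_sum]
    exact Fintype.sum_equiv (Equiv.mulRight k) _ _ fun g ↦ (h.map_mul g k c).symm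
  choose t ht using h1
  refine ⟨AddMonoidHom.mk' t fun a b ↦ h.injective ?_, ht⟩
  simp [ht, Finset.sum_add_distrib]

/-- The elements `x i` generate `C` over `R`, with coordinate functions `c ↦ tr (y i * c)`. -/
theorem exists_dual [Finite G] : ∃ (n : ℕ) (x : Fin n → C) (t : Fin n → C → R),
    (∀ i a b, t i (a + b) = t i a + t i b) ∧ (∀ i r a, t i (φ r * a) = r * t i a) ∧
      ∀ c, ∑ i, x i * φ (t i c) = c := by
  have := Fintype.ofFinite G
  classical
  obtain ⟨t, ht⟩ := h.exists_trace
  obtain ⟨n, x, y, h1, h0⟩ := h.free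
  refine ⟨n, x, fun i c ↦ t (y i * c), fun i a b ↦ by simp only [mul_add, map_add], fun i r a ↦
    h.injective ?_, fun c ↦ ?_⟩
  · rw [_root_.map_mul, ht, ht, Finset.mul_sum]
    refine Finset.sum_congr rfl fun g _ ↦ ?_
    simp only [_root_.map_mul, h.map_base]
    ring
  · simp_rw [ht, Finset.mul_sum]
    rw [Finset.sum_comm]
    have (g : G) : ∑ i, x i * σ g (y i * c) = if g = 1 then c else 0 := by
      simp_rw [_root_.map_mul, ← mul_assoc, ← Finset.sum_mul]
      split_ifs with hg
      · simp [hg, h.map_one, h1]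
      · simp [h0 g hg]
    rw [Finset.sum_congr rfl fun g _ ↦ this g]
    simp

theorem finite [Finite G] : φ.Finite := by
  obtain ⟨n, x, t, -, -, h3⟩ := h.exists_dual
  classical
  let := φ.toAlgebra
  refine ⟨⟨Finset.univ.image x, eq_top_iff.mpr fun c _ ↦ ?_⟩⟩
  rw [← h3 c]
  refine Submodule.sum_mem _ fun i _ ↦ ?_
  rw [mul_comm]
  exact Submodule.smul_mem _ (t i c) (Submodule.subset_span (by simp))

theorem flat [Finite G] : φ.Flat := by
  obtain ⟨n, x, t, h1, h2, h3⟩ := h.exists_dual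
  let := φ.toAlgebra
  let p : (Fin n → R) →ₗ[R] C := Fintype.linearCombination R x
  let s : C →ₗ[R] (Fin n → R) := LinearMap.pi fun i ↦
    { toFun := t i
      map_add' := h1 i
      map_smul' := fun r a ↦ h2 i r a }
  have : Module.Projective R C := Module.Projective.of_split s p <| by
    ext c
    simp only [p, s, LinearMap.comp_apply, Fintype.linearCombination_apply, LinearMap.pi_apply,
      LinearMap.id_apply]
    refine (Finset.sum_congr rfl fun i _ ↦ ?_).trans (h3 c)
    exact mul_comm _ _
  exact (inferInstance : Module.Flat R C)

theorem surjective_specMap [Finite G] : Surjective (Spec.map (CommRingCat.ofHom φ)) := by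
  refine ⟨?_⟩
  have h1 : φ.IsIntegral := h.finite.to_isIntegral
  exact h1.comap_surjective h.injective

/-- For a Galois extension `C` of `R` the homomorphism `C ⊗ C → ∏_{g ∈ G} C`, `a ⊗ b ↦ (σ g a *
b)_g` is an isomorphism. -/
theorem bijective_tensor [Finite G] :
    let := φ.toAlgebra
    Function.Bijective (RingHom.pi fun g ↦ (Algebra.TensorProduct.lift
      (⟨σ g, h.map_base g⟩ : C →ₐ[R] C) (AlgHom.id R C) fun _ _ ↦ .all _ _).toRingHom) := by
  let := φ.toAlgebra
  classical
  have := Fintype.ofFinite G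
  obtain ⟨n, x, y, h1, h0⟩ := h.free
  let θ (g : G) : C ⊗[R] C →ₐ[R] C := Algebra.TensorProduct.lift
      (⟨σ g, h.map_base g⟩ : C →ₐ[R] C) (AlgHom.id R C) fun _ _ ↦ .all _ _
  have hθ (g : G) (a b : C) : θ g (a ⊗ₜ b) = σ g a * b := by simp [θ]
  let e (g : G) : C ⊗[R] C := ∑ i, x i ⊗ₜ σ g (y i)
  obtain ⟨t, ht⟩ := h.exists_trace
  have key (z : C ⊗[R] C) : z = ∑ g, e g * (1 ⊗ₜ θ g z) := by
    induction z with
    | zero => simp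
    | add u v hu hv =>
      simp only [map_add, TensorProduct.tmul_add, mul_add, Finset.sum_add_distrib]
      rw [← hu, ← hv]
    | tmul a b =>
      have h2 : a = ∑ i, t (y i * a) • x i := by
        simp_rw [Algebra.smul_def]
        simp_rw [RingHom.algebraMap_toAlgebra, ht, Finset.sum_mul]
        rw [Finset.sum_comm]
        have (g : G) : ∑ i, σ g (y i * a) * x i = if g = 1 then a else 0 := by
          simp_rw [_root_.map_mul, mul_right_comm, mul_comm _ (x _), ← Finset.sum_mul]
          split_ifs with hg
          · simp [hg, h.map_one, h1]
          · simp [h0 g hg]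
        rw [Finset.sum_congr rfl fun g _ ↦ this g]
        simp
      conv_lhs => rw [h2, TensorProduct.sum_tmul]
      simp_rw [TensorProduct.smul_tmul, Algebra.smul_def, RingHom.algebraMap_toAlgebra, ht, hθ,
        Finset.sum_mul, TensorProduct.tmul_sum, e, Finset.sum_mul,
        Algebra.TensorProduct.tmul_mul_tmul, mul_one]
      rw [Finset.sum_comm]
      simp only [_root_.map_mul, mul_assoc]
  constructor
  · rw [injective_iff_map_eq_zero]
    intro z hz
    rw [key z]
    refine Finset.sum_eq_zero fun g _ ↦ ?_
    have : θ g z = 0 := congrFun hz g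
    simp [this]
  · intro c
    refine ⟨∑ g, e g * (1 ⊗ₜ c g), funext fun k ↦ ?_⟩
    change θ k _ = _
    have h2 (g : G) : θ k (e g) = if g = k then 1 else 0 := by
      simp only [e, map_sum, hθ]
      have h3 : ∑ i, σ k (x i) * σ g (y i) = σ k (∑ i, x i * σ (g * k⁻¹) (y i)) := by
        rw [map_sum]
        refine Finset.sum_congr rfl fun i _ ↦ ?_
        rw [_root_.map_mul, ← h.map_mul, inv_mul_cancel_right]
      rw [h3]
      split_ifs with hg
      · simp [hg, h.map_one, h1]
      · rw [h0 _ (by rwa [Ne, mul_inv_eq_one]), map_zero]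
    simp [hθ, h2]

/-- The morphism `G × Spec C ⟶ Spec C ×_{Spec R} Spec C`, `(g, p) ↦ (g p, p)`, is an isomorphism. -/
theorem isIso_sigmaDesc [Finite G] (w : ∀ g, Spec.map (CommRingCat.ofHom (σ g)) ≫
      Spec.map (CommRingCat.ofHom φ) = 𝟙 _ ≫ Spec.map (CommRingCat.ofHom φ)) :
    IsIso (Sigma.desc (f := fun _ : G ↦ Spec (.of C)) fun g ↦
      pullback.lift (f := Spec.map (CommRingCat.ofHom φ)) (g := Spec.map (CommRingCat.ofHom φ))
        (Spec.map (CommRingCat.ofHom (σ g))) (𝟙 _) (w g)) := by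
  let := φ.toAlgebra
  have hb := h.bijective_tensor
  set Θ : C ⊗[R] C →+* (G → C) := RingHom.pi fun g ↦ (Algebra.TensorProduct.lift
      (⟨σ g, h.map_base g⟩ : C →ₐ[R] C) (AlgHom.id R C) fun _ _ ↦ .all _ _).toRingHom with hΘ
  have : IsIso (CommRingCat.ofHom Θ) :=
    (ConcreteCategory.isIso_iff_bijective (C := CommRingCat) _).mpr hb
  have key : (Sigma.desc (f := fun _ : G ↦ Spec (.of C)) fun g ↦
      pullback.lift (f := Spec.map (CommRingCat.ofHom φ)) (g := Spec.map (CommRingCat.ofHom φ))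
        (Spec.map (CommRingCat.ofHom (σ g))) (𝟙 _) (w g)) =
      sigmaSpec (fun _ : G ↦ .of C) ≫ Spec.map (CommRingCat.ofHom Θ) ≫
        (pullbackSpecIso R C C).inv := by
    refine Sigma.hom_ext _ _ fun g ↦ ?_
    rw [Sigma.ι_desc, ι_sigmaSpec_assoc, ← Spec.map_comp_assoc]
    have e1 := pullbackSpecIso_inv_fst R C C
    have e2 := pullbackSpecIso_inv_snd R C C
    refine pullback.hom_ext ?_ ?_
    · rw [pullback.lift_fst, Category.assoc]
      refine Eq.trans ?_ (congrArg (_ ≫ ·) e1.symm)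
      rw [← Spec.map_comp]
      congr 1
      ext c
      simp [hΘ]
    · rw [pullback.lift_snd, Category.assoc]
      refine Eq.trans ?_ (congrArg (_ ≫ ·) e2.symm)
      rw [← Spec.map_comp, ← Spec.map_id]
      congr 1
      ext c
      simp [hΘ]
  rw [key]
  infer_instance

end IsGaloisExtension

end GaloisExtensions

/-! ### Quotients by free actions -/

section Quotients

variable {G : Type} [Group G] {W T : Scheme.{0}}

/-- The morphism `q : W ⟶ T`, where `W` carries an action `ρ` of `G`, is locally on `T` given by a
Galois extension of rings. -/
def IsLocallyGalois (q : W ⟶ T) (ρ : G → (W ⟶ W)) : Prop :=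
  ∀ t : T, ∃ (R C : CommRingCat.{0}) (φ : R ⟶ C) (σ : G → (C ⟶ C)) (i : Spec C ⟶ W)
    (j : Spec R ⟶ T), IsGaloisExtension φ.hom (fun g ↦ (σ g).hom) ∧
      IsPullback i (Spec.map φ) q j ∧ IsOpenImmersion j ∧ t ∈ Set.range j ∧
      ∀ g, Spec.map (σ g) ≫ i = i ≫ ρ g

/-- An invariant morphism from the spectrum of a Galois extension takes the same value at two points
with the same image in `Spec R`. -/
theorem IsGaloisExtension.comp_eq_of_comp_eq [Finite G] {R C : CommRingCat.{0}} {φ : R ⟶ C}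
    {σ : G → (C ⟶ C)} (h : IsGaloisExtension φ.hom (fun g ↦ (σ g).hom)) {Z : Scheme.{0}}
    (u : Spec C ⟶ Z) (hu : ∀ g, Spec.map (σ g) ≫ u = u) {V : Scheme.{0}} (a b : V ⟶ Spec C)
    (hab : a ≫ Spec.map φ = b ≫ Spec.map φ) : a ≫ u = b ≫ u := by
  have w (g : G) : Spec.map (σ g) ≫ Spec.map φ = 𝟙 _ ≫ Spec.map φ := by
    rw [← Spec.map_comp, Category.id_comp]
    congr 1
    ext c
    exact h.map_base g c
  have := h.isIso_sigmaDesc w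
  have key : pullback.fst (Spec.map φ) (Spec.map φ) ≫ u = pullback.snd _ _ ≫ u := by
    rw [← cancel_epi (Sigma.desc (f := fun _ : G ↦ Spec C) fun g ↦
      pullback.lift (f := Spec.map φ) (g := Spec.map φ) (Spec.map (σ g)) (𝟙 _) (w g))]
    refine Sigma.hom_ext _ _ fun g ↦ ?_
    rw [Sigma.ι_desc_assoc, Sigma.ι_desc_assoc, pullback.lift_fst_assoc, pullback.lift_snd_assoc,
      hu,
      Category.id_comp]
  rw [← pullback.lift_fst a b hab, Category.assoc, key, pullback.lift_snd_assoc]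

namespace IsLocallyGalois

variable {q : W ⟶ T} {ρ : G → (W ⟶ W)} (h : IsLocallyGalois q ρ)
include h

theorem exists_openCover [Finite G] : ∃ 𝒰 : Scheme.OpenCover.{0} T, ∀ k, ∃ (R C : CommRingCat.{0})
    (φ : R ⟶ C) (σ : G → (C ⟶ C)) (i : Spec C ⟶ W)
    (e : Spec R ≅ 𝒰.X k), IsGaloisExtension φ.hom (fun g ↦ (σ g).hom) ∧
      IsPullback i (Spec.map φ ≫ e.hom) q (𝒰.f k) ∧
      ∀ g, Spec.map (σ g) ≫ i = i ≫ ρ g := by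
  choose R C φ σ i j hG hP hO ht hρ using h
  refine ⟨Scheme.Cover.mkOfCovers (P := @IsOpenImmersion) (T : Type) (fun t ↦ Spec (R t)) j
    (fun t ↦ ⟨t, ?_⟩) hO, fun t ↦
    ⟨R t, C t, φ t, σ t, i t, Iso.refl _, hG t, ?_, hρ t⟩⟩
  · exact ht t
  · have := hP t
    rwa [← Category.comp_id (Spec.map (φ t))] at this

theorem flat_and_surjective [Finite G] : Flat q ∧ Surjective q := by
  obtain ⟨𝒰, hU⟩ := h.exists_openCover
  choose R C φ σ i e hG hP hρ using hU
  have key (k) : Flat (pullback.snd q (𝒰.f k)) ∧ Surjective (pullback.snd q (𝒰.f k)) := by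
    have e1 : pullback.snd q (𝒰.f k) = (hP k).isoPullback.inv ≫ Spec.map (φ k) ≫ (e k).hom := by
      rw [Iso.eq_inv_comp]
      exact (hP k).isoPullback_hom_snd
    have h1 := (hG k).surjective_specMap
    have h2 : Flat (Spec.map (φ k)) := by
      rw [HasRingHomProperty.Spec_iff (P := @Flat.{0})]
      exact (hG k).flat
    have h3 : Surjective (Spec.map (φ k)) := h1
    rw [e1]
    exact ⟨inferInstance, inferInstance⟩
  have : IsZariskiLocalAtTarget @Flat.{0} :=
    HasRingHomProperty.instIsZariskiLocalAtTarget (P := @Flat) (Q := RingHom.Flat)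
  exact ⟨(IsZariskiLocalAtTarget.iff_of_openCover (P := @Flat) 𝒰).mpr fun k ↦ (key k).1,
    (IsZariskiLocalAtTarget.iff_of_openCover (P := @Surjective) 𝒰).mpr fun k ↦ (key k).2⟩

/-- An invariant morphism descends uniquely: a locally Galois morphism is a categorical quotient. -/
theorem existsUnique_desc [Finite G] [QuasiCompact q] {Z : Scheme.{0}} (u : W ⟶ Z)
    (hu : ∀ g, ρ g ≫ u = u) :
    ∃! k : T ⟶ Z, q ≫ k = u := by
  obtain ⟨_, _⟩ := h.flat_and_surjective
  -- The morphism `q` is faithfully flat and quasi-compact, hence an effective epimorphism.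
  have hep : ∀ {V : Scheme.{0}} (a b : V ⟶ W), a ≫ q = b ≫ q → a ≫ u = b ≫ u := by
    intro V a b hab
    obtain ⟨𝒰, hU⟩ := h.exists_openCover
    refine Scheme.Cover.hom_ext (𝒰.pullback₁ (a ≫ q)) _ _ fun k ↦ ?_
    obtain ⟨R, C, φ, σ, i, e, hG, hP, hρ⟩ := hU k
    have h1 : ((𝒰.pullback₁ (a ≫ q)).f k ≫ a) ≫ q = pullback.snd _ _ ≫ 𝒰.f k := by
      rw [Category.assoc]
      exact pullback.condition
    have h2 : ((𝒰.pullback₁ (a ≫ q)).f k ≫ b) ≫ q = pullback.snd _ _ ≫ 𝒰.f k := by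
      rw [← h1, Category.assoc, Category.assoc, hab]
    rw [← Category.assoc, ← Category.assoc, ← hP.lift_fst _ _ h1, ← hP.lift_fst _ _ h2,
      Category.assoc, Category.assoc]
    refine hG.comp_eq_of_comp_eq _ (fun g ↦ by rw [← Category.assoc, hρ, Category.assoc, hu]) _ _ ?_
    rw [← cancel_mono e.hom, Category.assoc, Category.assoc]
    exact (hP.lift_snd _ _ h1).trans (hP.lift_snd _ _ h2).symm
  exact ⟨EffectiveEpi.desc q u hep, EffectiveEpi.fac q u hep,
    fun m hm ↦ EffectiveEpi.uniq q u hep m hm⟩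

end IsLocallyGalois

end Quotients

/-! ### Principal bundles over a field -/

section GaloisBundles

variable {G K A A' : Type} [Group G] [Field K] [CommRing A] [CommRing A']
  {φ : K →+* A} {σ : G → A →+* A} {φ' : K →+* A'} {σ' : G → A' →+* A'}

/-- The left action on `Spec A` given by a right action of `G` on `A`. -/
@[simps]
noncomputable def IsGaloisExtension.specAction (h : IsGaloisExtension φ σ) : G →* Aut (Spec (.of A))
    where
  toFun g :=
    { hom := Spec.map (CommRingCat.ofHom (σ g))
      inv := Spec.map (CommRingCat.ofHom (σ g⁻¹))
      hom_inv_id := by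
        rw [← Spec.map_comp, ← Spec.map_id]
        congr 1
        ext c
        exact (h.map_mul g⁻¹ g c).symm.trans (by rw [inv_mul_cancel, h.map_one]; rfl)
      inv_hom_id := by
        rw [← Spec.map_comp, ← Spec.map_id]
        congr 1
        ext c
        exact h.inv_apply g c }
  map_one' := by
    ext1
    change Spec.map _ = 𝟙 _
    rw [← Spec.map_id]
    congr 1
    ext c
    exact h.map_one c
  map_mul' g g' := by
    ext1
    change Spec.map _ = Spec.map _ ≫ Spec.map _
    rw [← Spec.map_comp]
    congr 1
    ext c
    exact h.map_mul g g' c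

/-- The principal `G`-bundle given by a Galois extension of a field. -/
noncomputable def IsGaloisExtension.bundle [Finite G] (h : IsGaloisExtension φ σ) :
    PrincipalBundle G (Spec (.of K)) where
  P := Spec (.of A)
  π := Spec.map (CommRingCat.ofHom φ)
  act := h.specAction
  act_comp g := by
    rw [h.specAction_apply_hom, ← Spec.map_comp]
    congr 1
    ext c
    exact h.map_base g c
  flat := by
    rw [HasRingHomProperty.Spec_iff (P := @Flat)]
    exact h.flat
  surjective := h.surjective_specMap
  locallyOfFinitePresentation := by
    rw [HasRingHomProperty.Spec_iff (P := @LocallyOfFinitePresentation)]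
    exact RingHom.FinitePresentation.of_finiteType.mp h.finite.finiteType
  quasiCompact := inferInstance
  quasiSeparated := inferInstance
  isIso := h.isIso_sigmaDesc _

/-- Equivariantly isomorphic Galois algebras define the same class. -/
theorem IsGaloisExtension.bundle_equiv [Finite G] (h : IsGaloisExtension φ σ)
    (h' : IsGaloisExtension φ' σ') (e : A ≃+* A') (he : ∀ k, e (φ k) = φ' k)
    (he' : ∀ g a, e (σ g a) = σ' g (e a)) :
    (Quotient.mk _ h.bundle : H1 G (Spec (.of K))) = Quotient.mk _ h'.bundle := by
  refine Quotient.sound ⟨(Scheme.Spec.mapIso e.toCommRingCatIso.op).symm, ?_, fun g ↦ ?_⟩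
  · change Spec.map (CommRingCat.ofHom e.symm.toRingHom) ≫ Spec.map _ = Spec.map _
    rw [← Spec.map_comp]
    congr 1
    ext k
    change e.symm (φ' k) = φ k
    rw [← he, e.symm_apply_apply]
  · change Spec.map _ ≫ Spec.map (CommRingCat.ofHom e.symm.toRingHom) =
      Spec.map (CommRingCat.ofHom e.symm.toRingHom) ≫ Spec.map _
    rw [← Spec.map_comp, ← Spec.map_comp]
    congr 1
    ext a
    change σ g (e.symm a) = e.symm (σ' g a)
    rw [e.eq_symm_apply, he', e.apply_symm_apply]

/-- The algebra of functions on a finite group, with the translation action, is a Galois extension: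
it is the algebra of the trivial bundle. -/
theorem isGaloisExtension_pi (G K : Type) [Group G] [Finite G] [Field K] :
    IsGaloisExtension (RingHom.pi fun _ : G ↦ RingHom.id K)
      fun g : G ↦ RingHom.pi fun k ↦ Pi.evalRingHom (fun _ : G ↦ K) (g * k) := by
  classical
  refine ⟨fun c ↦ funext fun k ↦ by simp, fun g h c ↦ funext fun k ↦ by simp [mul_assoc],
    fun g r ↦ rfl, fun a b hab ↦ congrFun hab 1, fun c hc ↦ ⟨c 1, funext fun k ↦ ?_⟩, ?_⟩
  · have := congrFun (hc k) 1
    simpa using this.symm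
  · have := Fintype.ofFinite G
    have e := Fintype.equivFin G
    refine ⟨Fintype.card G, fun i ↦ Pi.single (e.symm i) 1, fun i ↦ Pi.single (e.symm i) 1, ?_,
      fun g hg ↦ ?_⟩
    · refine (e.symm.sum_comp fun k ↦ (Pi.single k 1 * Pi.single k 1 : G → K)).trans ?_
      ext k
      simp [Pi.single_apply]
    · refine (e.symm.sum_comp fun k ↦ (Pi.single k 1 * (RingHom.pi fun l ↦
        Pi.evalRingHom (fun _ : G ↦ K) (g * l)) (Pi.single k 1) : G → K)).trans ?_
      ext k
      simp [Pi.single_apply, hg]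

end GaloisBundles

/-! ### Galois algebras over a number field -/

section GaloisAlgebras

open TensorProduct

variable {G K A Ω : Type} [Group G] [Field K] [CommRing A] [Field Ω] [Algebra K Ω]
  {φ : K →+* A} {σ : G → A →+* A}

/-- The image of a Galois algebra `A` in the algebra of functions `G → Ω`, under the equivariant
homomorphism which extends `ψ : A → Ω`. -/
def orbitRange (σ : G → A →+* A) (ψ : A →+* Ω) : Set (G → Ω) :=
  Set.range fun a k ↦ ψ (σ k a)

/-- The functions `h : G → Ω` with values in the subfield `E` for which `τ ∈ Gal(E/K)` acts on the
values as translation by `c τ`. -/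
def twistedFunctions (E : IntermediateField K Ω) (c : Gal(E/K) → G) : Set (G → Ω) :=
  {h | ∃ h' : G → E, (∀ k, (h' k : Ω) = h k) ∧ ∀ τ k, τ (h' k) = h' (k * c τ)}

namespace IsGaloisExtension

variable (h : IsGaloisExtension φ σ) {ψ : A →+* Ω} (hψ : ∀ k, ψ (φ k) = algebraMap K Ω k)
include h

include hψ in
/-- The equivariant homomorphism `A → (G → Ω)` which extends `ψ : A → Ω` is injective. -/
theorem injective_orbit [Finite G] : Function.Injective fun (a : A) (k : G) ↦ ψ (σ k a) := by
  have := Fintype.ofFinite G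
  have h0 (a : A) (ha : ∀ k, ψ (σ k a) = 0) : a = 0 := by
    obtain ⟨t, ht⟩ := h.exists_trace
    have h1 (b : A) : t (b * a) = 0 := by
      apply (algebraMap K Ω).injective
      rw [← hψ, ht, map_sum, map_zero]
      exact Finset.sum_eq_zero fun g _ ↦ by rw [_root_.map_mul, _root_.map_mul, ha, mul_zero]
    classical
    obtain ⟨n, x, y, h2, h3⟩ := h.free
    calc a = ∑ i, x i * φ (t (y i * a)) := by
            simp_rw [ht, Finset.mul_sum]
            rw [Finset.sum_comm]
            have (g : G) : ∑ i, x i * σ g (y i * a) = if g = 1 then a else 0 := by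
              simp_rw [_root_.map_mul, ← mul_assoc, ← Finset.sum_mul]
              split_ifs with hg
              · simp [hg, h.map_one, h2]
              · simp [h3 g hg]
            rw [Finset.sum_congr rfl fun g _ ↦ this g]
            simp
      _ = 0 := by simp [h1]
  intro a b hab
  rw [← sub_eq_zero]
  exact h0 _ fun k ↦ by rw [map_sub, map_sub, sub_eq_zero]; exact congrFun hab k

include hψ in
/-- The homomorphisms from a Galois algebra to a field are conjugate. -/
theorem exists_eq_comp [Finite G] {χ : A →+* Ω} (hχ : ∀ k, χ (φ k) = algebraMap K Ω k) :
    ∃ g, ∀ a, χ a = ψ (σ g a) := by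
  have := Fintype.ofFinite G
  classical
  let := φ.toAlgebra
  obtain ⟨n, x, y, h1, h0⟩ := h.free
  obtain ⟨t, ht⟩ := h.exists_trace
  -- The separability idempotent `e` satisfies `(a ⊗ 1) e = (1 ⊗ a) e`. Its image `d g` under
  -- `(ψ ∘ σ g) ⊗ χ` is non-zero for some `g`, as these
  -- elements add up to `1`; for this `g` the relation
  -- gives `ψ (σ g a) = χ a`.
  let e : A ⊗[K] A := ∑ i, x i ⊗ₜ y i
  have he (a : A) : (a ⊗ₜ 1) * e = (1 ⊗ₜ a) * e := by
    apply h.bijective_tensor.1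
    ext g
    simp only [e, Finset.mul_sum, Algebra.TensorProduct.tmul_mul_tmul, one_mul]
    simp only [map_sum, Finset.sum_apply]
    change ∑ i, σ g (a * x i) * y i = ∑ i, σ g (x i) * (a * y i)
    simp_rw [_root_.map_mul, mul_assoc, mul_left_comm _ a, ← Finset.mul_sum]
    rcases eq_or_ne g 1 with rfl | hg
    · rw [h.map_one]
    · have h3 : ∑ i, σ g (x i) * y i = σ g (∑ i, x i * σ g⁻¹ (y i)) := by
        rw [map_sum]
        refine Finset.sum_congr rfl fun i _ ↦ ?_
        rw [_root_.map_mul, ← h.map_mul, inv_mul_cancel, h.map_one]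
      rw [h3, h0 _ (by simpa using hg)]
      simp
  let d (g : G) : Ω := ∑ i, ψ (σ g (x i)) * χ (y i)
  have hd : ∑ g, d g = 1 := by
    simp only [d]
    rw [Finset.sum_comm]
    have e1 (i) : ∑ g, ψ (σ g (x i)) * χ (y i) = χ (φ (t (x i)) * y i) := by
      rw [_root_.map_mul, hχ, ← hψ, ht, map_sum, Finset.sum_mul]
    rw [Finset.sum_congr rfl fun i _ ↦ e1 i, ← map_sum]
    have e2 : ∑ i, φ (t (x i)) * y i = 1 := by
      simp_rw [ht, Finset.sum_mul]
      rw [Finset.sum_comm]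
      have (g : G) : ∑ i, σ g (x i) * y i = if g = 1 then 1 else 0 := by
        have h3 : ∑ i, σ g (x i) * y i = σ g (∑ i, x i * σ g⁻¹ (y i)) := by
          rw [map_sum]
          refine Finset.sum_congr rfl fun i _ ↦ ?_
          rw [_root_.map_mul, ← h.map_mul, inv_mul_cancel, h.map_one]
        rw [h3]
        split_ifs with hg
        · simp [hg, h.map_one, h1]
        · rw [h0 _ (by simpa using hg), map_zero]
      rw [Finset.sum_congr rfl fun g _ ↦ this g]
      simp
    rw [e2, _root_.map_one]
  obtain ⟨g, -, hg⟩ := Finset.exists_ne_zero_of_sum_ne_zero (hd ▸ one_ne_zero)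
  refine ⟨g, fun a ↦ ?_⟩
  let f : A ⊗[K] A →ₐ[K] Ω := Algebra.TensorProduct.lift
    (⟨ψ.comp (σ g), fun k ↦ (congrArg ψ (h.map_base g k)).trans (hψ k)⟩ : A →ₐ[K] Ω)
    (⟨χ, hχ⟩ : A →ₐ[K] Ω) fun _ _ ↦ .all _ _
  have hf (u v : A) : f (u ⊗ₜ v) = ψ (σ g u) * χ v := by simp [f]
  have hfe : f e = d g := by simp only [e, map_sum, hf, d]
  have := congrArg f (he a)
  rw [_root_.map_mul, _root_.map_mul, hfe, hf, hf] at this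
  simpa using (mul_right_cancel₀ hg this).symm

include hψ in
/-- The image of a Galois algebra in an algebraic closure of `K` is a Galois extension `E` of degree
at most `#G`, and each `τ ∈ Gal(E/K)` acts on it as some element `c τ` of `G`. -/
theorem exists_intermediateField [Finite G] [IsAlgClosure K Ω] [CharZero K] :
    ∃ E : IntermediateField K Ω, IsGalois K E ∧ FiniteDimensional K E ∧
      Module.finrank K E ≤ Nat.card G ∧ (∀ z, z ∈ E ↔ ∃ a, ψ a = z) ∧
      ∃ c : Gal(E/K) → G, ∀ τ a (z : E), ψ a = z → τ z = ψ (σ (c τ) a) := by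
  have := Fintype.ofFinite G
  let := φ.toAlgebra
  let ψ' : A →ₐ[K] Ω := ⟨ψ, hψ⟩
  have hfin : Module.Finite K A := h.finite
  have hint : Algebra.IsIntegral K ψ'.range :=
    Algebra.IsIntegral.of_surjective ψ'.rangeRestrict ψ'.rangeRestrict_surjective
  let E : IntermediateField K Ω := { ψ'.range with
    inv_mem' := fun z hz ↦ ψ'.range.inv_mem_of_algebraic (x := ⟨z, hz⟩)
      (Algebra.IsAlgebraic.isAlgebraic (R := K) (⟨z, hz⟩ : ψ'.range)).algebraMap }
  have hE (z : Ω) : z ∈ E ↔ ∃ a, ψ a = z := Iff.rfl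
  have hfinE : FiniteDimensional K E :=
    Module.Finite.of_surjective ψ'.rangeRestrict.toLinearMap ψ'.rangeRestrict_surjective
  have halg : IsAlgClosed Ω := IsAlgClosure.isAlgClosed K
  have hnorm : Normal K Ω := IsAlgClosure.normal K Ω
  have hconj (f : E →ₐ[K] Ω) : ∃ g, ∀ a (z : E), ψ a = z → f z = ψ (σ g a) := by
    obtain ⟨g, hg⟩ := h.exists_eq_comp hψ
      (χ := (f.comp (ψ'.rangeRestrict : A →ₐ[K] E)).toRingHom) (fun k ↦
        AlgHom.commutes (f.comp (ψ'.rangeRestrict : A →ₐ[K] E)) k)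
    refine ⟨g, fun a z hz ↦ ?_⟩
    rw [← hg]
    exact congrArg f (Subtype.ext hz.symm)
  have hnormE : Normal K E := by
    rw [IntermediateField.normal_iff_forall_map_le]
    rintro f _ ⟨z, hz, rfl⟩
    obtain ⟨g, hg⟩ := hconj (f.comp E.val)
    obtain ⟨a, ha⟩ := (hE z).mp hz
    exact (hE _).mpr ⟨σ g a, (hg a ⟨z, hz⟩ ha).symm⟩
  choose c hc using fun τ : Gal(E/K) ↦ hconj (E.val.comp τ.toAlgHom)
  have hgal : IsGalois K E := ⟨⟩
  refine ⟨E, hgal, hfinE, ?_, hE, c, hc⟩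
  rw [← IsGalois.card_aut_eq_finrank]
  refine Nat.card_le_card_of_injective c fun τ τ' hτ ↦ ?_
  ext z
  obtain ⟨a, ha⟩ := (hE z).mp z.2
  exact (hc τ a z ha).trans (hτ ▸ (hc τ' a z ha).symm)

include hψ in
/-- A Galois algebra is determined by the finite amount of data `(E, c)` of
`exists_intermediateField`. -/
theorem orbitRange_eq_twistedFunctions [Finite G] {E : IntermediateField K Ω} [IsGalois K E]
    [FiniteDimensional K E] (hE : ∀ z, z ∈ E ↔ ∃ a, ψ a = z) {c : Gal(E/K) → G}
    (hc : ∀ τ a (z : E), ψ a = z → τ z = ψ (σ (c τ) a)) :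
    orbitRange σ ψ = twistedFunctions E c := by
  have := Fintype.ofFinite G
  classical
  apply Set.Subset.antisymm
  · rintro _ ⟨a, rfl⟩
    refine ⟨fun k ↦ ⟨ψ (σ k a), (hE _).mpr ⟨_, rfl⟩⟩, fun k ↦ rfl, fun τ k ↦ Subtype.ext ?_⟩
    rw [hc τ (σ k a) _ rfl, ← h.map_mul]
  · rintro f ⟨f', hf, hτ⟩
    obtain ⟨n, x, y, h1, h0⟩ := h.free
    have hmem (a : A) : ψ a ∈ E := (hE _).mpr ⟨a, rfl⟩
    -- The coordinates of a twisted function `f` with respect to the `x i` are Galois-invariant,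
    -- hence in `K`.
    let s (i : Fin n) : E := ∑ g, ⟨ψ (σ g (y i)), hmem _⟩ * f' g
    have hs (i : Fin n) : s i ∈ Set.range (algebraMap K E) := by
      rw [IsGalois.mem_range_algebraMap_iff_fixed]
      intro τ
      simp only [s, map_sum, _root_.map_mul, hτ]
      refine Fintype.sum_equiv (Equiv.mulRight (c τ)) _ _ fun g ↦ ?_
      congr 1
      refine Subtype.ext ?_
      rw [hc τ _ _ rfl, ← h.map_mul]
      rfl
    choose r hr using hs
    refine ⟨∑ i, φ (r i) * x i, funext fun k ↦ ?_⟩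
    have hr' (i) : algebraMap K Ω (r i) = ∑ g, ψ (σ g (y i)) * f g := by
      have := congrArg (algebraMap E Ω) (hr i)
      rw [← IsScalarTower.algebraMap_apply] at this
      rw [this]
      simp only [s, map_sum, _root_.map_mul]
      exact Finset.sum_congr rfl fun g _ ↦ by rw [← hf]; rfl
    simp only [map_sum, _root_.map_mul, h.map_base, hψ, hr', Finset.sum_mul]
    rw [Finset.sum_comm]
    have key (g : G) : ∑ i, ψ (σ g (y i)) * f g * ψ (σ k (x i)) = if g = k then f g else 0 := by
      have h3 : ∑ i, σ k (x i) * σ g (y i) = σ k (∑ i, x i * σ (g * k⁻¹) (y i)) := by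
        rw [map_sum]
        refine Finset.sum_congr rfl fun i _ ↦ ?_
        rw [_root_.map_mul, ← h.map_mul, inv_mul_cancel_right]
      have h4 : ∑ i, ψ (σ g (y i)) * f g * ψ (σ k (x i)) =
          ψ (∑ i, σ k (x i) * σ g (y i)) * f g := by
        rw [map_sum, Finset.sum_mul]
        exact Finset.sum_congr rfl fun i _ ↦ by rw [_root_.map_mul]; ring
      rw [h4, h3]
      split_ifs with hg
      · subst hg
        rw [mul_inv_cancel, Finset.sum_congr rfl fun i _ ↦ by rw [h.map_one], h1]
        simp
      · rw [h0 _ (by rwa [Ne, mul_inv_eq_one])]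
        simp
    rw [Finset.sum_congr rfl fun g _ ↦ key g]
    simp

include hψ in
/-- A Galois algebra is determined by its image in the algebra of functions `G → Ω`. -/
theorem exists_ringEquiv_of_orbitRange_eq [Finite G] {A' : Type} [CommRing A'] {φ' : K →+* A'}
    {σ' : G → A' →+* A'} (h' : IsGaloisExtension φ' σ') {ψ' : A' →+* Ω}
    (hψ' : ∀ k, ψ' (φ' k) = algebraMap K Ω k) (he : orbitRange σ ψ = orbitRange σ' ψ') :
    ∃ e : A ≃+* A', (∀ k, e (φ k) = φ' k) ∧ ∀ g a, e (σ g a) = σ' g (e a) := by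
  have hi := h.injective_orbit hψ
  have hi' := h'.injective_orbit hψ'
  have h1 (a : A) : ∃ a', (fun k ↦ ψ' (σ' k a')) = fun k ↦ ψ (σ k a) := by
    have : (fun k ↦ ψ (σ k a)) ∈ orbitRange σ' ψ' := he ▸ ⟨a, rfl⟩
    exact this
  have h2 (a' : A') : ∃ a, (fun k ↦ ψ (σ k a)) = fun k ↦ ψ' (σ' k a') := by
    have : (fun k ↦ ψ' (σ' k a')) ∈ orbitRange σ ψ := he ▸ ⟨a', rfl⟩
    exact this
  choose e he using h1
  choose e' he' using h2
  have hek (a k) : ψ' (σ' k (e a)) = ψ (σ k a) := congrFun (he a) k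
  refine ⟨⟨⟨e, e', fun a ↦ hi (by simp only [he', he]), fun a ↦ hi' (by simp only [he', he])⟩,
    fun a b ↦ hi' (funext fun k ↦ ?_), fun a b ↦ hi' (funext fun k ↦ ?_)⟩,
    fun k ↦ hi' (funext fun g ↦ ?_), fun g a ↦ hi' (funext fun k ↦ ?_)⟩
  · simp [hek]
  · simp [hek]
  · change ψ' (σ' g (e (φ k))) = ψ' (σ' g (φ' k))
    rw [hek, h.map_base, h'.map_base, hψ, hψ']
  · change ψ' (σ' k (e (σ g a))) = ψ' (σ' k (σ' g (e a)))
    rw [hek, ← h.map_mul, ← h'.map_mul, hek]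

end IsGaloisExtension

/-- Up to isomorphism, there are only finitely many Galois algebras with given group which are
unramified outside a finite set `S` of primes. An algebra `A` is represented by its image
`orbitRange σ ψ`, and it is unramified at `𝔭` if its freeness is witnessed by elements whose images
under `ψ` are integral at `𝔭`. -/
theorem finite_setOf_orbitRange (G K Ω : Type) [Group G] [Finite G] [Field K] [NumberField K]
    [Field Ω] [Algebra K Ω] [IsAlgClosure K Ω] (S : Finset (Ideal (𝓞 K))) (hS : ⊥ ∉ S) :
    {I : Set (G → Ω) | ∃ (A : Type) (_ : CommRing A) (φ : K →+* A) (σ : G → A →+* A)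
      (ψ : A →+* Ω), IsGaloisExtension φ σ ∧ (∀ k, ψ (φ k) = algebraMap K Ω k) ∧
      (∀ 𝔭 : Ideal (𝓞 K), 𝔭.IsPrime → 𝔭 ≠ ⊥ → 𝔭 ∉ S → ∃ (n : ℕ) (x y : Fin n → A),
        ∑ i, x i * y i = 1 ∧ (∀ g, g ≠ 1 → ∑ i, x i * σ g (y i) = 0) ∧
        ∀ i, IsIntegralAtPrime 𝔭 (ψ (x i)) ∧ IsIntegralAtPrime 𝔭 (ψ (y i))) ∧
      I = orbitRange σ ψ}.Finite := by
  refine ((finite_setOf_intermediateField Ω S hS (Nat.card G)).biUnion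
    (t := fun E ↦ {I | ∃ c : Gal(E/K) → G, I = twistedFunctions E c}) ?_).subset ?_
  · rintro E ⟨_, _, _, -⟩
    refine (Set.finite_range fun c : Gal(E/K) → G ↦ twistedFunctions E c).subset ?_
    rintro _ ⟨c, rfl⟩
    exact ⟨c, rfl⟩
  · rintro _ ⟨A, _, φ, σ, ψ, h, hψ, hint, rfl⟩
    obtain ⟨E, hgal, hfin, hle, hE, c, hc⟩ := h.exists_intermediateField hψ
    have hnf : NumberField E := NumberField.of_module_finite K E
    refine Set.mem_biUnion (x := E) ⟨hfin, hgal, hnf, hle, fun 𝔭 hp hp0 hpS ↦ ?_⟩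
      ⟨c, h.orbitRange_eq_twistedFunctions hψ hE hc⟩
    obtain ⟨n, x, y, h1, h0, hxy⟩ := hint 𝔭 hp hp0 hpS
    have hmem (a : A) : ψ a ∈ E := (hE _).mpr ⟨a, rfl⟩
    have hval {z : E} (hz : IsIntegralAtPrime 𝔭 (z : Ω)) : IsIntegralAtPrime 𝔭 z := by
      obtain ⟨s, hs, hs'⟩ := hz
      exact ⟨s, hs, (isIntegral_algHom_iff (E.val.restrictScalars ℤ) Subtype.val_injective).mp hs'⟩
    -- The images under `ψ` of elements which witness the freeness of the action on `A` witness that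
    -- `E` is unramified, because `τ ≠ 1` acts as `c τ ≠ 1`.
    refine exists_mem_differentIdeal_of_isIntegralAtPrime Finset.univ
      (fun i ↦ (⟨ψ (x i), hmem _⟩ : E)) (fun i ↦ ⟨ψ (y i), hmem _⟩) (fun i _ ↦ hval (hxy i).1)
      (fun i _ ↦ hval (hxy i).2) ?_ fun τ hτ ↦ ?_
    · refine Subtype.ext ?_
      push_cast
      simp only [← map_mul, ← map_sum, h1, map_one]
    · have hcτ : c τ ≠ 1 := by
        rintro h1
        refine hτ (AlgEquiv.ext fun z ↦ Subtype.ext ?_)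
        obtain ⟨a, ha⟩ := (hE z).mp z.2
        rw [hc τ a z ha, h1, h.map_one, ha]
        rfl
      refine Subtype.ext ?_
      push_cast
      simp only [hc τ _ ⟨ψ (y _), hmem _⟩ rfl, ← map_mul, ← map_sum, h0 _ hcτ, map_zero]

end GaloisAlgebras

/-! ### Galois covers -/

section GaloisCovers

variable {X Y : Scheme.{0}} (f : Y ⟶ X)

/-- A point with values in a field has only finitely many lifts along a finite morphism. -/
theorem finite_setOf_comp_eq [IsFinite f] {L : Type} [Field L] (x : Spec (.of L) ⟶ X) :
    {y : Spec (.of L) ⟶ Y | y ≫ f = x}.Finite := by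
  let Q := pullback f x
  have hfin : IsFinite (pullback.snd f x) := inferInstance
  have hQ : IsAffine Q := isAffine_of_isAffineHom (pullback.snd f x)
  let φ : L →+* Γ(Q, ⊤) :=
    (pullback.snd f x).appTop.hom.comp (Scheme.ΓSpecIso (.of L)).inv.hom
  have hφ : φ.Finite := by
    refine RingHom.Finite.comp ?_ (RingHom.Finite.of_surjective _ ?_)
    · exact hfin.finite_app _ (isAffineOpen_top _)
    · exact (ConcreteCategory.bijective_of_isIso (Scheme.ΓSpecIso (.of L)).inv).2
  algebraize [φ]
  have : Finite (Γ(Q, ⊤) →ₐ[L] L) := inferInstance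
  let F (y : {y : Spec (.of L) ⟶ Y | y ≫ f = x}) : Γ(Q, ⊤) →ₐ[L] L :=
    { toRingHom := (Scheme.ΓSpecIso (.of L)).hom.hom.comp
        (pullback.lift (f := f) (g := x) y.1 (𝟙 _) (by rw [Category.id_comp]; exact y.2)).appTop.hom
      commutes' := fun r ↦ by
        change ((Scheme.ΓSpecIso (.of L)).inv ≫ (pullback.snd f x).appTop ≫
          (pullback.lift (f := f) (g := x) y.1 (𝟙 _) _).appTop ≫ (Scheme.ΓSpecIso (.of L)).hom) r =
            r
        rw [← Scheme.Hom.comp_appTop_assoc, pullback.lift_snd]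
        simp }
  refine Set.finite_coe_iff.mp (Finite.of_injective F fun y y' h ↦ Subtype.ext ?_)
  have hy : y.1 ≫ f = 𝟙 _ ≫ x := y.2.trans (Category.id_comp x).symm
  have hy' : y'.1 ≫ f = 𝟙 _ ≫ x := y'.2.trans (Category.id_comp x).symm
  have e1 : pullback.lift (f := f) (g := x) y.1 (𝟙 _) hy =
      pullback.lift (f := f) (g := x) y'.1 (𝟙 _) hy' := by
    refine ext_of_isAffine ?_
    rw [← cancel_mono (Scheme.ΓSpecIso (.of L)).hom]
    ext r
    exact DFunLike.congr_fun h r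
  rw [← pullback.lift_fst _ _ hy, e1, pullback.lift_fst]

theorem isDominant_fromSpecResidueField_genericPoint [IrreducibleSpace Y] :
    IsDominant (Y.fromSpecResidueField (genericPoint Y)) := by
  refine ⟨?_⟩
  rw [DenseRange, Scheme.range_fromSpecResidueField]
  exact dense_iff_closure_eq.mpr (genericPoint_closure _)

variable {f} in
/-- An automorphism of a cover is determined by its restriction along a dominant morphism. -/
theorem autOver_ext {W : Scheme.{0}} [IsReduced Y] [IsSeparated f] (i : W ⟶ Y) [IsDominant i]
    {g g' : AutOver f} (h : i ≫ (autAction f g).hom = i ≫ (autAction f g').hom) : g = g' := by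
  have := ext_of_isDominant_of_isSeparated f
    ((autAction_comp f g).trans (autAction_comp f g').symm) i h
  ext
  exact this

/-- The automorphism group is finite: it acts freely on the lifts of the generic point of `Y`. -/
theorem finite_autOver [IsFinite f] [IsIntegral Y] : Finite (AutOver f) := by
  have := isDominant_fromSpecResidueField_genericPoint (Y := Y)
  let i := Y.fromSpecResidueField (genericPoint Y)
  have hfin := finite_setOf_comp_eq f (L := Y.residueField (genericPoint Y)) (i ≫ f)
  have := hfin.to_subtype
  refine Finite.of_injective (β := {y : Spec (.of (Y.residueField (genericPoint Y))) ⟶ Y | y ≫ f =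
    i ≫ f})
    (fun g ↦ ⟨i ≫ (autAction f g).hom, ?_⟩) fun g g' h ↦ autOver_ext i (congrArg Subtype.val h)
  exact (Category.assoc _ _ _).trans (congrArg (i ≫ ·) (autAction_comp f g))

/-- A faithful action of a group on a domain which is unramified over a ring of invariant elements
is free: the separability idempotent `∑ x i ⊗ y i` provides the required elements, as `(b - σ g b) *
∑ x i * σ g (y i) = 0`. -/
theorem isFreeRingAction_of_formallyUnramified {G A B : Type} [Group G] [CommRing A] [CommRing B]
    [IsDomain B] {φ : A →+* B} (hφ : φ.FormallyUnramified) (hφ' : φ.FiniteType)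
    (σ : G → B →+* B) (hσ : ∀ g a, σ g (φ a) = φ a) (hf : ∀ g, (∀ b, σ g b = b) → g = 1) :
    IsFreeRingAction σ := by
  open TensorProduct in
  algebraize [φ]
  have hs (e : B ⊗[A] B) : ∃ (n : ℕ) (x y : Fin n → B), e = ∑ i, x i ⊗ₜ y i := by
    obtain ⟨n, x, y, h⟩ := TensorProduct.exists_sum_tmul_eq e
    exact ⟨n, x, y, h⟩
  obtain ⟨n, x, y, hxy⟩ := hs (Algebra.FormallyUnramified.elem A B)
  refine ⟨n, x, y, ?_, fun g hg ↦ ?_⟩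
  · have := Algebra.FormallyUnramified.lmul_elem (R := A) (S := B)
    rw [hxy, map_sum] at this
    simpa using this
  · by_contra h0
    refine hg (hf g fun b ↦ ?_)
    let F : B ⊗[A] B →ₐ[A] B := Algebra.TensorProduct.lift (AlgHom.id A B)
      (⟨σ g, hσ g⟩ : B →ₐ[A] B) fun _ _ ↦ .all _ _
    have h1 := congrArg F (Algebra.FormallyUnramified.one_tmul_mul_elem (R := A) b)
    have hF : F (Algebra.FormallyUnramified.elem A B) = ∑ i, x i * σ g (y i) := by
      rw [hxy, map_sum]
      simp [F]
    rw [map_mul, map_mul, hF] at h1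
    have := mul_right_cancel₀ h0 h1
    simpa [F] using this

theorem le_preimage_autAction (V : X.Opens) (g : AutOver f) :
    f ⁻¹ᵁ V ≤ (autAction f g).hom ⁻¹ᵁ (f ⁻¹ᵁ V) := by
  rw [← Scheme.Hom.comp_preimage, autAction_comp]

/-- The right action of `Aut(f)` on the functions on `f⁻¹ V`. -/
noncomputable def autSections (V : X.Opens) (g : AutOver f) : Γ(Y, f ⁻¹ᵁ V) →+* Γ(Y, f ⁻¹ᵁ V) :=
  ((autAction f g).hom.appLE (f ⁻¹ᵁ V) (f ⁻¹ᵁ V) (le_preimage_autAction f V g)).hom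

theorem autSections_app (V : X.Opens) (g : AutOver f) (a : Γ(X, V)) :
    autSections f V g (f.app V a) = f.app V a := by
  have : f.app V ≫ (autAction f g).hom.appLE (f ⁻¹ᵁ V) (f ⁻¹ᵁ V) (le_preimage_autAction f V g) =
      f.app V := by
    rw [Scheme.Hom.app_eq_appLE, Scheme.Hom.appLE_comp_appLE]
    simp only [autAction_comp]
  exact ConcreteCategory.congr_hom this a

/-- The group `Aut(f)` acts freely on the functions on `f⁻¹ V`, for a non-empty affine open subset
`V` over which `f` is étale. -/
theorem isFreeRingAction_autSections [IsFinite f] [Surjective f] [IsIntegral Y] {U V : X.Opens}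
    [Etale (f ∣_ U)] (hV : IsAffineOpen V) (hVU : V ≤ U) (hne : (V : Set X).Nonempty) :
    IsFreeRingAction (autSections f V) := by
  have hW : IsAffineOpen (f ⁻¹ᵁ V) := hV.preimage f
  obtain ⟨x, hx⟩ := hne
  obtain ⟨y, rfl⟩ := f.surjective x
  have hne' : Nonempty (f ⁻¹ᵁ V) := ⟨⟨y, hx⟩⟩
  have hunr : (f.app V).hom.FormallyUnramified := by
    have key : ∀ (V' : X.Opens) (W' : Y.Opens) (e), V' = V → W' = f ⁻¹ᵁ V →
        (f.appLE V' W' e).hom.FormallyUnramified → (f.app V).hom.FormallyUnramified := by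
      rintro _ _ e rfl rfl h
      rwa [Scheme.Hom.app_eq_appLE]
    have hV' : IsAffineOpen (U.ι ⁻¹ᵁ V) := by
      refine hV.preimage_of_isOpenImmersion _ ?_
      simpa using hVU
    have h1 := (f ∣_ U).formallyUnramified_appLE hV' (hV'.preimage (f ∣_ U)) le_rfl
    rw [morphismRestrict_appLE] at h1
    have e1 : U.ι ''ᵁ (U.ι ⁻¹ᵁ V) = V := by
      rw [Scheme.Hom.image_preimage_eq_opensRange_inf, Scheme.Opens.opensRange_ι]
      exact inf_eq_right.mpr hVU
    refine key _ _ _ e1 ?_ h1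
    rw [image_morphismRestrict_preimage, e1]
  refine isFreeRingAction_of_formallyUnramified hunr (IsFinite.finite_app f V hV).finiteType _
    (fun g a ↦ autSections_app f V g a) fun g hg ↦ ?_
  have hd : IsDominant hW.fromSpec := by
    refine ⟨?_⟩
    rw [DenseRange, hW.range_fromSpec]
    exact (f ⁻¹ᵁ V).isOpen.dense ⟨y, hx⟩
  refine autOver_ext hW.fromSpec ?_
  rw [map_one, ← IsAffineOpen.SpecMap_appLE_fromSpec _ hW hW (le_preimage_autAction f V g)]
  have : (autAction f g).hom.appLE (f ⁻¹ᵁ V) (f ⁻¹ᵁ V) (le_preimage_autAction f V g) = 𝟙 _ := by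
    ext b
    exact hg b
  rw [this, Spec.map_id, Category.id_comp]
  exact (Category.comp_id _).symm

end GaloisCovers

section Fibres

/-- An element of a finite reduced algebra over a field of characteristic zero is a scalar if all
homomorphisms to an algebraic closure agree on it. -/
theorem exists_algebraMap_eq_of_forall_eq {K A Ω : Type} [Field K] [CharZero K] [CommRing A]
    [Algebra K A] [Algebra.IsIntegral K A] [IsReduced A] [Nontrivial A] [Field Ω] [Algebra K Ω]
    [IsAlgClosure K Ω] {a : A} (h : ∀ ψ ψ' : A →ₐ[K] Ω, ψ a = ψ' a) : ∃ k, algebraMap K A k =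
      a := by
  have halg : IsAlgClosed Ω := IsAlgClosure.isAlgClosed K
  have hgal : IsGalois K Ω := IsAlgClosure.isGalois K Ω
  have hp (p : Ideal A) [p.IsPrime] : ∃ ψ : A →ₐ[K] Ω, ∀ b, ψ b = 0 → b ∈ p := by
    have hint : Algebra.IsIntegral K (A ⧸ p) :=
      Algebra.IsIntegral.of_surjective (Ideal.Quotient.mkₐ K p) Ideal.Quotient.mk_surjective
    let ψ : A ⧸ p →ₐ[K] Ω := IsAlgClosed.lift
    have hfield : IsField (A ⧸ p) := isField_of_isIntegral_of_isField' (Field.toIsField K)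
    have hinj : Function.Injective ψ := by
      let := hfield.toField
      exact RingHom.injective (ψ : A ⧸ p →+* Ω)
    exact ⟨ψ.comp (Ideal.Quotient.mkₐ K p), fun b hb ↦
      Ideal.Quotient.eq_zero_iff_mem.mp (hinj (hb.trans (map_zero ψ).symm))⟩
  obtain ⟨m, hm⟩ := Ideal.exists_maximal A
  obtain ⟨ψ, -⟩ := hp m
  have hz : ψ a ∈ Set.range (algebraMap K Ω) := by
    rw [InfiniteGalois.mem_range_algebraMap_iff_fixed]
    exact fun τ ↦ h (τ.toAlgHom.comp ψ) ψ
  obtain ⟨k, hk⟩ := hz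
  refine ⟨k, ?_⟩
  rw [← sub_eq_zero, ← Ideal.mem_bot, ← Ideal.zero_eq_bot, ← nilradical_eq_zero, nilradical_eq_sInf,
    Ideal.mem_sInf]
  intro p hpp
  have : p.IsPrime := hpp
  obtain ⟨χ, hχ⟩ := hp p
  refine hχ _ ?_
  rw [map_sub, AlgHom.commutes, h χ ψ, hk, sub_self]

variable {X Y : Scheme.{0}} (f : Y ⟶ X) {K : Type} [Field K] (P : Spec (.of K) ⟶ X)

/-- The automorphism of the fibre of `f` at `P` given by an automorphism of `f`. -/
noncomputable def fibreAut (g : AutOver f) : pullback f P ⟶ pullback f P :=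
  pullback.map f P f P (autAction f g).hom (𝟙 _) (𝟙 _) (by simp [autAction_comp]) (by simp)

theorem fibreAut_fst (g : AutOver f) :
    fibreAut f P g ≫ pullback.fst f P = pullback.fst f P ≫ (autAction f g).hom :=
  pullback.lift_fst _ _ _

theorem fibreAut_snd (g : AutOver f) : fibreAut f P g ≫ pullback.snd f P = pullback.snd f P :=
  (pullback.lift_snd _ _ _).trans (Category.comp_id _)

/-- The structure morphism of the algebra of functions on the fibre of `f` at `P`. -/
noncomputable def fibreMap : K →+* Γ(pullback f P, ⊤) :=
  ((Scheme.ΓSpecIso (.of K)).inv ≫ (pullback.snd f P).appTop).hom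

/-- The action of `Aut(f)` on the algebra of functions on the fibre of `f` at `P`. -/
noncomputable def fibreAction (g : AutOver f) : Γ(pullback f P, ⊤) →+* Γ(pullback f P, ⊤) :=
  (fibreAut f P g).appTop.hom

theorem le_preimage_fibre {V : X.Opens} (hP : ⊤ ≤ P ⁻¹ᵁ V) :
    ⊤ ≤ pullback.fst f P ⁻¹ᵁ f ⁻¹ᵁ V := by
  rw [← Scheme.Hom.comp_preimage, pullback.condition, Scheme.Hom.comp_preimage,
    top_le_iff.mp hP]
  exact le_rfl

/-- The restriction to the fibre of functions on the preimage of an open subset containing `P`. -/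
noncomputable def fibreRestrict (V : X.Opens) (hP : ⊤ ≤ P ⁻¹ᵁ V) :
    Γ(Y, f ⁻¹ᵁ V) →+* Γ(pullback f P, ⊤) :=
  ((pullback.fst f P).appLE _ _ (le_preimage_fibre f P hP)).hom

theorem fibreAction_fibreRestrict {V : X.Opens} (hP : ⊤ ≤ P ⁻¹ᵁ V) (g : AutOver f)
    (b : Γ(Y, f ⁻¹ᵁ V)) :
    fibreAction f P g (fibreRestrict f P V hP b) = fibreRestrict f P V hP (autSections f V g b) :=
      by
  have hle := le_preimage_fibre f P hP
  have e : (fibreAut f P g).appTop = (fibreAut f P g).appLE ⊤ ⊤ (Scheme.Hom.preimage_top _).ge :=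
    Scheme.Hom.app_eq_appLE _
  have : (pullback.fst f P).appLE (f ⁻¹ᵁ V) ⊤ hle ≫ (fibreAut f P g).appTop =
      (autAction f g).hom.appLE (f ⁻¹ᵁ V) (f ⁻¹ᵁ V) (le_preimage_autAction f V g) ≫
        (pullback.fst f P).appLE (f ⁻¹ᵁ V) ⊤ hle := by
    rw [e, Scheme.Hom.appLE_comp_appLE, Scheme.Hom.appLE_comp_appLE]
    simp only [fibreAut_fst]
  exact ConcreteCategory.congr_hom this b

/-- The fibre of `f` at a point of `U` is a fibre of `f ∣_ U`. -/
theorem isPullback_fibre {U : X.Opens} (hP : ⊤ ≤ P ⁻¹ᵁ U) :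
    ∃ (P' : Spec (.of K) ⟶ U) (i : pullback f P ⟶ (f ⁻¹ᵁ U : Y.Opens)), P' ≫ U.ι = P ∧
      i ≫ (f ⁻¹ᵁ U).ι = pullback.fst f P ∧ IsPullback i (pullback.snd f P) (f ∣_ U) P' := by
  have hr : Set.range P ⊆ Set.range U.ι := by
    rintro _ ⟨x, rfl⟩
    rw [Scheme.Opens.range_ι]
    exact hP (Set.mem_univ x)
  let P' := IsOpenImmersion.lift U.ι P hr
  have hP' : P' ≫ U.ι = P := IsOpenImmersion.lift_fac _ _ _
  have hsq := isPullback_morphismRestrict f U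
  have h1 : (pullback.snd f P ≫ P') ≫ U.ι = pullback.fst f P ≫ f := by
    rw [Category.assoc, hP', pullback.condition]
  refine ⟨P', hsq.lift _ _ h1, hP', hsq.lift_snd _ _ h1, .of_right (h₁₂ := (f ⁻¹ᵁ U).ι) (v₁₃ := f)
    (h₂₂ := U.ι) ?_ (hsq.lift_fst _ _ h1) hsq.flip⟩
  rw [hsq.lift_snd _ _ h1, hP']
  exact .of_hasPullback f P

/-- The fibre is étale over a field, hence reduced. -/
theorem isReduced_fibre {U : X.Opens} [Etale (f ∣_ U)] [IsFinite f] (hP : ⊤ ≤ P ⁻¹ᵁ U) :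
    _root_.IsReduced Γ(pullback f P, ⊤) := by
  obtain ⟨P', i, -, -, h⟩ := isPullback_fibre f P hP
  have h1 : Etale (pullback.snd f P) := MorphismProperty.of_isPullback h ‹_›
  have hQ : IsAffine (pullback f P) := isAffine_of_isAffineHom (pullback.snd f P)
  have h2 := (pullback.snd f P).etale_appLE (isAffineOpen_top _) (isAffineOpen_top _) le_top
  have h3 : (fibreMap f P).Etale := by
    have e : (pullback.snd f P).appTop = (pullback.snd f P).appLE ⊤ ⊤ le_top :=
      Scheme.Hom.app_eq_appLE _
    rw [fibreMap, e, CommRingCat.hom_comp]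
    exact RingHom.Etale.stableUnderComposition _ _ (RingHom.Etale.of_bijective
      (ConcreteCategory.bijective_of_isIso (Scheme.ΓSpecIso (.of K)).inv)) h2
  algebraize [fibreMap f P]
  exact Algebra.FormallyUnramified.isReduced_of_field K _

section Points

variable [IsAffine (pullback f P)] {Ω : Type} [Field Ω]

/-- The geometric point of the fibre given by a homomorphism `ψ`. -/
noncomputable def fibrePoint (ψ : Γ(pullback f P, ⊤) →+* Ω) : Spec (.of Ω) ⟶ pullback f P :=
  Spec.map (CommRingCat.ofHom ψ) ≫ (pullback f P).isoSpec.inv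

theorem fibrePoint_injective {ψ ψ' : Γ(pullback f P, ⊤) →+* Ω}
    (h : fibrePoint f P ψ = fibrePoint f P ψ') : ψ = ψ' := by
  rw [fibrePoint, fibrePoint, cancel_mono] at h
  exact congrArg CommRingCat.Hom.hom (Spec.map_injective h)

theorem fibrePoint_fibreAut (ψ : Γ(pullback f P, ⊤) →+* Ω) (g : AutOver f) :
    fibrePoint f P ψ ≫ fibreAut f P g = fibrePoint f P (ψ.comp (fibreAction f P g)) := by
  rw [fibrePoint, fibrePoint, Category.assoc, ← Scheme.isoSpec_inv_naturality,
    ← Spec.map_comp_assoc]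
  rfl

theorem fibrePoint_snd (ψ : Γ(pullback f P, ⊤) →+* Ω) :
    fibrePoint f P ψ ≫ pullback.snd f P = Spec.map (CommRingCat.ofHom (ψ.comp (fibreMap f P))) := by
  rw [fibrePoint, Category.assoc, ← Scheme.isoSpec_inv_naturality, Scheme.isoSpec_Spec_inv,
    ← Spec.map_comp, ← Spec.map_comp]
  rfl

end Points

/-- The fibre of a Galois cover at a rational point `P` of the étale locus is the spectrum of a
Galois algebra. An invariant function on it is constant because `Aut(f)` acts transitively on the
geometric fibre, and freeness is inherited from the functions on a neighbourhood of `P`. -/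
theorem isGaloisExtension_fibre [CharZero K] [IsFinite f] [Surjective f] [IsIntegral Y]
    (hgal : IsGaloisCover f) {U : X.Opens} [Etale (f ∣_ U)] (hP : ⊤ ≤ P ⁻¹ᵁ U) :
    IsGaloisExtension (fibreMap f P) (fibreAction f P) := by
  have hQ : IsAffine (pullback f P) := isAffine_of_isAffineHom (pullback.snd f P)
  have hinj : Function.Injective (fibreMap f P) := by
    have h1 : Surjective (pullback.snd f P) := inferInstance
    obtain ⟨q, -⟩ := h1.surj default
    have : Nonempty (⊤ : (pullback f P).Opens) := ⟨⟨q, trivial⟩⟩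
    have : Nontrivial Γ(pullback f P, ⊤) := inferInstance
    exact (fibreMap f P).injective
  refine ⟨fun c ↦ ?_, fun g h c ↦ ?_, fun g r ↦ ?_, hinj, fun a ha ↦ ?_, ?_⟩
  · have : fibreAut f P 1 = 𝟙 _ := by
      refine pullback.hom_ext ?_ ?_
      · rw [fibreAut_fst, map_one, Category.id_comp]
        exact Category.comp_id _
      · rw [fibreAut_snd, Category.id_comp]
    simp [fibreAction, this]
  · have : fibreAut f P (g * h) = fibreAut f P h ≫ fibreAut f P g := by
      refine pullback.hom_ext ?_ ?_
      · rw [fibreAut_fst, map_mul, Category.assoc, fibreAut_fst, ← Category.assoc, fibreAut_fst,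
          Category.assoc]
        rfl
      · rw [fibreAut_snd, Category.assoc, fibreAut_snd, fibreAut_snd]
    rw [fibreAction, this, Scheme.Hom.comp_appTop]
    rfl
  · change ((Scheme.ΓSpecIso (.of K)).inv ≫ (pullback.snd f P).appTop ≫ (fibreAut f P g).appTop) r =
      _
    rw [← Scheme.Hom.comp_appTop, fibreAut_snd]
    rfl
  · have hred := isReduced_fibre f P hP
    let Ω := AlgebraicClosure K
    have hconj (ψ ψ' : Γ(pullback f P, ⊤) →+* Ω)
        (hψ : ψ.comp (fibreMap f P) = ψ'.comp (fibreMap f P)) : ψ a = ψ' a := by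
      have e1 : fibrePoint f P ψ ≫ pullback.snd f P = fibrePoint f P ψ' ≫ pullback.snd f P := by
        rw [fibrePoint_snd, fibrePoint_snd, hψ]
      obtain ⟨g, hg⟩ := hgal Ω (fibrePoint f P ψ ≫ pullback.snd f P ≫ P)
        (fibrePoint f P ψ ≫ pullback.fst f P) (fibrePoint f P ψ' ≫ pullback.fst f P)
        (by rw [Category.assoc, pullback.condition])
        (by rw [Category.assoc, pullback.condition, ← Category.assoc, ← Category.assoc, e1])
      have e2 : fibrePoint f P ψ ≫ fibreAut f P g = fibrePoint f P ψ' := by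
        refine pullback.hom_ext ?_ ?_
        · rw [← hg, Category.assoc, Category.assoc, fibreAut_fst]
        · rw [← e1, Category.assoc, fibreAut_snd]
      rw [fibrePoint_fibreAut] at e2
      rw [← fibrePoint_injective f P e2, RingHom.comp_apply, ha]
    have hfin : (fibreMap f P).Finite := by
      refine RingHom.Finite.comp ?_ (RingHom.Finite.of_surjective _ ?_)
      · exact IsFinite.finite_app (pullback.snd f P) _ (isAffineOpen_top _)
      · exact (ConcreteCategory.bijective_of_isIso (Scheme.ΓSpecIso (.of K)).inv).2
    algebraize [fibreMap f P]
    have hnt : Nontrivial Γ(pullback f P, ⊤) := hinj.nontrivial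
    exact exists_algebraMap_eq_of_forall_eq (Ω := Ω) fun ψ ψ' ↦ hconj ψ ψ' <| RingHom.ext fun k ↦
      (ψ.commutes k).trans (ψ'.commutes k).symm
  · let x : X := P default
    obtain ⟨V, hV, hxV, hVU⟩ := exists_isAffineOpen_mem_and_subset
      (x := x) (U := U) (hP (Set.mem_univ (default : Spec (.of K))))
    obtain ⟨n, u, v, h1, h0⟩ := isFreeRingAction_autSections f (U := U) hV hVU ⟨x, hxV⟩
    have hPV : ⊤ ≤ P ⁻¹ᵁ V := fun z _ ↦ by
      rw [Subsingleton.elim z default]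
      exact hxV
    refine ⟨n, fun i ↦ fibreRestrict f P V hPV (u i), fun i ↦ fibreRestrict f P V hPV (v i), ?_,
      fun g hg ↦ ?_⟩
    · simp only [← map_mul, ← map_sum, h1, map_one]
    · simp only [fibreAction_fibreRestrict, ← map_mul, ← map_sum, h0 g hg, map_zero]

end Fibres

/-! ### Gluing subalgebras of functions -/

section Subalgebras

universe u

variable {W X : Scheme.{u}} (a : W ⟶ X)

/-- The restriction map of functions on preimages of open subsets of `X`. -/
noncomputable abbrev restrictPreimage {U V : X.Opens} (h : V ≤ U) :
    Γ(W, a ⁻¹ᵁ U) →+* Γ(W, a ⁻¹ᵁ V) :=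
  (W.presheaf.map (homOfLE (a.preimage_mono h)).op).hom

/-- A function on the preimage of `X_r` extends to the preimage of `U` after multiplication by a
power of `r`. -/
theorem exists_restrictPreimage_eq_pow_mul [QuasiCompact a] [QuasiSeparated a] {U : X.Opens}
    (hU : IsAffineOpen U) (r : Γ(X, U)) (c : Γ(W, a ⁻¹ᵁ X.basicOpen r)) :
    ∃ (n : ℕ) (c' : Γ(W, a ⁻¹ᵁ U)), restrictPreimage a (X.basicOpen_le r) c' =
      restrictPreimage a (X.basicOpen_le r) (a.app U r) ^ n * c := by
  have key : ∀ (D : W.Opens) (hD : D = W.basicOpen (a.app U r)) (hle : D ≤ a ⁻¹ᵁ U) (c : Γ(W, D)),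
      ∃ (n : ℕ) (c' : Γ(W, a ⁻¹ᵁ U)), W.presheaf.map (homOfLE hle).op c' =
        W.presheaf.map (homOfLE hle).op (a.app U r) ^ n * c := by
    rintro _ rfl hle c
    exact exists_eq_pow_mul_of_isCompact_of_isQuasiSeparated W _
      (a.isCompact_preimage hU.isCompact) (a.isQuasiSeparated_preimage hU.isQuasiSeparated) _ c
  exact key _ (a.preimage_basicOpen r) _ c

theorem exists_pow_mul_eq_zero [QuasiCompact a] {U : X.Opens}
    (hU : IsAffineOpen U) (r : Γ(X, U)) {c : Γ(W, a ⁻¹ᵁ U)}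
    (hc : restrictPreimage a (X.basicOpen_le r) c = 0) : ∃ n : ℕ, a.app U r ^ n * c = 0 := by
  have key : ∀ (D : W.Opens) (hD : D = W.basicOpen (a.app U r)) (hle : D ≤ a ⁻¹ᵁ U),
      W.presheaf.map (homOfLE hle).op c = 0 → ∃ n : ℕ, a.app U r ^ n * c = 0 := by
    rintro _ rfl hle hc
    exact exists_pow_mul_eq_zero_of_res_basicOpen_eq_zero_of_isCompact W
      (a.isCompact_preimage hU.isCompact) c _ hc
  exact key _ (a.preimage_basicOpen r) _ hc

theorem isIso_appLE_of_isOpenImmersion (i : W ⟶ X) [IsOpenImmersion i] {U : X.Opens} {V : W.Opens}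
    (hU : U ≤ i.opensRange) (hV : i ⁻¹ᵁ U ≤ V) (h : V ≤ i ⁻¹ᵁ U) : IsIso (i.appLE U V h) := by
  obtain rfl := le_antisymm h hV
  rw [← Scheme.Hom.app_eq_appLE]
  exact i.isIso_app U hU

/-- A quasi-coherent `𝒪_X`-subalgebra of `a_* 𝒪_W`, for a morphism `a : W ⟶ X`. Quasi-coherence is
expressed by `exists_pow`: a section over a basic open subset `X_r` of an affine open subset `U`
extends to `U` after multiplication by a power of `r`. The sheaf property is not required, because
only sections over affine open subsets are used. -/
structure QCohSubalgebra where
  /-- The sections of the subalgebra. -/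
  ring (U : X.Opens) : Subring Γ(W, a ⁻¹ᵁ U)
  restrict_mem {U V : X.Opens} (h : V ≤ U) {c} (hc : c ∈ ring U) : restrictPreimage a h c ∈ ring V
  app_mem (U : X.Opens) (r : Γ(X, U)) : a.app U r ∈ ring U
  exists_pow {U : X.Opens} (hU : IsAffineOpen U) (r : Γ(X, U)) {c} (hc : c ∈ ring (X.basicOpen r)) :
    ∃ (n : ℕ) (c' : Γ(W, a ⁻¹ᵁ U)), c' ∈ ring U ∧
      restrictPreimage a (X.basicOpen_le r) c' =
        restrictPreimage a (X.basicOpen_le r) (a.app U r) ^ n * c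

namespace QCohSubalgebra

variable {a} (𝒜 : QCohSubalgebra a)

/-- The presheaf of sections of a quasi-coherent subalgebra. -/
noncomputable def presheaf : X.Opensᵒᵖ ⥤ CommRingCat where
  obj U := .of (𝒜.ring U.unop)
  map {V U} i := CommRingCat.ofHom ((restrictPreimage a i.unop.le).restrict _ _
    fun _ hx ↦ 𝒜.restrict_mem i.unop.le hx)
  map_id U := by
    ext x
    change W.presheaf.map (𝟙 _) x.1 = x.1
    rw [W.presheaf.map_id]
    rfl
  map_comp i j := by
    ext x
    change W.presheaf.map (homOfLE _).op x.1 = W.presheaf.map (homOfLE _).op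
      (W.presheaf.map (homOfLE _).op x.1)
    rw [← CommRingCat.comp_apply, ← W.presheaf.map_comp]
    rfl

/-- The structure morphism of a quasi-coherent subalgebra. -/
noncomputable def presheafMap : X.presheaf ⟶ 𝒜.presheaf where
  app U := CommRingCat.ofHom ((a.app U.unop).hom.codRestrict _ (𝒜.app_mem U.unop))
  naturality {U V} i := by
    ext x
    exact Subtype.ext (ConcreteCategory.congr_hom (a.naturality i) x)

open Scheme AffineZariskiSite in
/-- The rings of sections over affine open subsets are compatible with localization, which is the
condition for their spectra to glue. -/
theorem coequifibered [QuasiCompact a] [QuasiSeparated a] :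
    (Functor.whiskerLeft (toOpensFunctor X).op 𝒜.presheafMap).Coequifibered := by
  refine coequifibered_iff_forall_isLocalizationAway.mpr fun U r ↦ ?_
  let : Algebra (𝒜.ring U.1) (𝒜.ring (X.basicOpen r)) :=
    (𝒜.presheaf.map (homOfLE (X.basicOpen_le r)).op).hom.toAlgebra
  change IsLocalization.Away (⟨a.app U.1 r, 𝒜.app_mem U.1 r⟩ : 𝒜.ring U.1) (𝒜.ring (X.basicOpen r))
  have halg (x : 𝒜.ring U.1) : (algebraMap (𝒜.ring U.1) (𝒜.ring (X.basicOpen r)) x).1 =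
    restrictPreimage a (X.basicOpen_le r) x.1 := rfl
  have hr : algebraMap (𝒜.ring U.1) (𝒜.ring (X.basicOpen r)) ⟨a.app U.1 r, 𝒜.app_mem U.1 r⟩ =
      (a.app (X.basicOpen r)).hom.codRestrict _ (𝒜.app_mem (X.basicOpen r))
        (X.presheaf.map (homOfLE (X.basicOpen_le r)).op r) :=
    Subtype.ext (ConcreteCategory.congr_hom (a.naturality (homOfLE (X.basicOpen_le r)).op) r).symm
  refine IsLocalization.Away.mk _ ?_ (fun c ↦ ?_) (fun c c' h ↦ ?_)
  · rw [hr]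
    refine RingHom.isUnit_map _ ?_
    exact RingedSpace.isUnit_res_basicOpen _ r
  · obtain ⟨n, c', hc', h⟩ := 𝒜.exists_pow U.2 r c.2
    refine ⟨n, ⟨c', hc'⟩, Subtype.ext ?_⟩
    exact (mul_comm _ _).trans h.symm
  · have h1 : restrictPreimage a (X.basicOpen_le r) (c.1 - c'.1) = 0 := by
      rw [map_sub, sub_eq_zero]
      exact congrArg Subtype.val h
    obtain ⟨n, hn⟩ := exists_pow_mul_eq_zero a U.2 r h1
    refine ⟨n, Subtype.ext ?_⟩
    rw [mul_sub, sub_eq_zero] at hn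
    exact hn

open Scheme AffineZariskiSite in
/-- The gluing data for the relative spectrum of a quasi-coherent subalgebra. -/
noncomputable def glueData [QuasiCompact a] [QuasiSeparated a] :
    (AffineZariskiSite.directedCover X).RelativeGluingData :=
  relativeGluingData 𝒜.coequifibered

/-- The restriction of `W ⟶ Spec 𝒜` to the preimage of an affine open subset, with values in the
chart. -/
noncomputable def toChart (U : X.affineOpens) :
    (a ⁻¹ᵁ U.1 : W.Opens).toScheme ⟶ Spec (.of (𝒜.ring U.1)) :=
  (a ⁻¹ᵁ U.1).toSpecΓ ≫ Spec.map (CommRingCat.ofHom (𝒜.ring U.1).subtype)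

theorem homOfLE_toChart {U V : X.affineOpens} (h : U.1 ≤ V.1) :
    W.homOfLE (a.preimage_mono h) ≫ 𝒜.toChart V =
      𝒜.toChart U ≫ Spec.map (𝒜.presheaf.map (homOfLE h).op) := by
  have h1 : W.homOfLE (a.preimage_mono h) ≫ (a ⁻¹ᵁ V.1).toSpecΓ =
      (a ⁻¹ᵁ U.1).toSpecΓ ≫ Spec.map (W.presheaf.map (homOfLE (a.preimage_mono h)).op) := by
    simp
  have h2 : Spec.map (W.presheaf.map (homOfLE (a.preimage_mono h)).op) ≫
      Spec.map (CommRingCat.ofHom (𝒜.ring V.1).subtype) =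
      Spec.map (CommRingCat.ofHom (𝒜.ring U.1).subtype) ≫
        Spec.map (𝒜.presheaf.map (homOfLE h).op) :=
    (Spec.map_comp _ _).symm.trans (Spec.map_comp (𝒜.presheaf.map (homOfLE h).op)
      (CommRingCat.ofHom (𝒜.ring U.1).subtype))
  exact (Category.assoc _ _ _).symm.trans ((congrArg (· ≫ _) h1).trans
    ((Category.assoc _ _ _).trans ((congrArg (_ ≫ ·) h2).trans (Category.assoc _ _ _).symm)))

variable [QuasiCompact a] [QuasiSeparated a]

instance : (𝒜.glueData.functor ⋙ Scheme.forget).IsLocallyDirected :=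
  Scheme.Cover.RelativeGluingData.instIsLocallyDirectedI₀CompFunctorForgetOfIsThin ..

/-- The relative spectrum of a quasi-coherent subalgebra. -/
noncomputable def spec : Scheme.{u} := 𝒜.glueData.glued

/-- The affine open cover of the relative spectrum. -/
noncomputable def chart (U : X.affineOpens) : Spec (.of (𝒜.ring U.1)) ⟶ 𝒜.spec :=
  𝒜.glueData.cover.f U

/-- The structure morphism of the relative spectrum. -/
noncomputable def toBase : 𝒜.spec ⟶ X := 𝒜.glueData.toBase

theorem chart_toBase (U : X.affineOpens) :
    𝒜.chart U ≫ 𝒜.toBase = Spec.map (𝒜.presheafMap.app (.op U.1)) ≫ U.2.fromSpec :=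
  colimit.ι_desc _ _

instance (U : X.affineOpens) : IsOpenImmersion (𝒜.chart U) :=
  𝒜.glueData.cover.map_prop U

theorem toBase_preimage (U : X.affineOpens) : 𝒜.toBase ⁻¹ᵁ U.1 = (𝒜.chart U).opensRange := by
  have := 𝒜.glueData.toBase_preimage_eq_opensRange_ι U
  refine Eq.trans ?_ this
  exact congrArg (𝒜.toBase ⁻¹ᵁ ·) U.1.opensRange_ι.symm

instance : IsAffineHom 𝒜.toBase := by
  refine ⟨fun U hU ↦ ?_⟩
  rw [𝒜.toBase_preimage ⟨U, hU⟩]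
  exact isAffineOpen_opensRange _

open Scheme AffineZariskiSite in
theorem exists_toSpec : ∃ q : W ⟶ 𝒜.spec, ∀ U : X.affineOpens,
    (a ⁻¹ᵁ U.1).ι ≫ q = 𝒜.toChart U ≫ 𝒜.chart U := by
  have hι (U : X.affineOpens) : (pullbackRestrictIsoRestrict a U.1).hom ≫ (a ⁻¹ᵁ U.1).ι =
      ((directedCover X).pullback₁ a).f U := pullbackRestrictIsoRestrict_hom_ι a U.1
  have H {U V : X.AffineZariskiSite} (i : U ⟶ V) :
      Cover.trans ((directedCover X).pullback₁ a) i ≫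
        (pullbackRestrictIsoRestrict a V.1).hom ≫ 𝒜.toChart V ≫ 𝒜.chart V =
      (pullbackRestrictIsoRestrict a U.1).hom ≫ 𝒜.toChart U ≫ 𝒜.chart U := by
    have h1 : Cover.trans ((directedCover X).pullback₁ a) i ≫
        (pullbackRestrictIsoRestrict a V.1).hom =
        (pullbackRestrictIsoRestrict a U.1).hom ≫
          W.homOfLE (a.preimage_mono (toOpens_mono i.le)) := by
      refine (cancel_mono (Scheme.Opens.ι _)).mp ?_
      refine (Category.assoc _ _ _).trans ((congrArg (_ ≫ ·) (hι V)).trans ?_)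
      refine (Cover.trans_map ((directedCover X).pullback₁ a) i).trans ?_
      refine (hι U).symm.trans (Eq.trans ?_ (Category.assoc _ _ _).symm)
      exact congrArg (_ ≫ ·) (Scheme.homOfLE_ι _ _).symm
    have h2 : 𝒜.chart U = Spec.map (𝒜.presheaf.map (homOfLE (toOpens_mono i.le)).op) ≫ 𝒜.chart V :=
      (colimit.w 𝒜.glueData.functor i).symm
    have h3 : W.homOfLE (a.preimage_mono (toOpens_mono i.le)) ≫ 𝒜.toChart V ≫ 𝒜.chart V =
        𝒜.toChart U ≫ 𝒜.chart U := by
      refine (Category.assoc _ _ _).symm.trans ?_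
      refine (congrArg (· ≫ _) (𝒜.homOfLE_toChart (U := U) (V := V) (toOpens_mono i.le))).trans ?_
      exact (Category.assoc _ _ _).trans (congrArg (_ ≫ ·) h2.symm)
    exact (Category.assoc _ _ _).symm.trans ((congrArg (· ≫ _) h1).trans
      ((Category.assoc _ _ _).trans (congrArg (_ ≫ ·) h3)))
  refine ⟨Scheme.OpenCover.glueMorphismsOfLocallyDirected ((directedCover X).pullback₁ a)
    (fun U ↦ (pullbackRestrictIsoRestrict a _).hom ≫ 𝒜.toChart U ≫ 𝒜.chart U) H, fun U ↦ ?_⟩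
  refine (cancel_epi (pullbackRestrictIsoRestrict a U.1).hom).mp ?_
  refine (Category.assoc _ _ _).symm.trans ((congrArg (· ≫ _) (hι U)).trans ?_)
  exact Scheme.OpenCover.map_glueMorphismsOfLocallyDirected _ _ H _

/-- The morphism from `W` to the relative spectrum of a subalgebra of functions on `W`. -/
noncomputable def toSpec : W ⟶ 𝒜.spec := 𝒜.exists_toSpec.choose

theorem ι_toSpec (U : X.affineOpens) :
    (a ⁻¹ᵁ U.1).ι ≫ 𝒜.toSpec = 𝒜.toChart U ≫ 𝒜.chart U :=
  𝒜.exists_toSpec.choose_spec U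

theorem toSpec_toBase : 𝒜.toSpec ≫ 𝒜.toBase = a := by
  suffices h : ∀ U : X.affineOpens, (a ⁻¹ᵁ U.1).ι ≫ 𝒜.toSpec ≫ 𝒜.toBase = (a ⁻¹ᵁ U.1).ι ≫ a from
    Scheme.Cover.hom_ext (W.openCoverOfIsOpenCover _
      (.comap (iSup_affineOpens_eq_top X) a.base.1)) _ _ h
  intro U
  have h1 : (a ⁻¹ᵁ U.1).toSpecΓ ≫ Spec.map (a.app _) ≫ U.2.fromSpec = (a ⁻¹ᵁ U.1).ι ≫ a := by
    have hU : IsAffineOpen U.1 := U.2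
    change _ ≫ _ ≫ hU.fromSpec = _
    simp
  have h2 : Spec.map (CommRingCat.ofHom (𝒜.ring U.1).subtype) ≫
      Spec.map (𝒜.presheafMap.app (.op U.1)) = Spec.map (a.app U.1) :=
    (Spec.map_comp (𝒜.presheafMap.app (.op U.1)) _).symm
  refine (Category.assoc _ _ _).symm.trans ((congrArg (· ≫ _) (𝒜.ι_toSpec U)).trans ?_)
  refine (Category.assoc _ _ _).trans ((congrArg (_ ≫ ·) (𝒜.chart_toBase U)).trans ?_)
  refine (Category.assoc _ _ _).trans (Eq.trans (congrArg (_ ≫ ·) ?_) h1)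
  exact (Category.assoc _ _ _).symm.trans (congrArg (· ≫ _) h2)

theorem le_toSpec_preimage (U : X.Opens) : a ⁻¹ᵁ U ≤ 𝒜.toSpec ⁻¹ᵁ (𝒜.toBase ⁻¹ᵁ U) := by
  rw [← Scheme.Hom.comp_preimage, 𝒜.toSpec_toBase]

/-- Functions on the relative spectrum are identified with sections of the subalgebra. -/
theorem exists_toSpec_appLE (U : X.affineOpens) :
    ∃ e : Γ(𝒜.spec, 𝒜.toBase ⁻¹ᵁ U.1) ≃+* 𝒜.ring U.1, ∀ s,
      𝒜.toSpec.appLE (𝒜.toBase ⁻¹ᵁ U.1) (a ⁻¹ᵁ U.1) (𝒜.le_toSpec_preimage U.1) s = (e s).1 := by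
  have h1 : ⊤ ≤ 𝒜.chart U ⁻¹ᵁ (𝒜.toBase ⁻¹ᵁ U.1) := by
    rw [𝒜.toBase_preimage U, Scheme.Hom.preimage_opensRange]
  have h2 : IsIso ((𝒜.chart U).appLE (𝒜.toBase ⁻¹ᵁ U.1) ⊤ h1) := by
    exact isIso_appLE_of_isOpenImmersion _ (𝒜.toBase_preimage U).le le_top h1
  let E := asIso ((𝒜.chart U).appLE (𝒜.toBase ⁻¹ᵁ U.1) ⊤ h1) ≪≫ Scheme.ΓSpecIso _
  refine ⟨E.commRingCatIsoToRingEquiv, fun s ↦ ?_⟩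
  have h3 : ⊤ ≤ (a ⁻¹ᵁ U.1).ι ⁻¹ᵁ (a ⁻¹ᵁ U.1) := by simp
  have h4 : 𝒜.toSpec.appLE (𝒜.toBase ⁻¹ᵁ U.1) (a ⁻¹ᵁ U.1) (𝒜.le_toSpec_preimage U.1) ≫
      (a ⁻¹ᵁ U.1).ι.appLE (a ⁻¹ᵁ U.1) ⊤ h3 = (𝒜.chart U).appLE (𝒜.toBase ⁻¹ᵁ U.1) ⊤ h1 ≫
        (𝒜.toChart U).appLE ⊤ ⊤ (Scheme.Hom.preimage_top _).ge := by
    rw [Scheme.Hom.appLE_comp_appLE, Scheme.Hom.appLE_comp_appLE]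
    simp only [𝒜.ι_toSpec U]
  have h5 : (𝒜.toChart U).appLE ⊤ ⊤ (Scheme.Hom.preimage_top _).ge =
      (Scheme.ΓSpecIso _).hom ≫ CommRingCat.ofHom (𝒜.ring U.1).subtype ≫
      (a ⁻¹ᵁ U.1).ι.appLE (a ⁻¹ᵁ U.1) ⊤ h3 := by
    have h8 : (a ⁻¹ᵁ U.1).toSpecΓ.appTop = (Scheme.ΓSpecIso _).hom ≫
        (a ⁻¹ᵁ U.1).ι.appLE (a ⁻¹ᵁ U.1) ⊤ h3 := by
      rw [Scheme.Opens.toSpecΓ_appTop, Scheme.Opens.ι_appLE]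
      rfl
    have h9 := Scheme.ΓSpecIso_naturality (CommRingCat.ofHom (𝒜.ring U.1).subtype)
    have h7 : (𝒜.toChart U).appTop = (Spec.map (CommRingCat.ofHom (𝒜.ring U.1).subtype)).appTop ≫
      (a ⁻¹ᵁ U.1).toSpecΓ.appTop := Scheme.Hom.comp_appTop _ _
    refine (Scheme.Hom.app_eq_appLE _).symm.trans (h7.trans ?_)
    refine (congrArg (_ ≫ ·) h8).trans ((Category.assoc _ _ _).symm.trans ?_)
    exact (congrArg (· ≫ _) h9).trans (Category.assoc _ _ _)
  have h6 : IsIso ((a ⁻¹ᵁ U.1).ι.appLE (a ⁻¹ᵁ U.1) ⊤ h3) :=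
    isIso_appLE_of_isOpenImmersion _ (by simp) le_top h3
  rw [h5, ← Category.assoc, ← Category.assoc, cancel_mono] at h4
  exact ConcreteCategory.congr_hom h4 s

end QCohSubalgebra

end Subalgebras

section Constraints

universe u

variable {W' W X : Scheme.{u}} {a : W ⟶ X} {b : W' ⟶ X}

/-- The pull-back of functions along a morphism of `X`-schemes, over an open subset of `X`. -/
noncomputable def pullPreimage (v : W' ⟶ W) (h : v ≫ a = b) (U : X.Opens) :
    Γ(W, a ⁻¹ᵁ U) →+* Γ(W', b ⁻¹ᵁ U) :=
  (v.appLE (a ⁻¹ᵁ U) (b ⁻¹ᵁ U) (by rw [← h, Scheme.Hom.comp_preimage])).hom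

theorem restrictPreimage_pullPreimage (v : W' ⟶ W) (h : v ≫ a = b) {U V : X.Opens} (hVU : V ≤ U)
    (c : Γ(W, a ⁻¹ᵁ U)) : restrictPreimage b hVU (pullPreimage v h U c) =
      pullPreimage v h V (restrictPreimage a hVU c) := by
  change ((v.appLE _ _ _) ≫ W'.presheaf.map _) c = (W.presheaf.map _ ≫ v.appLE _ _ _) c
  rw [Scheme.Hom.appLE_map, Scheme.Hom.map_appLE]

theorem pullPreimage_app (v : W' ⟶ W) (h : v ≫ a = b) (U : X.Opens) (r : Γ(X, U)) :
    pullPreimage v h U (a.app U r) = b.app U r := by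
  subst h
  change (a.app U ≫ v.appLE _ _ _) r = _
  rw [Scheme.Hom.comp_app, Scheme.Hom.app_eq_appLE v]
  rfl

theorem pullPreimage_id (U : X.Opens) (c : Γ(W, a ⁻¹ᵁ U)) :
    pullPreimage (𝟙 W) (Category.id_comp a) U c = c := by
  change ((𝟙 W : W ⟶ W).appLE _ _ _) c = c
  have h : (𝟙 W : W ⟶ W).appLE (a ⁻¹ᵁ U) (a ⁻¹ᵁ U) le_rfl = 𝟙 _ :=
    ((𝟙 W : W ⟶ W).app_eq_appLE (U := a ⁻¹ᵁ U)).symm.trans (Scheme.Hom.id_app _)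
  exact ConcreteCategory.congr_hom h c

theorem pullPreimage_comp {W'' : Scheme.{u}} {d : W'' ⟶ X} (w : W'' ⟶ W') (v : W' ⟶ W)
    (hw : w ≫ b = d) (hv : v ≫ a = b) (hwv : (w ≫ v) ≫ a = d) (U : X.Opens) (c : Γ(W, a ⁻¹ᵁ U)) :
    pullPreimage (w ≫ v) hwv U c = pullPreimage w hw U (pullPreimage v hv U c) := by
  change _ = (v.appLE _ _ _ ≫ w.appLE _ _ _) c
  rw [Scheme.Hom.appLE_comp_appLE]
  rfl

theorem restrictPreimage_app (a : W ⟶ X) {U V : X.Opens} (hVU : V ≤ U) (r : Γ(X, U)) :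
    restrictPreimage a hVU (a.app U r) = a.app V (X.presheaf.map (homOfLE hVU).op r) :=
  (ConcreteCategory.congr_hom (a.naturality (homOfLE hVU).op) r).symm

/-- The subalgebra of invariants of a finite group acting on an `X`-scheme. -/
noncomputable def invariants {G : Type} [Finite G] [QuasiCompact a] [QuasiSeparated a]
    (ρ : G → (W ⟶ W)) (hρ : ∀ g, ρ g ≫ a = a) : QCohSubalgebra a where
  ring U := ⨅ g, RingHom.eqLocus (pullPreimage (ρ g) (hρ g) U) (RingHom.id _)
  restrict_mem h c hc := by
    simp only [Subring.mem_iInf, RingHom.mem_eqLocus, RingHom.id_apply] at hc ⊢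
    intro g
    rw [← restrictPreimage_pullPreimage, hc]
  app_mem U r := by
    simp only [Subring.mem_iInf, RingHom.mem_eqLocus, RingHom.id_apply]
    exact fun g ↦ pullPreimage_app _ _ _ _
  -- An invariant section `c` over `X_r` extends to `c'` over `U` after multiplication by a power of
  -- `r`; the differences of `c'` and its translates vanish on `X_r`, so they are killed by a power
  -- of `r`.
  exists_pow {U} hU r c hc := by
    simp only [Subring.mem_iInf, RingHom.mem_eqLocus, RingHom.id_apply] at hc ⊢
    obtain ⟨n, c', hc'⟩ := exists_restrictPreimage_eq_pow_mul a hU r c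
    have h1 (g : G) : ∃ k : ℕ, a.app U r ^ k * (pullPreimage (ρ g) (hρ g) U c' - c') = 0 := by
      refine exists_pow_mul_eq_zero a hU r ?_
      rw [map_sub, restrictPreimage_pullPreimage, hc', map_mul, hc, map_pow, restrictPreimage_app,
        pullPreimage_app, sub_self]
    choose k hk using h1
    have := Fintype.ofFinite G
    classical
    refine ⟨(∑ g, k g) + n, a.app U r ^ (∑ g, k g) * c', fun g ↦ ?_, ?_⟩
    · rw [map_mul, map_pow, pullPreimage_app, ← sub_eq_zero, ← mul_sub,
        ← Finset.add_sum_erase _ k (Finset.mem_univ g), pow_add, mul_assoc, mul_left_comm, hk,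
        mul_zero]
    · rw [map_mul, hc', map_pow, pow_add, mul_assoc]

/-- The subalgebra of the functions on `W` whose pull-back to `W' i` along `w i` comes from a
function on the `X`-scheme `𝒯 i`, for all `i`. -/
noncomputable def liftable {ι : Type} [Finite ι] [QuasiCompact a] [QuasiSeparated a]
    {W' 𝒯 : ι → Scheme.{u}} {b : ∀ i, W' i ⟶ X} [∀ i, QuasiCompact (b i)] (w : ∀ i, W' i ⟶ W)
    (hw : ∀ i, w i ≫ a = b i) {h : ∀ i, 𝒯 i ⟶ X} [∀ i, QuasiCompact (h i)]
    [∀ i, QuasiSeparated (h i)] (v : ∀ i, W' i ⟶ 𝒯 i) (hv : ∀ i, v i ≫ h i = b i) :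
    QCohSubalgebra a where
  ring U := ⨅ i, (pullPreimage (v i) (hv i) U).range.comap (pullPreimage (w i) (hw i) U)
  restrict_mem {U V} h c hc := by
    simp only [Subring.mem_iInf, Subring.mem_comap, RingHom.mem_range] at hc ⊢
    intro i
    obtain ⟨d, hd⟩ := hc i
    exact ⟨restrictPreimage _ h d, by
      rw [← restrictPreimage_pullPreimage, hd, restrictPreimage_pullPreimage]⟩
  app_mem U r := by
    simp only [Subring.mem_iInf, Subring.mem_comap, RingHom.mem_range]
    exact fun i ↦ ⟨(h i).app U r, by rw [pullPreimage_app, pullPreimage_app]⟩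
  exists_pow {U} hU r c hc := by
    simp only [Subring.mem_iInf, Subring.mem_comap, RingHom.mem_range] at hc ⊢
    obtain ⟨n, c', hc'⟩ := exists_restrictPreimage_eq_pow_mul a hU r c
    have h1 (i) : ∃ (k : ℕ) (d : Γ(𝒯 i, h i ⁻¹ᵁ U)), pullPreimage (v i) (hv i) U d =
        pullPreimage (w i) (hw i) U (a.app U r ^ k * c') := by
      obtain ⟨d, hd⟩ := hc i
      obtain ⟨m, d', hd'⟩ := exists_restrictPreimage_eq_pow_mul (h i) hU r d
      obtain ⟨k, hk⟩ : ∃ k : ℕ, (b i).app U r ^ k * ((b i).app U r ^ n *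
          pullPreimage (v i) (hv i) U d' -
          (b i).app U r ^ m * pullPreimage (w i) (hw i) U c') = 0 := by
        refine exists_pow_mul_eq_zero (b i) hU r ?_
        rw [map_sub, map_mul, map_mul, restrictPreimage_pullPreimage, restrictPreimage_pullPreimage,
          hc', hd', map_mul, map_mul, hd]
        simp only [map_pow, restrictPreimage_app, pullPreimage_app]
        ring
      rw [mul_sub, sub_eq_zero] at hk
      refine ⟨k + m, (h i).app U r ^ (k + n) * d', ?_⟩
      rw [map_mul, map_mul, map_pow, map_pow, pullPreimage_app, pullPreimage_app, pow_add, pow_add,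
        mul_assoc, mul_assoc, hk]
    choose k d hd using h1
    have := Fintype.ofFinite ι
    refine ⟨(∑ i, k i) + n, a.app U r ^ (∑ i, k i) * c', fun i ↦ ?_, ?_⟩
    · classical
      refine ⟨(h i).app U r ^ (∑ j ∈ Finset.univ.erase i, k j) * d i, ?_⟩
      rw [map_mul, hd, ← Finset.add_sum_erase _ k (Finset.mem_univ i), pow_add, map_mul, map_mul,
        map_mul, map_pow, map_pow, map_pow, pullPreimage_app, pullPreimage_app]
      ring
    · rw [map_mul, hc', map_pow, pow_add, mul_assoc]

/-- Over an affine open subset `U` the morphism `W ⟶ Spec 𝒜` restricts to the morphism to the chart.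
-/
theorem QCohSubalgebra.isPullback_toChart [QuasiCompact a] [QuasiSeparated a] (𝒜 : QCohSubalgebra a)
    (U : X.affineOpens) :
    IsPullback (a ⁻¹ᵁ U.1).ι (𝒜.toChart U) 𝒜.toSpec (𝒜.chart U) := by
  refine (IsOpenImmersion.isPullback _ _ _ _ (𝒜.ι_toSpec U) ?_).flip
  rw [Scheme.Opens.opensRange_ι, ← 𝒜.toBase_preimage, ← Scheme.Hom.comp_preimage, 𝒜.toSpec_toBase]

theorem QCohSubalgebra.isPullback_fromSpec [IsAffineHom a] (𝒜 : QCohSubalgebra a)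
    (U : X.affineOpens) :
    IsPullback (U.2.preimage a).fromSpec (Spec.map (CommRingCat.ofHom (𝒜.ring U.1).subtype))
      𝒜.toSpec (𝒜.chart U) := by
  have h : IsAffineOpen (a ⁻¹ᵁ U.1) := U.2.preimage a
  refine (𝒜.isPullback_toChart U).of_iso h.isoSpec (Iso.refl _) (Iso.refl _)
    (Iso.refl _) ?_ ?_ ?_ ?_
  · exact (Category.comp_id _).trans (h.toSpecΓ_fromSpec.symm.trans
      (congrArg (· ≫ h.fromSpec) h.isoSpec_hom.symm))
  · exact (Category.comp_id _).trans
      (congrArg (· ≫ Spec.map (CommRingCat.ofHom (𝒜.ring U.1).subtype)) h.isoSpec_hom.symm)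
  · rw [Iso.refl_hom, Iso.refl_hom, Category.comp_id, Category.id_comp]
  · rw [Iso.refl_hom, Iso.refl_hom, Category.comp_id, Category.id_comp]

end Constraints

section Invariants

variable {W X : Scheme.{0}} {a : W ⟶ X} {G : Type} [Group G] [Finite G] [IsAffineHom a]

/-- The relative spectrum of the algebra of invariants is the quotient of `W` by the action, if the
action is free over the affine open subsets of `X`. -/
theorem isLocallyGalois_invariants (ρ : G → (W ⟶ W)) (hρ : ∀ g, ρ g ≫ a = a) (h1 : ρ 1 = 𝟙 W)
    (hmul : ∀ g h, ρ (g * h) = ρ h ≫ ρ g)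
    (hfree : ∀ U : X.affineOpens, IsFreeRingAction fun g ↦ pullPreimage (ρ g) (hρ g) U.1) :
    IsLocallyGalois (invariants ρ hρ).toSpec ρ := by
  intro t
  obtain ⟨V, hV, hxV, -⟩ := exists_isAffineOpen_mem_and_subset
    (show (invariants ρ hρ).toBase t ∈ (⊤ : X.Opens) from trivial)
  let U : X.affineOpens := ⟨V, hV⟩
  have mem (c : Γ(W, a ⁻¹ᵁ V)) : c ∈ (invariants ρ hρ).ring V ↔
      ∀ g, pullPreimage (ρ g) (hρ g) V c = c := by
    simp [invariants, Subring.mem_iInf, RingHom.mem_eqLocus]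
  refine ⟨.of ((invariants ρ hρ).ring V), Γ(W, a ⁻¹ᵁ V), CommRingCat.ofHom (Subring.subtype _),
    fun g ↦ CommRingCat.ofHom (pullPreimage (ρ g) (hρ g) V), (hV.preimage a).fromSpec,
    (invariants ρ hρ).chart U, ⟨fun c ↦ ?_, fun g h c ↦ ?_, fun g r ↦ (mem _).mp r.2 g,
      Subtype.val_injective, fun c hc ↦ ⟨⟨c, (mem _).mpr hc⟩, rfl⟩, hfree U⟩,
    (invariants ρ hρ).isPullback_fromSpec U, inferInstance, ?_, fun g ↦ ?_⟩
  · refine Eq.trans ?_ (pullPreimage_id V c)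
    simp [h1]
  · refine Eq.trans ?_ (pullPreimage_comp (ρ h) (ρ g) (hρ h) (hρ g) (by simp [hρ]) V c)
    simp [hmul]
  · have : t ∈ (invariants ρ hρ).toBase ⁻¹ᵁ V := hxV
    rwa [(invariants ρ hρ).toBase_preimage U] at this
  · exact IsAffineOpen.SpecMap_appLE_fromSpec _ (hV.preimage a) (hV.preimage a) _

end Invariants

/-! ### Twists as quotients by free actions -/

section Finiteness

universe u

variable {W X : Scheme.{u}} {a : W ⟶ X} [QuasiCompact a] [QuasiSeparated a] (𝒜 : QCohSubalgebra a)

/-- Over a noetherian ring, a subalgebra of the image of a finite algebra is finite. -/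
theorem finite_of_le_range {R A D C : Type*} [CommRing R] [CommRing A] [CommRing D] [CommRing C]
    [IsNoetherianRing R] {χ : R →+* D} (hχ : χ.Finite) (ψ : D →+* C) (θ : R →+* A) (ε : A →+* C)
    (hε : Function.Injective ε) (h : ∀ x, ε x ∈ ψ.range) (hc : ∀ r, ε (θ r) = ψ (χ r)) :
    θ.Finite := by
  let := χ.toAlgebra
  let := θ.toAlgebra
  let := (ψ.comp χ).toAlgebra
  let ψ' : D →ₗ[R] C := { ψ with map_smul' := fun r d ↦ by simp [Algebra.smul_def,
    RingHom.algebraMap_toAlgebra] }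
  let ε' : A →ₗ[R] C := { ε with map_smul' := fun r d ↦ by simp [Algebra.smul_def,
    RingHom.algebraMap_toAlgebra, hc] }
  have : Module.Finite R D := hχ
  have hD : IsNoetherian R D := inferInstance
  have h1 : IsNoetherian R (LinearMap.range ψ') := isNoetherian_of_surjective ψ'.rangeRestrict
    ψ'.range_rangeRestrict
  exact Module.Finite.of_injective (ε'.codRestrict (LinearMap.range ψ') h)
    fun x y hxy ↦ hε (congrArg Subtype.val hxy)

/-- A quasi-coherent subalgebra which is locally contained in a finite algebra is finite. -/
theorem QCohSubalgebra.isFinite_toBase {ι : Type*} (V : ι → X.affineOpens)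
    (hV : ⨆ i, (V i).1 = ⊤) (hN : ∀ i, IsNoetherianRing Γ(X, (V i).1))
    (D : ι → CommRingCat.{u}) (χ : ∀ i, Γ(X, (V i).1) →+* D i) (hχ : ∀ i, (χ i).Finite)
    (ψ : ∀ i, D i →+* Γ(W, a ⁻¹ᵁ (V i).1)) (hψ : ∀ i r, ψ i (χ i r) = a.app (V i).1 r)
    (hD : ∀ i, 𝒜.ring (V i).1 ≤ (ψ i).range) : IsFinite 𝒜.toBase := by
  have inst : HasAffineProperty @IsFinite.{u} (fun X _ f _ ↦ IsAffine X ∧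
    RingHom.Finite (f.appTop).hom) := by
    exact IsFinite.instHasAffinePropertyAndIsAffineFiniteCarrierObjOppositeOpensCarrierCarrierCommRingCatPresheafOpOpensTopHomAppTop
  refine @HasAffineProperty.of_iSup_eq_top _ _ inst _ _ _ _ V hV fun i ↦ ?_
  have hV' : IsAffineOpen (V i).1 := (V i).2
  refine ⟨hV'.preimage 𝒜.toBase, ?_⟩
  suffices h : (𝒜.toBase.app (V i).1).hom.Finite by
    have key : ∀ (U' : X.Opens) (V' : 𝒜.spec.Opens) (_ : U' = (V i).1)
        (_ : V' = 𝒜.toBase ⁻¹ᵁ (V i).1) (h : V' ≤ 𝒜.toBase ⁻¹ᵁ U'),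
        (𝒜.toBase.appLE U' V' h).hom.Finite := by
      rintro _ _ rfl rfl _
      rwa [← Scheme.Hom.app_eq_appLE]
    have h1 : (𝒜.toBase ∣_ (V i).1).appTop = 𝒜.toBase.appLE _ _
        (image_morphismRestrict_preimage 𝒜.toBase (V i).1 ⊤).le := morphismRestrict_app' _ _ _
    rw [h1]
    exact key _ _ (Scheme.Opens.ι_image_top _) (Scheme.Opens.ι_image_top _) _
  have := hN i
  obtain ⟨e, he⟩ := 𝒜.exists_toSpec_appLE (V i)
  refine finite_of_le_range (hχ i) (ψ i) _ ((𝒜.ring (V i).1).subtype.comp e.toRingHom)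
    (fun x y h ↦ e.injective (Subtype.ext h)) (fun x ↦ hD i (e x).2) fun r ↦ ?_
  refine (he _).symm.trans (Eq.trans ?_ (hψ i r).symm)
  exact pullPreimage_app 𝒜.toSpec 𝒜.toSpec_toBase (V i).1 r

end Finiteness

theorem IsFreeRingAction.map {G C C' : Type} [Group G] [CommRing C] [CommRing C']
    {σ : G → C →+* C} {σ' : G → C' →+* C'} (h : IsFreeRingAction σ) (e : C →+* C')
    (he : ∀ g c, e (σ g c) = σ' g (e c)) : IsFreeRingAction σ' := by
  obtain ⟨n, x, y, h1, h2⟩ := h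
  refine ⟨n, fun i ↦ e (x i), fun i ↦ e (y i), ?_, fun g hg ↦ ?_⟩
  · simp_rw [← map_mul, ← map_sum, h1, map_one]
  · simp_rw [← he, ← map_mul, ← map_sum, h2 g hg, map_zero]

/-- The quotient morphism is invariant. -/
theorem IsLocallyGalois.comp_eq {G : Type} [Group G] [Finite G] {W T : Scheme.{0}} {q : W ⟶ T}
    {ρ : G → (W ⟶ W)} (h : IsLocallyGalois q ρ) (g : G) : ρ g ≫ q = q := by
  obtain ⟨𝒰, hU⟩ := h.exists_openCover
  refine Scheme.Cover.hom_ext (𝒰.pullback₁ q) _ _ fun k ↦ ?_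
  obtain ⟨R, C, φ, σ, i, e, hG, hP, hρ⟩ := hU k
  have h1 : (𝒰.pullback₁ q).f k = hP.isoPullback.inv ≫ i := (hP.isoPullback_inv_fst).symm
  have h2 : Spec.map (σ g) ≫ Spec.map φ = Spec.map φ := by
    rw [← Spec.map_comp]
    congr 1
    ext c
    exact hG.map_base g c
  have h3 : i ≫ ρ g ≫ q = i ≫ q := by
    rw [← Category.assoc, ← hρ, Category.assoc, hP.w, ← Category.assoc, ← Category.assoc, h2]
  rw [h1]
  exact (Category.assoc _ _ _).trans ((congrArg (_ ≫ ·) h3).trans (Category.assoc _ _ _).symm)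

theorem appLE_appTop_eq_of_comp_eq {W P : Scheme} (s : W ⟶ P) (α : P ⟶ P) (β : W ⟶ W)
    (h : β ≫ s = s ≫ α) {V : W.Opens} (hV : V ≤ β ⁻¹ᵁ V) (c : Γ(P, ⊤)) :
    s.appLE ⊤ V le_top (α.appTop c) = β.appLE V V hV (s.appLE ⊤ V le_top c) := by
  have key : α.appTop ≫ s.appLE ⊤ V le_top = s.appLE ⊤ V le_top ≫ β.appLE V V hV := by
    refine Eq.trans ?_ (Scheme.Hom.appLE_comp_appLE _ _ _ _ _ _ _).symm
    rw [Scheme.Hom.appTop, Scheme.Hom.app_eq_appLE]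
    refine (Scheme.Hom.appLE_comp_appLE _ _ _ _ _ _ _).trans ?_
    simp only [h]
  exact ConcreteCategory.congr_hom key c

section Twist

variable {K : Type} [Field K] {X Y : Scheme.{0}}

theorem Twist.map_eq {G : Type} [Group G] {S : Scheme.{0}} {p : Y ⟶ S} {ρ : G →* Aut Y}
    {hρ : ∀ g, (ρ g).hom ≫ p = p} {B : PrincipalBundle G S} (T : Twist p ρ hρ B)
    (pX : X ⟶ S) (f : Y ⟶ X) (hf : f ≫ pX = p)
    (hinv : ∀ g, (ρ g).hom ≫ f = f) (k : T.T ⟶ X) (h1 : k ≫ pX = T.str)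
    (h2 : T.q ≫ k = pullback.fst p B.π ≫ f) : T.map pX f hf hinv = k :=
  (T.exists_map pX f hf hinv).unique (T.exists_map pX f hf hinv).choose_spec.1 ⟨h1, h2⟩

/-- The bundle `B` is the spectrum of a Galois algebra. -/
structure PrincipalBundle.IsGaloisAlgebra {G : Type} [Group G]
    (B : PrincipalBundle G (Spec (.of K))) : Prop where
  isFinite : IsFinite B.π
  free : IsFreeRingAction fun g ↦ (B.act g).hom.appTop.hom

theorem IsGaloisExtension.isGaloisAlgebra_bundle {G A : Type} [Group G] [Finite G] [CommRing A]
    {φ : K →+* A} {σ : G → A →+* A} (h : IsGaloisExtension φ σ) :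
    (H1.bundle (Quotient.mk _ h.bundle)).IsGaloisAlgebra := by
  obtain ⟨e, he, he'⟩ := Quotient.exact (Quotient.out_eq (Quotient.mk _ h.bundle : H1 G (Spec (.of
    K))))
  have h1 : IsFinite h.bundle.π := (IsFinite.SpecMap_iff _).mpr h.finite
  refine ⟨?_, ?_⟩
  · change IsFinite (PrincipalBundle.π (Quotient.out _))
    rw [← he]
    infer_instance
  · refine h.free.map (e.hom.appTop.hom.comp (Scheme.ΓSpecIso (.of A)).inv.hom) fun g c ↦ ?_
    have h2 : (Scheme.ΓSpecIso (.of A)).inv ≫ (Spec.map (CommRingCat.ofHom (σ g))).appTop =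
      CommRingCat.ofHom (σ g) ≫ (Scheme.ΓSpecIso (.of A)).inv :=
        (Scheme.ΓSpecIso_inv_naturality _).symm
    have h3 := congrArg Scheme.Hom.appTop (he' g)
    rw [Scheme.Hom.comp_appTop, Scheme.Hom.comp_appTop] at h3
    refine (congrArg e.hom.appTop (ConcreteCategory.congr_hom h2 c)).symm.trans ?_
    exact (ConcreteCategory.congr_hom h3 _).symm

variable {pX : X ⟶ Spec (.of K)} {pY : Y ⟶ Spec (.of K)} {f : Y ⟶ X} (hf : f ≫ pX = pY)
  [IsFinite f] [Finite (AutOver f)]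

/-- The twist of a finite cover by a bundle with finite total space exists and is finite over `X`:
as `G` acts freely on the bundle, it acts freely on `Y ×_K P`, and the relative spectrum over `X` of
the algebra of invariants is a categorical quotient. -/
theorem exists_coverTwist [IsLocallyNoetherian X] (t : H1 (AutOver f) (Spec (.of K)))
    (ht : t.bundle.IsGaloisAlgebra) :
    ∃ T : CoverTwist f hf t, IsFinite T.toBase ∧
      T.q ≫ T.toBase = pullback.fst pY t.bundle.π ≫ f ∧
      IsLocallyGalois T.q
        (diagonalAction pY (autAction f) (autAction_comp_of_comp hf) t.bundle) := by
  set B := t.bundle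
  have := ht.isFinite
  let a : pullback pY B.π ⟶ X := pullback.fst pY B.π ≫ f
  let ρ := diagonalAction pY (autAction f) (autAction_comp_of_comp hf) B
  have hsnd (g) : ρ g ≫ pullback.snd pY B.π = pullback.snd pY B.π ≫ (B.act g).hom :=
    pullback.lift_snd _ _ _
  have hfst (g) : ρ g ≫ pullback.fst pY B.π = pullback.fst pY B.π ≫ (autAction f g).hom :=
    pullback.lift_fst _ _ _
  have hρ (g) : ρ g ≫ a = a := by
    rw [← Category.assoc, hfst, Category.assoc, autAction_comp]
  have h1 : ρ 1 = 𝟙 _ := by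
    refine pullback.hom_ext ?_ ?_
    · rw [hfst, map_one, Category.id_comp]
      exact Category.comp_id _
    · rw [hsnd, map_one, Category.id_comp]
      exact Category.comp_id _
  have hmul (g h) : ρ (g * h) = ρ h ≫ ρ g := by
    refine pullback.hom_ext ?_ ?_
    · rw [hfst, map_mul, Category.assoc, hfst, ← Category.assoc, hfst, Category.assoc]
      rfl
    · rw [hsnd, map_mul, Category.assoc, hsnd, ← Category.assoc, hsnd, Category.assoc]
      rfl
  -- Freeness is inherited from the functions on the bundle.
  have hfree (U : X.affineOpens) : IsFreeRingAction fun g ↦ pullPreimage (ρ g) (hρ g) U.1 := by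
    refine ht.free.map ((pullback.snd pY B.π).appLE ⊤ (a ⁻¹ᵁ U.1) le_top).hom fun g c ↦ ?_
    exact appLE_appTop_eq_of_comp_eq _ _ _ (hsnd g) _ c
  have hG : IsLocallyGalois (invariants ρ hρ).toSpec ρ :=
    isLocallyGalois_invariants ρ hρ h1 hmul hfree
  have hq := (invariants ρ hρ).toSpec_toBase
  have : QuasiCompact ((invariants ρ hρ).toSpec ≫ (invariants ρ hρ).toBase) := by
    rw [hq]
    infer_instance
  have : QuasiCompact (invariants ρ hρ).toSpec := .of_comp _ (invariants ρ hρ).toBase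
  have hstr : (invariants ρ hρ).toSpec ≫ (invariants ρ hρ).toBase ≫ pX = pullback.fst pY B.π ≫
    pY := by
    rw [← Category.assoc, hq, Category.assoc, hf]
  let T : CoverTwist f hf t :=
    { T := (invariants ρ hρ).spec
      str := (invariants ρ hρ).toBase ≫ pX
      q := (invariants ρ hρ).toSpec
      q_str := hstr
      invariant := hG.comp_eq
      universal := fun Z z u huz hu ↦ by
        obtain ⟨k, hk, hk'⟩ := hG.existsUnique_desc u hu
        refine ⟨k, ⟨?_, hk⟩, fun m hm ↦ hk' m hm.2⟩
        refine (hG.existsUnique_desc (pullback.fst pY B.π ≫ pY) fun g ↦ ?_).unique ?_ hstr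
        · rw [← huz, ← Category.assoc, hu]
        · rw [← Category.assoc, hk, huz] }
  have hT : T.toBase = (invariants ρ hρ).toBase := T.map_eq pX f hf (autAction_comp f) _ rfl hq
  refine ⟨T, ?_, ?_, hG⟩
  · rw [hT]
    refine (invariants ρ hρ).isFinite_toBase id (iSup_affineOpens_eq_top X) (fun i ↦
      IsLocallyNoetherian.component_noetherian i) (fun i ↦ Γ(_, a ⁻¹ᵁ i.1)) (fun i ↦
      (a.app i.1).hom)
      (fun i ↦ a.finite_app i.1 i.2) (fun i ↦ RingHom.id _) (fun i r ↦ rfl) fun i x _ ↦ ⟨x, rfl⟩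
  · rw [hT]
    exact hq

end Twist

/-! ### Clearing denominators -/

section Denominators

open Polynomial in
/-- Let `A` be a localization of `R` at natural numbers, in the sense that each element of `A` has a
multiple which comes from `R`. An element integral over `A` has a multiple which is integral over
`R`. -/
theorem exists_isIntegralElem_natCast_mul {R A C : Type*} [CommRing R] [CommRing A] [CommRing C]
    (α : R →+* A) (β : A →+* C) (hα : ∀ x, ∃ n : ℕ, n ≠ 0 ∧ ∃ r, α r = n * x) {c : C}
    (hc : β.IsIntegralElem c) : ∃ n : ℕ, n ≠ 0 ∧ (β.comp α).IsIntegralElem (n * c) := by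
  obtain ⟨p, hp, hpc⟩ := hc
  choose n hn r hr using hα
  -- Scaling the roots of `p` by a common denominator `N` of its coefficients multiplies the
  -- coefficient of degree `k` by a positive power of `N` for `k < p.natDegree`.
  let N := ∏ i ∈ Finset.range p.natDegree, n (p.coeff i)
  have hN : (p.scaleRoots (N : A)) ∈ lifts α := by
    rw [lifts_iff_coeff_lifts]
    intro k
    rw [coeff_scaleRoots]
    rcases lt_trichotomy k p.natDegree with h | rfl | h
    · obtain ⟨m, hm⟩ : n (p.coeff k) ∣ N := Finset.dvd_prod_of_mem _ (Finset.mem_range.mpr h)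
      refine ⟨r (p.coeff k) * (m : R) * (N : R) ^ (p.natDegree - k - 1), ?_⟩
      rw [map_mul, map_mul, hr, map_pow, map_natCast, map_natCast]
      obtain ⟨l, hl⟩ : ∃ l, p.natDegree - k = l + 1 := ⟨p.natDegree - k - 1, by omega⟩
      rw [hl, Nat.add_sub_cancel, pow_succ]
      have : (N : A) = n (p.coeff k) * m := by rw [hm, Nat.cast_mul]
      rw [mul_comm ((N : A) ^ l), this]
      ring
    · exact ⟨1, by simp [hp.coeff_natDegree]⟩
    · exact ⟨0, by simp [coeff_eq_zero_of_natDegree_lt h]⟩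
  obtain ⟨q, hq, -, hqm⟩ := lifts_and_natDegree_eq_and_monic hN ((monic_scaleRoots_iff _).mpr hp)
  refine ⟨N, Finset.prod_ne_zero_iff.mpr fun i _ ↦ hn _, q, hqm, ?_⟩
  rw [← eval₂_map, hq]
  simpa using scaleRoots_eval₂_eq_zero β (s := (N : A)) hpc

/-- A finite algebra `C` over a localization `A` of `R` at natural numbers contains a finite
`R`-algebra `D` which has the same localization. The ring `D` is generated over `R` by integral
multiples of generators of the `A`-module `C`. -/
theorem exists_finite_subring {R A C : Type*} [CommRing R] [CommRing A] [CommRing C]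
    (α : R →+* A) (β : A →+* C) (hα : ∀ x, ∃ n : ℕ, n ≠ 0 ∧ ∃ r, α r = n * x) (hβ : β.Finite) :
    ∃ (D : Subring C) (χ : R →+* D), χ.Finite ∧ (∀ r, (χ r : C) = β (α r)) ∧
      ∀ c : C, ∃ n : ℕ, n ≠ 0 ∧ (n : C) * c ∈ D := by
  have hint (c : C) := exists_isIntegralElem_natCast_mul α β hα (hβ.to_isIntegral c)
  choose m hm hmi using hint
  let := β.toAlgebra
  let := (β.comp α).toAlgebra
  have : Module.Finite A C := hβ
  obtain ⟨s, hs⟩ := this.fg_top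
  let t : Set C := (fun c ↦ (m c : C) * c) '' s
  have ht : t.Finite := s.finite_toSet.image _
  have hfin := Algebra.finite_adjoin_of_finite_of_isIntegral (R := R) ht
    (by rintro _ ⟨c, -, rfl⟩; exact hmi c)
  refine ⟨(Algebra.adjoin R t).toSubring, algebraMap R (Algebra.adjoin R t), ?_, fun r ↦ rfl,
    fun c ↦ ?_⟩
  · exact (RingHom.finite_algebraMap (A := R) (B := Algebra.adjoin R t)).mpr hfin
  · have hc : c ∈ Submodule.span A (s : Set C) := hs ▸ trivial
    induction hc using Submodule.span_induction with
    | mem c hc => exact ⟨m c, hm c, Algebra.subset_adjoin ⟨c, hc, rfl⟩⟩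
    | zero => exact ⟨1, one_ne_zero, by simp⟩
    | add c c' _ _ h h' =>
      obtain ⟨n, hn, h⟩ := h
      obtain ⟨n', hn', h'⟩ := h'
      refine ⟨n * n', mul_ne_zero hn hn', ?_⟩
      have : ((n * n' : ℕ) : C) * (c + c') = n' * (n * c) + n * (n' * c') := by push_cast; ring
      rw [this]
      exact add_mem (mul_mem (natCast_mem _ _) h) (mul_mem (natCast_mem _ _) h')
    | smul a c _ h =>
      obtain ⟨n, hn, h⟩ := h
      obtain ⟨k, hk, r, hr⟩ := hα a
      refine ⟨k * n, mul_ne_zero hk hn, ?_⟩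
      have : ((k * n : ℕ) : C) * (a • c) = algebraMap R C r * (n * c) := by
        change _ = β (α r) * _
        rw [hr, Algebra.smul_def, map_mul, map_natCast, RingHom.algebraMap_toAlgebra]
        push_cast
        ring
      rw [this]
      exact mul_mem (Subalgebra.algebraMap_mem _ r) h

variable (K : Type) [Field K] [NumberField K]

theorem exists_natCast_mul_eq_algebraMap (z : K) : ∃ n : ℕ, n ≠ 0 ∧ ∃ y : 𝓞 K, (y : K) = n * z := by
  obtain ⟨y, hy, h⟩ := ((IsFractionRing.isAlgebraic_iff ℤ ℚ K).mpr
    (Algebra.IsAlgebraic.isAlgebraic z)).exists_integral_multiple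
  rw [zsmul_eq_mul] at h
  refine ⟨y.natAbs, Int.natAbs_ne_zero.mpr hy, ?_⟩
  rcases Int.natAbs_eq y with hy' | hy'
  · rw [hy', Int.cast_natCast] at h
    exact ⟨⟨_, h⟩, rfl⟩
  · rw [hy', Int.cast_neg, Int.cast_natCast, neg_mul, IsIntegral.neg_iff] at h
    exact ⟨⟨_, h⟩, rfl⟩

variable {K}

/-- If `i : B → C` is injective and each element of the `K`-algebra `C` has a non-zero multiple in
`B`, then `C = B ⊗ K`. -/
theorem isPushout_of_natCast {B C : CommRingCat.{0}} (b : .of (𝓞 K) ⟶ B) (k : .of K ⟶ C) (i : B ⟶ C)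
    (h : b ≫ i = CommRingCat.ofHom (algebraMap (𝓞 K) K) ≫ k) (hi : Function.Injective i)
    (hn : ∀ c, ∃ n : ℕ, n ≠ 0 ∧ ∃ y, i y = n * c) :
    IsPushout b (CommRingCat.ofHom (algebraMap (𝓞 K) K)) i k := by
  let M : Submonoid (𝓞 K) := (nonZeroDivisors ℕ).map (Nat.castRingHom (𝓞 K))
  have hM : IsLocalization M K := by
    refine { map_units := ?_, surj := ?_, exists_of_eq := ?_ }
    · rintro ⟨_, n, hn, rfl⟩
      have : (n : K) ≠ 0 := Nat.cast_ne_zero.mpr (nonZeroDivisors.ne_zero hn)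
      exact isUnit_iff_ne_zero.mpr (by simpa using this)
    · intro z
      obtain ⟨n, hn, y, hy⟩ := exists_natCast_mul_eq_algebraMap K z
      exact ⟨(y, ⟨_, n, mem_nonZeroDivisors_of_ne_zero hn, rfl⟩), by simp [hy, mul_comm]⟩
    · intro x y hxy
      exact ⟨1, by rw [NumberField.RingOfIntegers.coe_injective hxy]⟩
  let := i.hom.toAlgebra
  have hC : IsLocalization (M.map b.hom) C := by
    refine { map_units := ?_, surj := ?_, exists_of_eq := ?_ }
    · rintro ⟨_, _, ⟨n, hn, rfl⟩, rfl⟩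
      have : (n : K) ≠ 0 := Nat.cast_ne_zero.mpr (nonZeroDivisors.ne_zero hn)
      have h1 := (isUnit_iff_ne_zero.mpr this).map k.hom
      rw [map_natCast] at h1
      simpa [RingHom.algebraMap_toAlgebra] using h1
    · intro c
      obtain ⟨n, hn', y, hy⟩ := hn c
      exact ⟨(y, ⟨_, _, ⟨n, mem_nonZeroDivisors_of_ne_zero hn', rfl⟩, rfl⟩),
        by simpa [RingHom.algebraMap_toAlgebra, mul_comm] using hy.symm⟩
    · intro x y hxy
      rw [RingHom.algebraMap_toAlgebra] at hxy
      exact ⟨1, by rw [hi hxy]⟩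
  exact CommRingCat.isPushout_of_isLocalization b.hom k.hom
    (congrArg CommRingCat.Hom.hom h).symm M

theorem flat_specFieldToInt : Flat (specFieldToInt K) := by
  rw [specFieldToInt, HasRingHomProperty.Spec_iff (P := @Flat)]
  exact RingHom.flat_algebraMap_iff.mpr (IsLocalization.flat K (nonZeroDivisors (𝓞 K)))

/-- A function on the generic fibre of an `𝒪_K`-scheme has a non-zero multiple which comes from a
function on the scheme, over a quasi-compact and quasi-separated open subset. -/
theorem exists_app_eq_natCast_mul {X Y : Scheme.{0}} {g : Y ⟶ X} {p : Y ⟶ Spec (.of K)}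
    {str : X ⟶ specInt K} (H : IsPullback g p str (specFieldToInt K)) {U : X.Opens}
    (hU : IsCompact (U : Set X)) (hU' : IsQuasiSeparated (U : Set X)) (c : Γ(Y, g ⁻¹ᵁ U)) :
    ∃ n : ℕ, n ≠ 0 ∧ ∃ d, g.app U d = n * c := by
  have := flat_specFieldToInt (K := K)
  have h1 := (isIso_pushoutSection_iff ..).mp
    (isIso_pushoutSection_of_isQuasiSeparated_of_flat_right H (US := ⊤) (UT := ⊤) (UX := U)
    (UY := g ⁻¹ᵁ U) le_top le_top (by simp) (isAffineOpen_top _) (isAffineOpen_top _) hU hU')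
  have h2 := CommRingCat.closure_range_union_range_eq_top_of_isPushout h1
  have hc := Subring.mem_top c
  rw [← h2] at hc
  induction hc using Subring.closure_induction with
  | mem c hc =>
    rcases hc with ⟨d, rfl⟩ | ⟨z, rfl⟩
    · refine ⟨1, one_ne_zero, d, ?_⟩
      rw [Nat.cast_one, one_mul, Scheme.Hom.app_eq_appLE]
    · obtain ⟨n, hn, y, hy⟩ := exists_natCast_mul_eq_algebraMap K ((Scheme.ΓSpecIso (.of K)).hom z)
      refine ⟨n, hn, str.appLE ⊤ U le_top ((Scheme.ΓSpecIso (.of (𝓞 K))).inv y), ?_⟩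
      have h3 := ConcreteCategory.congr_hom h1.w ((Scheme.ΓSpecIso (.of (𝓞 K))).inv y)
      rw [Scheme.Hom.app_eq_appLE]
      have h4 := ConcreteCategory.congr_hom (Scheme.ΓSpecIso_inv_naturality
        (CommRingCat.ofHom (algebraMap (𝓞 K) K))) y
      have h5 : (Scheme.ΓSpecIso (.of K)).inv (algebraMap (𝓞 K) K y) = n * z := by
        have h6 : algebraMap (𝓞 K) K y = n * (Scheme.ΓSpecIso (.of K)).hom z := hy
        rw [h6, map_mul, map_natCast]
        exact congrArg _ (ConcreteCategory.congr_hom (Scheme.ΓSpecIso (.of K)).hom_inv_id z)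
      have h7 : (specFieldToInt K).appLE ⊤ ⊤ le_top ((Scheme.ΓSpecIso (.of (𝓞 K))).inv y) =
          n * z := by
        refine Eq.trans ?_ (h4.symm.trans h5)
        exact ConcreteCategory.congr_hom (Scheme.Hom.app_eq_appLE _).symm _
      refine h3.trans ((congrArg (p.appLE ⊤ (g ⁻¹ᵁ U) le_top) h7).trans ?_)
      rw [map_mul, map_natCast]
  | zero => exact ⟨1, one_ne_zero, 0, by simp⟩
  | one => exact ⟨1, one_ne_zero, 1, by simp⟩
  | add c c' _ _ h h' =>
    obtain ⟨n, hn, d, h⟩ := h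
    obtain ⟨n', hn', d', h'⟩ := h'
    refine ⟨n * n', mul_ne_zero hn hn', n' * d + n * d', ?_⟩
    rw [map_add, map_mul, map_mul, map_natCast, map_natCast, h, h']
    push_cast
    ring
  | neg c _ h =>
    obtain ⟨n, hn, d, h⟩ := h
    exact ⟨n, hn, -d, by rw [map_neg, h, mul_neg]⟩
  | mul c c' _ _ h h' =>
    obtain ⟨n, hn, d, h⟩ := h
    obtain ⟨n', hn', d', h'⟩ := h'
    refine ⟨n * n', mul_ne_zero hn hn', d * d', ?_⟩
    rw [map_mul, h, h']
    push_cast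
    ring

end Denominators

/-! ### Finite models -/

section FiniteModels

variable {K : Type} [Field K] [NumberField K]

/-- A function on `Spec A`, pulled back to an open subscheme `V` of `W` along the morphism given by
`s : A ⟶ Γ(W, V)`, is the image of an element of `A` under `s`. -/
theorem toSpecΓ_SpecMap_appLE {W : Scheme.{0}} (V : W.Opens) {A : CommRingCat.{0}}
    (s : A ⟶ Γ(W, V)) {N : (Spec A).Opens} (hN : N = ⊤) {U : V.toScheme.Opens} (hU : U = ⊤)
    (h : U ≤ (V.toSpecΓ ≫ Spec.map s) ⁻¹ᵁ N) (h' : U ≤ V.ι ⁻¹ᵁ V) (d : Γ(Spec A, N)) :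
    ∃ x : A, (V.toSpecΓ ≫ Spec.map s).appLE N U h d = V.ι.appLE V U h' (s x) := by
  subst hN hU
  have h8 : V.toSpecΓ.appTop = (Scheme.ΓSpecIso _).hom ≫ V.ι.appLE V ⊤ h' := by
    rw [Scheme.Opens.toSpecΓ_appTop, Scheme.Opens.ι_appLE]
    rfl
  have h9 := Scheme.ΓSpecIso_naturality s
  have h7 : (V.toSpecΓ ≫ Spec.map s).appTop = (Spec.map s).appTop ≫ V.toSpecΓ.appTop :=
    Scheme.Hom.comp_appTop _ _
  have h10 : (V.toSpecΓ ≫ Spec.map s).appLE ⊤ ⊤ h =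
      (Scheme.ΓSpecIso _).hom ≫ s ≫ V.ι.appLE V ⊤ h' := by
    refine (Scheme.Hom.app_eq_appLE _).symm.trans (h7.trans ?_)
    refine (congrArg (_ ≫ ·) h8).trans ((Category.assoc _ _ _).symm.trans ?_)
    exact (congrArg (· ≫ _) h9).trans (Category.assoc _ _ _)
  exact ⟨(Scheme.ΓSpecIso _).hom d, ConcreteCategory.congr_hom h10 d⟩

theorem exists_appLE_eq_natCast_mul {X Y : Scheme.{0}} {g : Y ⟶ X} {p : Y ⟶ Spec (.of K)}
    {str : X ⟶ specInt K} (H : IsPullback g p str (specFieldToInt K)) {U : X.Opens}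
    (hU : IsCompact (U : Set X)) (hU' : IsQuasiSeparated (U : Set X)) {V : Y.Opens}
    (hV : V = g ⁻¹ᵁ U) (c : Γ(Y, V)) :
    ∃ n : ℕ, n ≠ 0 ∧ ∃ d, g.appLE U V hV.le d = n * c := by
  subst hV
  obtain ⟨n, hn, d, h⟩ := exists_app_eq_natCast_mul H hU hU' c
  exact ⟨n, hn, d, by rw [← h, Scheme.Hom.app_eq_appLE]⟩

/-- A subring of the ring of functions on an affine open subset `V` of a `K`-scheme, which contains
a multiple of each function, defines a flat model of `V`. -/
theorem isPullback_toSpecΓ_SpecMap {T : Scheme.{0}} {V : T.Opens} (hV : IsAffineOpen V)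
    (D : Subring Γ(T, V)) (hD : ∀ c : Γ(T, V), ∃ n : ℕ, n ≠ 0 ∧ (n : Γ(T, V)) * c ∈ D)
    (p : T ⟶ Spec (.of K)) (h : Spec (.of D) ⟶ specInt K)
    (w : (V.toSpecΓ ≫ Spec.map (CommRingCat.ofHom D.subtype)) ≫ h =
      (V.ι ≫ p) ≫ specFieldToInt K) :
    Flat h ∧ IsPullback (V.toSpecΓ ≫ Spec.map (CommRingCat.ofHom D.subtype)) (V.ι ≫ p) h
      (specFieldToInt K) := by
  obtain ⟨b, rfl⟩ := Spec.map_surjective h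
  obtain ⟨k, hk⟩ := Spec.map_surjective (hV.fromSpec ≫ p)
  have hk' : V.ι ≫ p = V.toSpecΓ ≫ Spec.map k := by
    rw [hk, ← Category.assoc, hV.toSpecΓ_fromSpec]
  have : IsIso V.toSpecΓ := hV.isoSpec_hom ▸ inferInstance
  have w' : b ≫ CommRingCat.ofHom D.subtype = CommRingCat.ofHom (algebraMap (𝓞 K) K) ≫ k := by
    apply Spec.map_injective
    rw [Spec.map_comp, Spec.map_comp, ← cancel_epi V.toSpecΓ, ← Category.assoc, w, hk',
      Category.assoc]
    rfl
  refine ⟨?_, ?_⟩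
  · rw [HasRingHomProperty.Spec_iff (P := @Flat)]
    let := b.hom.toAlgebra
    have : Module.IsTorsionFree (𝓞 K) D := by
      refine ⟨fun r hr x y hxy ↦ Subtype.ext ?_⟩
      have h1 : algebraMap (𝓞 K) K r ≠ 0 := by simpa using hr.ne_zero
      have h2 : IsUnit (b r).1 := by
        have h3 := (isUnit_iff_ne_zero.mpr h1).map k.hom
        have h4 := ConcreteCategory.congr_hom w' r
        rwa [← show (b r).1 = k.hom (algebraMap (𝓞 K) K r) from h4] at h3
      exact h2.mul_left_cancel (congrArg Subtype.val hxy)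
    exact (inferInstance : Module.Flat (𝓞 K) D)
  · have h1 := isPullback_SpecMap_of_isPushout _ _ _ _ (isPushout_of_natCast b k
      (CommRingCat.ofHom D.subtype) w' Subtype.val_injective
      fun c ↦ by
        obtain ⟨n, hn, h⟩ := hD c
        exact ⟨n, hn, ⟨_, h⟩, rfl⟩)
    refine h1.of_iso hV.isoSpec.symm (Iso.refl _) (Iso.refl _) (Iso.refl _) ?_ ?_ ?_ ?_
    · rw [Iso.symm_hom, Iso.eq_inv_comp, hV.isoSpec_hom, Iso.refl_hom, Category.comp_id]
    · rw [Iso.symm_hom, Iso.eq_inv_comp, hV.isoSpec_hom, Iso.refl_hom, hk', Category.comp_id]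
    · rw [Iso.refl_hom, Iso.refl_hom, Category.comp_id, Category.id_comp]
    · rw [Iso.refl_hom, Iso.refl_hom, Category.comp_id, Category.id_comp]
      rfl

theorem toSpecΓ_SpecMap_fromSpec {T 𝒳 : Scheme.{0}} (b : T ⟶ 𝒳) {V : 𝒳.Opens}
    (hV : IsAffineOpen V) (D : Subring Γ(T, b ⁻¹ᵁ V)) (χ : Γ(𝒳, V) →+* D)
    (hχ : ∀ r, (χ r).1 = b.app V r) :
    ((b ⁻¹ᵁ V).toSpecΓ ≫ Spec.map (CommRingCat.ofHom D.subtype)) ≫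
      Spec.map (CommRingCat.ofHom χ) ≫ hV.fromSpec = (b ⁻¹ᵁ V).ι ≫ b := by
  have h1 : CommRingCat.ofHom χ ≫ CommRingCat.ofHom D.subtype = b.app V := by
    ext r
    exact hχ r
  have h2 : (b ⁻¹ᵁ V).toSpecΓ ≫ Spec.map (b.app V) ≫ hV.fromSpec = (b ⁻¹ᵁ V).ι ≫ b := by
    simp
  rw [← h1] at h2
  rw [Category.assoc, ← Spec.map_comp_assoc]
  exact h2

/-- An affine morphism `b : T ⟶ 𝒳` from a `K`-scheme to a proper `𝒪_K`-scheme factors through a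
finite `𝒳`-scheme which is a flat model of `T` over `𝒪_K`, if it does so locally. -/
theorem exists_finite_model {𝒳 T : Scheme.{0}} {str : 𝒳 ⟶ specInt K} [IsProper str]
    (b : T ⟶ 𝒳) [IsAffineHom b] (p : T ⟶ Spec (.of K)) (hp : b ≫ str = p ≫ specFieldToInt K)
    (hloc : ∀ V : 𝒳.Opens, IsAffineOpen V → ∃ (D : Subring Γ(T, b ⁻¹ᵁ V)) (χ : Γ(𝒳, V) →+* D),
      χ.Finite ∧ (∀ r, (χ r).1 = b.app V r) ∧
        ∀ c : Γ(T, b ⁻¹ᵁ V), ∃ n : ℕ, n ≠ 0 ∧ (n : Γ(T, b ⁻¹ᵁ V)) * c ∈ D) :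
    ∃ (𝒴 : Scheme.{0}) (g : 𝒴 ⟶ 𝒳) (j' : T ⟶ 𝒴),
      IsFinite g ∧ Flat (g ≫ str) ∧ j' ≫ g = b ∧ IsPullback j' p (g ≫ str) (specFieldToInt K) := by
  have hc : CompactSpace 𝒳 := QuasiCompact.compactSpace_of_compactSpace str
  have : IsLocallyNoetherian 𝒳 := LocallyOfFiniteType.isLocallyNoetherian str
  obtain ⟨I, hI, hIV⟩ := isCompact_iff_finite_and_eq_biUnion_affineOpens (U := (⊤ : 𝒳.Opens)).mp
    isCompact_univ
  have := hI.to_subtype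
  let V : I → 𝒳.affineOpens := Subtype.val
  have hV : ⨆ i, (V i).1 = ⊤ := by
    rw [hIV, iSup_subtype]
  have hVa (i : I) : IsAffineOpen (V i).1 := (V i).2
  have hVb (i : I) : IsAffineOpen (b ⁻¹ᵁ (V i).1) := (hVa i).preimage b
  choose D χ hχ hχD hD using fun i ↦ hloc (V i).1 (hVa i)
  let 𝒯 (i : I) : Scheme.{0} := Spec (.of (D i))
  let h (i : I) : 𝒯 i ⟶ 𝒳 := Spec.map (CommRingCat.ofHom (χ i)) ≫ (hVa i).fromSpec
  let w (i : I) : (b ⁻¹ᵁ (V i).1).toScheme ⟶ T := (b ⁻¹ᵁ (V i).1).ι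
  let v (i : I) : (b ⁻¹ᵁ (V i).1).toScheme ⟶ 𝒯 i :=
    (b ⁻¹ᵁ (V i).1).toSpecΓ ≫ Spec.map (CommRingCat.ofHom (D i).subtype)
  have hv (i : I) : v i ≫ h i = w i ≫ b :=
    toSpecΓ_SpecMap_fromSpec b (hVa i) (D i) (χ i) (hχD i)
  have (i : I) : IsAffine (b ⁻¹ᵁ (V i).1).toScheme := hVb i
  -- The local models need not be compatible. The functions on `T` which, over each `V i`, come from
  -- the local model `D i` form a quasi-coherent algebra `𝒜`. It is finite, since its sections over
  -- `V i` lie in `D i`, and it has the right generic fibre, since each function has a multiple in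
  -- all `D i`.
  let 𝒜 : QCohSubalgebra b := liftable w (fun _ ↦ rfl) v hv
  have mem {U : 𝒳.Opens} (c : Γ(T, b ⁻¹ᵁ U)) : c ∈ 𝒜.ring U ↔
      ∀ i, ∃ d, pullPreimage (v i) (hv i) U d = pullPreimage (w i) rfl U c := by
    exact Subring.mem_iInf
  have hsq (i : I) := isPullback_toSpecΓ_SpecMap (hVb i) (D i) (hD i) p (h i ≫ str) (by
    refine (Category.assoc _ _ _).symm.trans ((congrArg (· ≫ str) (hv i)).trans ?_)
    rw [Category.assoc, Category.assoc, ← hp])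
  have hD' (i : I) : 𝒜.ring (V i).1 ≤ (D i).subtype.range := by
    intro c hc
    obtain ⟨d, hd⟩ := (mem c).mp hc i
    have hN : h i ⁻¹ᵁ (V i).1 = ⊤ := by
      simp only [h, Scheme.Hom.comp_preimage]
      rw [(hVa i).fromSpec_preimage_self, Scheme.Hom.preimage_top]
    have hU : (w i ≫ b) ⁻¹ᵁ (V i).1 = ⊤ := by
      simp [w]
    obtain ⟨x, hx⟩ := toSpecΓ_SpecMap_appLE (b ⁻¹ᵁ (V i).1) (CommRingCat.ofHom (D i).subtype) hN hU
      (by change _ ≤ v i ⁻¹ᵁ _; rw [← Scheme.Hom.comp_preimage, hv i]) le_rfl d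
    have hiso : IsIso ((w i).appLE (b ⁻¹ᵁ (V i).1) ((w i ≫ b) ⁻¹ᵁ (V i).1) le_rfl) :=
      isIso_appLE_of_isOpenImmersion _ (by simp [w]) le_rfl le_rfl
    refine ⟨x, ((ConcreteCategory.bijective_of_isIso _ ).1 (hd.symm.trans hx)).symm⟩
  have hn (i : I) (c : Γ(T, b ⁻¹ᵁ (V i).1)) :
      ∃ n : ℕ, n ≠ 0 ∧ (n : Γ(T, b ⁻¹ᵁ (V i).1)) * c ∈ 𝒜.ring (V i).1 := by
    have h1 (l : I) := exists_appLE_eq_natCast_mul (hsq l).2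
      ((h l).isCompact_preimage (hVa i).isCompact)
      ((h l).isQuasiSeparated_preimage (hVa i).isQuasiSeparated)
      (V := (w l ≫ b) ⁻¹ᵁ (V i).1) (by rw [← hv l]; rfl) (pullPreimage (w l) rfl (V i).1 c)
    choose n hn d hd using h1
    have := Fintype.ofFinite I
    classical
    refine ⟨∏ l, n l, Finset.prod_ne_zero_iff.mpr fun l _ ↦ hn l, (mem _).mpr fun l ↦
      ⟨((∏ k ∈ Finset.univ.erase l, n k : ℕ) : Γ(𝒯 l, h l ⁻¹ᵁ (V i).1)) * d l, ?_⟩⟩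
    rw [map_mul, map_mul, map_natCast, map_natCast, ← Finset.mul_prod_erase _ _ (Finset.mem_univ l),
      mul_comm (n l), Nat.cast_mul, mul_assoc]
    exact congrArg _ (hd l)
  have hsq' (i : I) := isPullback_toSpecΓ_SpecMap (hVb i) (𝒜.ring (V i).1) (hn i) p
    (𝒜.chart (V i) ≫ 𝒜.toBase ≫ str) (by
    refine (Category.assoc _ _ _).symm.trans ((congrArg (· ≫ _) (𝒜.ι_toSpec (V i)).symm).trans ?_)
    rw [Category.assoc, ← Category.assoc 𝒜.toSpec, 𝒜.toSpec_toBase, hp, Category.assoc])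
  let 𝒰 : 𝒜.spec.OpenCover := Scheme.Cover.mkOfCovers (P := @IsOpenImmersion) I
    (fun i ↦ Spec (.of (𝒜.ring (V i).1))) (fun i ↦ 𝒜.chart (V i)) (fun x ↦ by
      have hx : 𝒜.toBase x ∈ (⨆ i, (V i).1 : 𝒳.Opens) := hV ▸ trivial
      obtain ⟨i, hi⟩ := TopologicalSpace.Opens.mem_iSup.mp hx
      have hi' : x ∈ 𝒜.toBase ⁻¹ᵁ (V i).1 := hi
      rw [𝒜.toBase_preimage (V i)] at hi'
      exact ⟨i, hi'⟩) (fun i ↦ inferInstance)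
  refine ⟨𝒜.spec, 𝒜.toBase, 𝒜.toSpec, 𝒜.isFinite_toBase V hV
    (fun i ↦ IsLocallyNoetherian.component_noetherian _) (fun i ↦ .of (D i)) χ hχ
    (fun i ↦ (D i).subtype) hχD hD', ?_, 𝒜.toSpec_toBase, ?_⟩
  · have : IsZariskiLocalAtSource @Flat.{0} :=
      HasRingHomProperty.instIsZariskiLocalAtSource (P := @Flat) (Q := RingHom.Flat)
    exact IsZariskiLocalAtSource.of_openCover (P := @Flat) 𝒰 fun i ↦ (hsq' i).1
  · refine Scheme.isPullback_of_openCover _ _ _ _ 𝒰 fun i ↦ ?_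
    refine (hsq' i).2.of_iso (𝒜.isPullback_toChart (V i)).isoPullback (Iso.refl _) (Iso.refl _)
      (Iso.refl _) ?_ ?_ ?_ ?_
    · exact (Category.comp_id _).trans (𝒜.isPullback_toChart (V i)).isoPullback_hom_snd.symm
    · refine (Category.comp_id _).trans ?_
      refine Eq.trans ?_ (Category.assoc _ _ _)
      exact congrArg (· ≫ p) (𝒜.isPullback_toChart (V i)).isoPullback_hom_fst.symm
    · exact (Category.comp_id _).trans (Category.id_comp _).symm
    · exact (Category.comp_id _).trans (Category.id_comp _).symm

/-- A finite morphism to the generic fibre of a proper `𝒪_K`-scheme extends to a finite morphism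
from a flat `𝒪_K`-scheme. -/
theorem exists_finite_extension {𝒳 X T : Scheme.{0}} {str : 𝒳 ⟶ specInt K} [IsProper str]
    {j : X ⟶ 𝒳} {p : X ⟶ Spec (.of K)} (H : IsPullback j p str (specFieldToInt K)) (a : T ⟶ X)
    [IsFinite a] : ∃ (𝒴 : Scheme.{0}) (g : 𝒴 ⟶ 𝒳) (j' : T ⟶ 𝒴),
      IsFinite g ∧ Flat (g ≫ str) ∧ IsPullback j' a g j := by
  have hsp : IsAffineHom (specFieldToInt K) := inferInstanceAs (IsAffineHom (Spec.map _))
  have : IsAffineHom j := MorphismProperty.of_isPullback (P := @IsAffineHom) H.flip hsp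
  obtain ⟨𝒴, g, j', h1, h2, h3, h4⟩ := exists_finite_model (str := str) (a ≫ j) (a ≫ p)
    (by rw [Category.assoc, Category.assoc, H.w]) fun V hV ↦ by
      obtain ⟨D, χ, hχ, hχD, hD⟩ := exists_finite_subring (j.app V).hom (a.app (j ⁻¹ᵁ V)).hom
        (fun x ↦ exists_app_eq_natCast_mul H hV.isCompact hV.isQuasiSeparated x)
        (a.finite_app _ (hV.preimage j))
      exact ⟨D, χ, hχ, fun r ↦ (hχD r).trans
        (ConcreteCategory.congr_hom (Scheme.Hom.comp_app a j V) r).symm, hD⟩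
  exact ⟨𝒴, g, j', h1, h2, IsPullback.of_bot h4 h3 H⟩

end FiniteModels

/-! ### Generators of line bundles -/

section Generators

universe u

variable {X Y Z : Scheme.{u}}

/-- The restriction of a section of an `𝒪_X`-module to a smaller open subset. -/
noncomputable abbrev resSection (L : X.Modules) {U V : X.Opens} (h : V ≤ U) : Γ(L, U) →+ Γ(L, V) :=
  (L.presheaf.map (homOfLE h).op).hom

theorem resSection_resSection (L : X.Modules) {U V W : X.Opens} (h : V ≤ U) (h' : W ≤ V)
    (s : Γ(L, U)) : resSection L h' (resSection L h s) = resSection L (h'.trans h) s := by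
  change (L.presheaf.map _ ≫ L.presheaf.map _) s = _
  rw [← L.presheaf.map_comp]
  rfl

theorem resSection_self (L : X.Modules) {U : X.Opens} (h : U ≤ U) (s : Γ(L, U)) :
    resSection L h s = s := by
  change L.presheaf.map (𝟙 _) s = s
  rw [L.presheaf.map_id]
  rfl

theorem resSection_smul (L : X.Modules) {U V : X.Opens} (h : V ≤ U) (r : Γ(X, U)) (s : Γ(L, U)) :
    resSection L h (r • s) = X.presheaf.map (homOfLE h).op r • resSection L h s :=
  Scheme.Modules.map_smul L (homOfLE h) r s

theorem app_resSection {L M : X.Modules} (φ : L ⟶ M) {U V : X.Opens} (h : V ≤ U) (s : Γ(L, U)) :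
    φ.app V (resSection L h s) = resSection M h (φ.app U s) :=
  ConcreteCategory.congr_hom (φ.mapPresheaf.naturality (homOfLE h).op) s

/-- The unit of the adjunction between pull-back and push-forward, on sections. -/
noncomputable def unitSection (f : Y ⟶ X) (L : X.Modules) (U : X.Opens) :
    Γ(L, U) →+ Γ((Scheme.Modules.pullback f).obj L, f ⁻¹ᵁ U) :=
  (((Scheme.Modules.pullbackPushforwardAdjunction f).unit.app L).app U).hom

theorem pullbackSection_eq (f : Y ⟶ X) (L : X.Modules) (U : X.Opens) (V : Y.Opens) (h : V ≤ f ⁻¹ᵁ U)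
    (s : Γ(L, U)) : pullbackSection f L U V h s = resSection _ h (unitSection f L U s) := rfl

theorem unitSection_resSection (f : Y ⟶ X) (L : X.Modules) {U V : X.Opens} (h : V ≤ U)
    (s : Γ(L, U)) :
    unitSection f L V (resSection L h s) = resSection _ (f.preimage_mono h) (unitSection f L U s) :=
  app_resSection ((Scheme.Modules.pullbackPushforwardAdjunction f).unit.app L) h s

theorem unitSection_smul (f : Y ⟶ X) (L : X.Modules) {U : X.Opens} (r : Γ(X, U)) (s : Γ(L, U)) :
    unitSection f L U (r • s) = f.app U r • unitSection f L U s :=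
  ((Scheme.Modules.pullbackPushforwardAdjunction f).unit.app L).app_smul r s

theorem pullbackSection_resSection (f : Y ⟶ X) (L : X.Modules) {U U' : X.Opens} (hU : U' ≤ U)
    {V : Y.Opens} (h : V ≤ f ⁻¹ᵁ U') (s : Γ(L, U)) :
    pullbackSection f L U' V h (resSection L hU s) =
      pullbackSection f L U V (h.trans (f.preimage_mono hU)) s := by
  rw [pullbackSection_eq, unitSection_resSection, resSection_resSection]
  rfl

theorem pullbackSection_smul (f : Y ⟶ X) (L : X.Modules) {U : X.Opens} {V : Y.Opens}
    (h : V ≤ f ⁻¹ᵁ U) (r : Γ(X, U)) (s : Γ(L, U)) :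
    pullbackSection f L U V h (r • s) = f.appLE U V h r • pullbackSection f L U V h s := by
  rw [pullbackSection_eq, unitSection_smul, resSection_smul]
  rfl

/-- The pull-back of sections is natural in the module. -/
theorem map_pullbackSection (f : Y ⟶ X) {L M : X.Modules} (φ : L ⟶ M) {U : X.Opens} {V : Y.Opens}
    (h : V ≤ f ⁻¹ᵁ U) (s : Γ(L, U)) :
    ((Scheme.Modules.pullback f).map φ).app V (pullbackSection f L U V h s) =
      pullbackSection f M U V h (φ.app U s) := by
  rw [pullbackSection_eq, app_resSection, pullbackSection_eq]
  congr 1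
  have := (Scheme.Modules.pullbackPushforwardAdjunction f).unit.naturality φ
  have h2 := congrArg (fun ψ ↦ Scheme.Modules.Hom.app ψ U s) this
  exact h2.symm

/-- The pull-back of sections is compatible with the canonical isomorphism `f^* g^* L ≅ (f ≫ g)^*
L`. -/
theorem pullbackComp_pullbackSection (f : Z ⟶ Y) (g : Y ⟶ X) (L : X.Modules) {U : X.Opens}
    {V : Y.Opens} {W : Z.Opens} (hV : V ≤ g ⁻¹ᵁ U) (hW : W ≤ f ⁻¹ᵁ V) (hW' : W ≤ (f ≫ g) ⁻¹ᵁ U)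
    (s : Γ(L, U)) :
    ((Scheme.Modules.pullbackComp f g).hom.app L).app W
      (pullbackSection f _ V W hW (pullbackSection g L U V hV s)) =
      pullbackSection (f ≫ g) L U W hW' s := by
  have h1 : ((Scheme.Modules.pullbackComp f g).inv.app L).app _ (unitSection (f ≫ g) L U s) =
      unitSection f _ _ (unitSection g L U s) := by
    have := unit_conjugateEquiv ((Scheme.Modules.pullbackPushforwardAdjunction g).comp
      (Scheme.Modules.pullbackPushforwardAdjunction f))
      (Scheme.Modules.pullbackPushforwardAdjunction (f ≫ g)) (Scheme.Modules.pullbackComp f g).inv L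
    rw [Scheme.Modules.conjugateEquiv_pullbackComp_inv] at this
    have h2 := congrArg (fun ψ ↦ Scheme.Modules.Hom.app ψ U s) this
    exact h2.symm
  have h3 : ((Scheme.Modules.pullbackComp f g).hom.app L).app _
      (unitSection f _ _ (unitSection g L U s)) = unitSection (f ≫ g) L U s := by
    rw [← h1]
    have h4 := (Scheme.Modules.pullbackComp f g).inv_hom_id_app L
    exact congrArg (fun ψ ↦ Scheme.Modules.Hom.app ψ _ (unitSection (f ≫ g) L U s)) h4
  rw [pullbackSection_eq g, pullbackSection_resSection, pullbackSection_eq]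
  exact (app_resSection ((Scheme.Modules.pullbackComp f g).hom.app L) hW' _).trans (congrArg _ h3)

/-- The section `e` of `L` over `U` generates `L` over `U`: over each open subset of `U` the
sections of `L` are the unique multiples of `e`. -/
def IsGenerator (L : X.Modules) {U : X.Opens} (e : Γ(L, U)) : Prop :=
  ∀ (W : X.Opens) (h : W ≤ U), Function.Bijective fun r : Γ(X, W) ↦ r • resSection L h e

theorem IsGenerator.resSection {L : X.Modules} {U V : X.Opens} {e : Γ(L, U)} (he : IsGenerator L e)
    (h : V ≤ U) : IsGenerator L (resSection L h e) := fun W hW ↦ by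
  simp_rw [resSection_resSection]
  exact he W _

theorem IsGenerator.map {L M : X.Modules} {U : X.Opens} {e : Γ(L, U)} (he : IsGenerator L e)
    (φ : L ⟶ M) [IsIso φ] : IsGenerator M (φ.app U e) := fun W hW ↦ by
  have h1 : Function.Bijective (φ.app W) := ConcreteCategory.bijective_of_isIso (φ.app W)
  convert! h1.comp (he W hW) using 2 with r
  rw [Function.comp_apply, Scheme.Modules.Hom.app_smul, app_resSection]

/-- The structure sheaf, as a module over itself. -/
noncomputable abbrev structureModule (X : Scheme.{u}) : X.Modules :=
  SheafOfModules.unit X.ringCatSheaf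

/-- The section `1` of the structure sheaf. -/
noncomputable def oneSection (X : Scheme.{u}) : Γ(structureModule X, ⊤) := (1 : Γ(X, ⊤))

theorem isGenerator_oneSection (X : Scheme.{u}) : IsGenerator _ (oneSection X) := by
  intro W hW
  have h : ∀ r : Γ(X, W), r * X.presheaf.map (homOfLE hW).op 1 = r := fun r ↦ by
    rw [map_one, mul_one]
  change Function.Bijective fun r : Γ(X, W) ↦ r * X.presheaf.map (homOfLE hW).op 1
  simp_rw [h]
  exact Function.bijective_id

/-- A global section is the image of `1` under a homomorphism from the structure sheaf. -/
theorem exists_hom_oneSection (M : X.Modules) (s : Γ(M, ⊤)) :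
    ∃ φ : structureModule X ⟶ M, φ.app ⊤ (oneSection X) = s := by
  let t : PresheafOfModules.sections M.val := PresheafOfModules.sectionsMk
    (fun U ↦ resSection M (U := ⊤) (V := U.unop) le_top s) (fun U V f ↦
      resSection_resSection M le_top (leOfHom f.unop) s)
  refine ⟨M.unitHomEquiv.symm t, ?_⟩
  have h := M.unitHomEquiv.apply_symm_apply t
  have h2 := SheafOfModules.unitHomEquiv_apply_coe M (M.unitHomEquiv.symm t) (.op ⊤)
  rw [h] at h2
  refine h2.symm.trans ?_
  exact resSection_self M le_top s

/-- A homomorphism from a module with a global generator is determined by the image of the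
generator. -/
theorem IsGenerator.hom_ext {L M : X.Modules} {e : Γ(L, (⊤ : X.Opens))} (he : IsGenerator L e)
    {φ ψ : L ⟶ M} (h : φ.app ⊤ e = ψ.app ⊤ e) : φ = ψ := by
  refine Scheme.Modules.hom_ext _ _ fun U ↦ ?_
  ext s
  obtain ⟨r, rfl⟩ := (he U le_top).2 s
  simp only [Scheme.Modules.Hom.app_smul]
  rw [app_resSection, app_resSection, h]

theorem top_le_preimage (f : Y ⟶ X) : (⊤ : Y.Opens) ≤ f ⁻¹ᵁ ⊤ := le_rfl

theorem homEquiv_app (f : Y ⟶ X) {L : X.Modules} {N : Y.Modules}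
    (φ : (Scheme.Modules.pullback f).obj L ⟶ N) (s : Γ(L, ⊤)) :
    ((Scheme.Modules.pullbackPushforwardAdjunction f).homEquiv L N φ).app ⊤ s =
      φ.app ⊤ (pullbackSection f L ⊤ ⊤ (top_le_preimage f) s) := by
  rw [pullbackSection_eq, Adjunction.homEquiv_unit]
  refine Eq.trans ?_ (congrArg (φ.app ⊤) (resSection_self _ (U := ⊤) le_top _).symm)
  rfl

/-- The pull-back of `1` generates the pull-back of the structure sheaf. By the adjunction and
`exists_hom_oneSection`, this pull-back has the universal property of the structure sheaf. -/
theorem isGenerator_pullbackSection_oneSection (f : Y ⟶ X) :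
    IsGenerator _ (pullbackSection f (structureModule X) ⊤ ⊤ (top_le_preimage f)
      (oneSection X)) := by
  set u := pullbackSection f (structureModule X) ⊤ ⊤ (top_le_preimage f) (oneSection X)
  obtain ⟨φ, hφ⟩ := exists_hom_oneSection _ u
  obtain ⟨ψ', hψ'⟩ := exists_hom_oneSection ((Scheme.Modules.pushforward f).obj (structureModule Y))
    (oneSection Y)
  let ψ := ((Scheme.Modules.pullbackPushforwardAdjunction f).homEquiv _ _).symm ψ'
  have hψ : ψ.app ⊤ u = oneSection Y := by
    rw [← homEquiv_app, Equiv.apply_symm_apply, hψ']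
  have : IsIso φ := by
    refine ⟨ψ, ?_, ?_⟩
    · refine (isGenerator_oneSection Y).hom_ext ?_
      change ψ.app ⊤ (φ.app ⊤ _) = _
      rw [hφ, hψ]
      rfl
    · refine ((Scheme.Modules.pullbackPushforwardAdjunction f).homEquiv _ _).injective ?_
      refine (isGenerator_oneSection X).hom_ext ?_
      rw [homEquiv_app, homEquiv_app]
      change φ.app ⊤ (ψ.app ⊤ u) = u
      rw [hψ, hφ]
  rw [← hφ]
  exact (isGenerator_oneSection Y).map φ

/-- A global generator of a module identifies it with the structure sheaf. -/
theorem IsGenerator.exists_iso {L : X.Modules} {e : Γ(L, (⊤ : X.Opens))} (he : IsGenerator L e) :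
    ∃ φ : structureModule X ⟶ L, IsIso φ ∧ φ.app ⊤ (oneSection X) = e := by
  obtain ⟨φ, hφ⟩ := exists_hom_oneSection _ e
  refine ⟨φ, ?_, hφ⟩
  rw [Scheme.Modules.Hom.isIso_iff_isIso_app]
  intro U
  rw [ConcreteCategory.isIso_iff_bijective]
  have h : φ.app U ∘ (fun r : Γ(X, U) ↦ r • GrowthRates.resSection _ (le_top : U ≤ ⊤)
    (oneSection X)) =
      fun r : Γ(X, U) ↦ r • GrowthRates.resSection L le_top e := by
    funext r
    rw [Function.comp_apply, Scheme.Modules.Hom.app_smul, app_resSection, hφ]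
  refine (Function.Bijective.of_comp_iff _ (isGenerator_oneSection X U le_top)).1 ?_
  rw [h]
  exact he U le_top

theorem IsGenerator.pullbackSection_top (f : Y ⟶ X) {L : X.Modules} {e : Γ(L, (⊤ : X.Opens))}
    (he : IsGenerator L e) : IsGenerator _ (pullbackSection f L ⊤ ⊤ (top_le_preimage f) e) := by
  obtain ⟨φ, hφ, rfl⟩ := he.exists_iso
  rw [← map_pullbackSection]
  exact (isGenerator_pullbackSection_oneSection f).map _

theorem isGenerator_restrict_iff (i : Y ⟶ X) [IsOpenImmersion i] (L : X.Modules) {V : Y.Opens}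
    (e : Γ(L, i ''ᵁ V)) :
    IsGenerator (L.restrict i) ((L.restrictAppIso i V).inv e) ↔ IsGenerator L e := by
  have key (W : Y.Opens) (h : W ≤ V) :
      (Function.Bijective fun r : Γ(Y, W) ↦ r • resSection (L.restrict i) h ((L.restrictAppIso i
        V).inv e)) ↔
      Function.Bijective fun r : Γ(X, i ''ᵁ W) ↦ r • resSection L (i.image_mono h) e := by
    have hb : Function.Bijective (i.appIso W).inv := ConcreteCategory.bijective_of_isIso _
    exact Function.Bijective.of_comp_iff
      (fun r : Γ(X, i ''ᵁ W) ↦ r • resSection L (i.image_mono h) e) hb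
  refine ⟨fun H W h ↦ ?_, fun H W h ↦ (key W h).2 (H _ _)⟩
  obtain ⟨W', rfl⟩ : ∃ W' : Y.Opens, W = i ''ᵁ W' := by
    refine ⟨i ⁻¹ᵁ W, ?_⟩
    rw [i.image_preimage_eq_opensRange_inf, inf_eq_right.2 (h.trans (i.image_le_opensRange V))]
  have h' : W' ≤ V := by rwa [i.image_le_image_iff] at h
  exact (key W' h').1 (H W' h')

/-- Over an open immersion `i`, the pull-back of a section of `L` generates if and only if the
section generates `L` over the image of `i`. -/
theorem isGenerator_pullbackSection_openImmersion_iff (i : Y ⟶ X) [IsOpenImmersion i]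
    (L : X.Modules) {U : X.Opens} {V : Y.Opens} (h : V ≤ i ⁻¹ᵁ U) (h' : i ''ᵁ V ≤ U) (e : Γ(L,
      U)) :
    IsGenerator _ (pullbackSection i L U V h e) ↔ IsGenerator L (resSection L h' e) := by
  let ψ := (Scheme.Modules.restrictFunctorIsoPullback i).hom.app L
  have h1 : (Scheme.Modules.restrictAdjunction i).unit.app L ≫
    (Scheme.Modules.pushforward i).map ψ =
      (Scheme.Modules.pullbackPushforwardAdjunction i).unit.app L :=
    Adjunction.unit_leftAdjointUniq_hom_app _ _ _
  have h2 : pullbackSection i L U V h e = ψ.app V ((L.restrictAppIso i V).inv (resSection L h' e))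
    := by
    have h3 : unitSection i L U e = ψ.app (i ⁻¹ᵁ U)
        ((L.restrictAppIso i _).inv (resSection L (i.image_preimage_le U) e)) :=
      congrArg (fun φ ↦ Scheme.Modules.Hom.app φ U e) h1.symm
    rw [pullbackSection_eq, h3]
    refine (app_resSection ψ h _).symm.trans (congrArg (ψ.app V) ?_)
    exact resSection_resSection L _ (i.image_mono h) e
  rw [h2, ← isGenerator_restrict_iff]
  refine ⟨fun H ↦ ?_, fun H ↦ H.map ψ⟩
  have h4 := H.map (inv ψ)
  have h5 : ψ ≫ inv ψ = 𝟙 _ := IsIso.hom_inv_id ψ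
  have h6 := congrArg (fun φ ↦ Scheme.Modules.Hom.app φ V
    ((L.restrictAppIso i V).inv (resSection L h' e))) h5
  have h7 : (inv ψ).app V (ψ.app V ((L.restrictAppIso i V).inv (resSection L h' e))) =
    (L.restrictAppIso i V).inv (resSection L h' e) := h6
  rwa [h7] at h4

theorem IsGenerator.of_resSection {L : X.Modules} {U V : X.Opens} {e : Γ(L, U)} (h : V ≤ U)
    (h' : U ≤ V) (he : IsGenerator L (GrowthRates.resSection L h e)) : IsGenerator L e := by
  have := he.resSection h'
  rwa [resSection_resSection, resSection_self] at this

theorem isGenerator_pullbackComp_iff (f : Z ⟶ Y) (g : Y ⟶ X) (L : X.Modules) {U : X.Opens}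
    {V : Y.Opens} {W : Z.Opens} (hV : V ≤ g ⁻¹ᵁ U) (hW : W ≤ f ⁻¹ᵁ V) (hW' : W ≤ (f ≫ g) ⁻¹ᵁ U)
    (s : Γ(L, U)) :
    IsGenerator _ (pullbackSection f _ V W hW (pullbackSection g L U V hV s)) ↔
      IsGenerator _ (pullbackSection (f ≫ g) L U W hW' s) := by
  rw [← pullbackComp_pullbackSection f g L hV hW hW']
  refine ⟨fun H ↦ H.map _, fun H ↦ ?_⟩
  have h2 := H.map (((Scheme.Modules.pullbackComp f g).inv.app L))
  have h4 := (Scheme.Modules.pullbackComp f g).hom_inv_id_app L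
  have h5 := congrArg (fun ψ ↦ Scheme.Modules.Hom.app ψ _
    (pullbackSection f _ V W hW (pullbackSection g L U V hV s))) h4
  exact (congrArg (IsGenerator _) h5).mp h2

/-- Pull-backs of generators are generators. -/
theorem IsGenerator.pullbackSection (f : Y ⟶ X) {L : X.Modules} {U : X.Opens} {V : Y.Opens}
    (h : V ≤ f ⁻¹ᵁ U) {e : Γ(L, U)} (he : IsGenerator L e) :
    IsGenerator _ (pullbackSection f L U V h e) := by
  have hU : (⊤ : (U : Scheme.{u}).Opens) ≤ U.ι ⁻¹ᵁ U := by simp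
  have hV : (⊤ : (V : Scheme.{u}).Opens) ≤ V.ι ⁻¹ᵁ V := by simp
  have hVι : V.ι ''ᵁ ⊤ = V := by simp
  have hUι : U.ι ''ᵁ ⊤ = U := by simp
  have h1 : IsGenerator _ (GrowthRates.pullbackSection U.ι L U ⊤ hU e) :=
    (isGenerator_pullbackSection_openImmersion_iff U.ι L hU hUι.le e).2 (he.resSection _)
  have h2 := h1.pullbackSection_top (f.resLE U V h)
  have h3 : ∀ k : (V : Scheme.{u}) ⟶ X, k = f.resLE U V h ≫ U.ι → ∀ hk : ⊤ ≤ k ⁻¹ᵁ U,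
      IsGenerator _ (GrowthRates.pullbackSection k L U ⊤ hk e) := by
    rintro _ rfl hk
    exact (isGenerator_pullbackComp_iff _ _ L _ _ hk e).1 h2
  have h4 : (⊤ : (V : Scheme.{u}).Opens) ≤ (V.ι ≫ f) ⁻¹ᵁ U := hV.trans (V.ι.preimage_mono h)
  have h5 := (isGenerator_pullbackComp_iff V.ι f L h hV h4 e).2 (h3 _ (f.resLE_comp_ι h).symm h4)
  rw [isGenerator_pullbackSection_openImmersion_iff V.ι _ hV hVι.le] at h5
  exact h5.of_resSection _ hVι.ge

/-- A module is a line bundle if and only if it is locally generated by a section in the sense of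
`IsGenerator`; in this form the property is stable under pull-back. -/
theorem isLineBundle_iff (L : X.Modules) :
    IsLineBundle L ↔ ∀ x : X, ∃ (U : X.Opens) (e : Γ(L, U)), x ∈ U ∧ IsGenerator L e := by
  refine forall_congr' fun x ↦ ⟨?_, ?_⟩
  · rintro ⟨U, hx, ⟨φ⟩⟩
    have h1 := (isGenerator_oneSection U).map φ.inv
    exact ⟨U.ι ''ᵁ ⊤, (L.restrictAppIso U.ι ⊤).hom (φ.inv.app ⊤ (oneSection U)), by simpa using hx,
      (isGenerator_restrict_iff U.ι L _).1 h1⟩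
  · rintro ⟨U, e, hx, he⟩
    have hUι : U.ι ''ᵁ ⊤ = U := by simp
    obtain ⟨φ, hφ, -⟩ := ((isGenerator_restrict_iff U.ι L _).2 (he.resSection hUι.le)).exists_iso
    exact ⟨U, hx, ⟨(asIso φ).symm⟩⟩

theorem IsLineBundle.pullback {L : X.Modules} (hL : IsLineBundle L) (f : Y ⟶ X) :
    IsLineBundle ((Scheme.Modules.pullback f).obj L) := by
  rw [isLineBundle_iff] at hL ⊢
  intro y
  obtain ⟨U, e, hx, he⟩ := hL (f y)
  exact ⟨f ⁻¹ᵁ U, _, hx, he.pullbackSection f le_rfl⟩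

end Generators

/-! ### Complex points and the pull-back of Hermitian line bundles -/

section PullbackHermitian

variable {K : Type} [Field K] {X Y : Scheme.{0}} {str : X ⟶ specInt K} {σ : K →+* ℂ}

namespace ComplexPoints

theorem mem_iff (x : ComplexPoints str σ) (U : X.Opens) :
    x.Mem U ↔ x.1 (IsLocalRing.closedPoint ℂ) ∈ U := by
  refine ⟨fun h ↦ h (Set.mem_univ _), fun h z _ ↦ ?_⟩
  have : z = IsLocalRing.closedPoint ℂ := Subsingleton.elim (α := PrimeSpectrum ℂ) _ _
  rw [this]
  exact h

theorem Mem.mono {x : ComplexPoints str σ} {U V : X.Opens} (h : x.Mem V) (hVU : V ≤ U) : x.Mem U :=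
  h.trans (x.1.preimage_mono hVU)

theorem value_smul (x : ComplexPoints str σ) (L : X.Modules) {U : X.Opens} (h : x.Mem U)
    (r : Γ(X, U)) (s : Γ(L, U)) :
    x.value L h (r • s) = (x.1.appLE U ⊤ h r : Γ(Spec (.of ℂ), ⊤)) • x.value L h s :=
  pullbackSection_smul _ _ _ _ _

theorem value_resSection (x : ComplexPoints str σ) (L : X.Modules) {U V : X.Opens} (hVU : V ≤ U)
    (h : x.Mem V) (s : Γ(L, U)) :
    x.value L h (resSection L hVU s) = x.value L (h.mono hVU) s :=
  pullbackSection_resSection _ _ _ _ _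

theorem isOpen_setOf_mem (U : X.Opens) : IsOpen {x : ComplexPoints str σ | x.Mem U} := by
  refine TopologicalSpace.isOpen_generateFrom_of_mem ⟨U, 0, Set.univ, isOpen_univ, ?_⟩
  ext x
  simp

theorem continuous_eval (U : X.Opens) (r : Γ(X, U)) :
    Continuous fun x : {x : ComplexPoints str σ // x.Mem U} ↦ x.1.eval x.2 r := by
  refine ⟨fun A hA ↦ ?_⟩
  refine ⟨{x | ∃ h : x.Mem U, x.eval h r ∈ A},
    TopologicalSpace.isOpen_generateFrom_of_mem ⟨U, r, A, hA, rfl⟩, ?_⟩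
  ext ⟨x, hx⟩
  simp [hx]

theorem eval_conj (x : ComplexPoints str σ) {U : X.Opens} (h : x.Mem U) (r : Γ(X, U)) :
    x.conj.eval h.conj r = starRingEnd ℂ (x.eval h r) := by
  have h1 : x.conj.1.appLE U ⊤ h.conj = x.1.appLE U ⊤ h ≫ specConj.appLE ⊤ ⊤ (top_le_preimage _) :=
    (Scheme.Hom.appLE_comp_appLE _ _ _ _ _ _ _).symm
  have h2 := Scheme.ΓSpecIso_naturality (CommRingCat.ofHom (starRingEnd ℂ))
  have h3 : specConj.appLE ⊤ ⊤ (top_le_preimage _) = specConj.appTop :=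
    Scheme.Hom.appLE_eq_app _
  rw [eval, h1, h3]
  exact ConcreteCategory.congr_hom h2 _

variable (g : Y ⟶ X)

/-- The image of a complex point under a morphism of `𝒪_K`-schemes. -/
noncomputable def map (y : ComplexPoints (g ≫ str) σ) : ComplexPoints str σ :=
  ⟨y.1 ≫ g, by rw [Category.assoc, y.2]⟩

theorem Mem.map {y : ComplexPoints (g ≫ str) σ} {U : X.Opens} (h : y.Mem (g ⁻¹ᵁ U)) :
    (y.map g).Mem U := h

theorem eval_mapPoint (y : ComplexPoints (g ≫ str) σ) {U : X.Opens} (h : y.Mem (g ⁻¹ᵁ U))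
    (r : Γ(X, U)) :
    (y.map g).eval h.map r = y.eval h (g.app U r) := by
  have h1 : (y.map g).1.appLE U ⊤ h = g.app U ≫ y.1.appLE _ ⊤ h :=
    (Scheme.Hom.comp_appLE _ _ _ _ _)
  rw [eval, h1]
  rfl

theorem continuous_map : Continuous (map g : ComplexPoints (g ≫ str) σ → ComplexPoints str σ) := by
  refine continuous_generateFrom_iff.2 ?_
  rintro _ ⟨U, r, A, hA, rfl⟩
  refine TopologicalSpace.isOpen_generateFrom_of_mem ⟨g ⁻¹ᵁ U, g.app U r, A, hA, ?_⟩
  ext y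
  exact ⟨fun ⟨h, h'⟩ ↦ ⟨h, (eval_mapPoint g y h r) ▸ h'⟩,
    fun ⟨h, h'⟩ ↦ ⟨h, (eval_mapPoint g y h r).symm ▸ h'⟩⟩

end ComplexPoints

namespace HermitianLineBundle

variable (H : HermitianLineBundle str)

theorem norm_value_congr {x x' : ComplexPoints str σ} (hx : x = x') {U : X.Opens} (h : x.Mem U)
    (h' : x'.Mem U) (s : Γ(H.L, U)) :
    H.norm σ x (x.value H.L h s) = H.norm σ x' (x'.value H.L h' s) := by
  subst hx
  rfl

variable (g : Y ⟶ X)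

/-- The norm on the fibre of `g^* L` at `y`, under the identification with the fibre of `L` at
`g(y)`. -/
noncomputable def pullbackNorm (σ : K →+* ℂ) (y : ComplexPoints (g ≫ str) σ)
    (v : y.fiber ((Scheme.Modules.pullback g).obj H.L)) : ℝ :=
  H.norm σ (y.map g) (((Scheme.Modules.pullbackComp y.1 g).hom.app H.L).app ⊤ v)

theorem pullbackNorm_smul (y : ComplexPoints (g ≫ str) σ) (a : Γ(Spec (.of ℂ), ⊤))
    (v : y.fiber ((Scheme.Modules.pullback g).obj H.L)) :
    H.pullbackNorm g σ y (a • v) =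
      ‖((Scheme.ΓSpecIso (.of ℂ)).hom a : ℂ)‖ * H.pullbackNorm g σ y v := by
  rw [pullbackNorm, Scheme.Modules.Hom.app_smul]
  exact H.norm_smul _ _ _ _

theorem pullbackNorm_value (y : ComplexPoints (g ≫ str) σ) {U : X.Opens} {V : Y.Opens}
    (hV : V ≤ g ⁻¹ᵁ U) (h : y.Mem V) (e : Γ(H.L, U)) :
    H.pullbackNorm g σ y (y.value _ h (pullbackSection g H.L U V hV e)) =
      H.norm σ (y.map g) ((y.map g).value H.L (h.mono hV).map e) :=
  congrArg (H.norm σ (y.map g)) (pullbackComp_pullbackSection y.1 g H.L hV h _ e)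

theorem pullbackNorm_value_smul (y : ComplexPoints (g ≫ str) σ) {U : X.Opens} {V : Y.Opens}
    (hV : V ≤ g ⁻¹ᵁ U) (h : y.Mem V) (e : Γ(H.L, U)) (r : Γ(Y, V)) :
    H.pullbackNorm g σ y (y.value _ h (r • pullbackSection g H.L U V hV e)) =
      ‖y.eval h r‖ * H.norm σ (y.map g) ((y.map g).value H.L (h.mono hV).map e) := by
  rw [ComplexPoints.value_smul, pullbackNorm_smul, ← H.pullbackNorm_value g y hV h]
  rfl

/-- Near a complex point, each section of `g^* L` is a multiple of the pull-back of a section of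
`L`. -/
theorem exists_eq_smul_pullbackSection (y : ComplexPoints (g ≫ str) σ) {V : Y.Opens} (hy : y.Mem V)
    (s : Γ((Scheme.Modules.pullback g).obj H.L, V)) :
    ∃ (U : X.Opens) (e : Γ(H.L, U)) (W : Y.Opens) (hW : W ≤ g ⁻¹ᵁ U) (hWV : W ≤ V) (r : Γ(Y, W)),
      y.Mem W ∧ resSection _ hWV s = r • pullbackSection g H.L U W hW e := by
  obtain ⟨U, e, hx, he⟩ := (isLineBundle_iff H.L).1 H.isLineBundle
    ((y.map g).1 (IsLocalRing.closedPoint ℂ))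
  have hW : V ⊓ g ⁻¹ᵁ U ≤ g ⁻¹ᵁ U := inf_le_right
  obtain ⟨r, hr⟩ := ((he.pullbackSection g hW) _ le_rfl).2 (resSection _ inf_le_left s)
  refine ⟨U, e, V ⊓ g ⁻¹ᵁ U, hW, inf_le_left, r, (y.mem_iff _).2 ⟨(y.mem_iff _).1 hy, ?_⟩, ?_⟩
  · exact (ComplexPoints.mem_iff (y.map g) U).1 ((ComplexPoints.mem_iff (y.map g) U).2 hx)
  · rw [← hr, resSection_self]

/-- Locally a section of `g^* L` is `r • g^* e`, and its norm is `‖r(y)‖ * ‖e(g(y))‖`. -/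
theorem continuous_pullbackNorm (V : Y.Opens) (s : Γ((Scheme.Modules.pullback g).obj H.L, V)) :
    Continuous fun y : {y : ComplexPoints (g ≫ str) σ // y.Mem V} ↦
      H.pullbackNorm g σ y.1 (y.1.value _ y.2 s) := by
  refine continuous_iff_continuousAt.2 fun y₀ ↦ ?_
  obtain ⟨U, e, W, hW, hWV, r, hy, hs⟩ := H.exists_eq_smul_pullbackSection g y₀.1 y₀.2 s
  have hopen : IsOpen {y : {y : ComplexPoints (g ≫ str) σ // y.Mem V} | y.1.Mem W} :=
    (ComplexPoints.isOpen_setOf_mem W).preimage continuous_subtype_val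
  refine ContinuousOn.continuousAt ?_ (hopen.mem_nhds hy)
  rw [continuousOn_iff_continuous_domRestrict]
  have h1 : Continuous fun y : {y : {y : ComplexPoints (g ≫ str) σ // y.Mem V} // y.1.Mem W} ↦
      ‖y.1.1.eval y.2 r‖ := by
    exact ((ComplexPoints.continuous_eval W r).comp
      ((continuous_subtype_val.comp continuous_subtype_val).subtype_mk fun y ↦ y.2)).norm
  have h2 : Continuous fun y : {y : {y : ComplexPoints (g ≫ str) σ // y.Mem V} // y.1.Mem W} ↦
      H.norm σ (y.1.1.map g) ((y.1.1.map g).value H.L (y.2.mono hW).map e) :=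
    (H.continuous_norm σ U e).comp (((ComplexPoints.continuous_map g).comp
      (continuous_subtype_val.comp continuous_subtype_val)).subtype_mk fun y ↦ (y.2.mono hW).map)
  refine (h1.mul h2).congr fun y ↦ ?_
  refine (H.pullbackNorm_value_smul g y.1.1 hW y.2 e r).symm.trans ?_
  rw [← hs, ComplexPoints.value_resSection]
  rfl

theorem pullbackNorm_conj (y : ComplexPoints (g ≫ str) σ) (V : Y.Opens) (hy : y.Mem V)
    (s : Γ((Scheme.Modules.pullback g).obj H.L, V)) :
    H.pullbackNorm g _ y.conj (y.conj.value _ hy.conj s) =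
      H.pullbackNorm g σ y (y.value _ hy s) := by
  obtain ⟨U, e, W, hW, hWV, r, hyW, hs⟩ := H.exists_eq_smul_pullbackSection g y hy s
  rw [← ComplexPoints.value_resSection y _ hWV hyW, ← ComplexPoints.value_resSection y.conj _ hWV
    hyW.conj,
    hs, pullbackNorm_value_smul, pullbackNorm_value_smul, ComplexPoints.eval_conj, RCLike.norm_conj,
    ← H.norm_conj σ (y.map g)]
  have h1 : y.conj.map g = (y.map g).conj := Subtype.ext (Category.assoc specConj y.1 g)
  exact congrArg _ (H.norm_value_congr h1 _ _ e)

/-- The pull-back of a Hermitian line bundle along a morphism of `𝒪_K`-schemes. -/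
noncomputable def pullback : HermitianLineBundle (g ≫ str) where
  L := (Scheme.Modules.pullback g).obj H.L
  isLineBundle := H.isLineBundle.pullback g
  norm := H.pullbackNorm g
  norm_add_le σ y v w := by
    rw [pullbackNorm, map_add]
    exact H.norm_add_le _ _ _ _
  norm_smul σ y a v := H.pullbackNorm_smul g y a v
  eq_zero_of_norm σ y v h := by
    have h1 := H.eq_zero_of_norm _ _ _ h
    exact (ConcreteCategory.bijective_of_isIso
      (((Scheme.Modules.pullbackComp y.1 g).hom.app H.L).app ⊤)).1 (h1.trans (map_zero _).symm)
  continuous_norm σ V s := H.continuous_pullbackNorm g V s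
  norm_conj σ y V h s := H.pullbackNorm_conj g y V h s

end HermitianLineBundle

end PullbackHermitian

/-! ### Sections of line bundles on integral affine schemes -/

section IndexOfSections

variable {R M : Type*} [CommRing R] [AddCommGroup M] [Module R M]

/-- For `s ≠ 0` in a torsion-free module, the quotient of `R s` by `R (a s)` is isomorphic to `R /
a`. -/
theorem card_quotient_span_smul (hM : ∀ (a : R) (m : M), a • m = 0 → a = 0 ∨ m = 0) {s : M}
    (hs : s ≠ 0) (a : R) :
    Nat.card (M ⧸ Submodule.span R {a • s}) =
      Nat.card (R ⧸ Ideal.span {a}) * Nat.card (M ⧸ Submodule.span R {s}) := by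
  let f : R →ₗ[R] M := LinearMap.toSpanSingleton R M s
  have hf : Function.Injective f := (injective_iff_map_eq_zero f).2 fun r hr ↦
    (hM r s hr).resolve_right hs
  have h1 : Submodule.span R {s} = Submodule.map f ⊤ := by
    rw [Submodule.map_top, LinearMap.range_toSpanSingleton]
  have h2 : Submodule.span R {a • s} = Submodule.map f (Ideal.span {a}) := by
    rw [Ideal.span, Submodule.map_span, Set.image_singleton]
    rfl
  have h3 := AddSubgroup.relIndex_map_map_of_injective (f := f.toAddMonoidHom)
    (Ideal.span {a} : Submodule R R).toAddSubgroup (⊤ : Submodule R R).toAddSubgroup hf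
  have h4 := AddSubgroup.relIndex_mul_index (H := (Submodule.span R {a • s}).toAddSubgroup)
    (K := (Submodule.span R {s}).toAddSubgroup)
    (by
      rw [Submodule.toAddSubgroup_le, Submodule.span_singleton_le_iff_mem]
      exact Submodule.smul_mem _ _ (Submodule.mem_span_singleton_self s))
  have h5 : (Submodule.span R {a • s}).toAddSubgroup.relIndex (Submodule.span R {s}).toAddSubgroup =
      (Ideal.span {a} : Submodule R R).toAddSubgroup.index := by
    rw [← AddSubgroup.relIndex_top_right, h1, h2]
    exact h3
  rw [h5] at h4
  exact h4.symm

/-- If `a ≠ 0` multiplies the torsion-free module `M` into `R s`, then `M / R s` embeds into `R /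
a`. -/
theorem finite_quotient_span_of_smul_mem (hM : ∀ (a : R) (m : M), a • m = 0 → a = 0 ∨ m = 0) {s : M}
    {a : R} (ha : a ≠ 0) (h : ∀ m : M, a • m ∈ Submodule.span R {s})
    [Finite (R ⧸ Ideal.span {a})] : Finite (M ⧸ Submodule.span R {s}) := by
  choose c hc using fun m ↦ Submodule.mem_span_singleton.1 (h m)
  refine Finite.of_injective (fun x : M ⧸ Submodule.span R {s} ↦
    (Ideal.Quotient.mk (Ideal.span {a}) (c x.out))) fun x y hxy ↦ ?_
  obtain ⟨d, hd⟩ := Ideal.mem_span_singleton'.1 (Ideal.Quotient.eq.1 hxy)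
  rw [← Submodule.Quotient.mk_out x, ← Submodule.Quotient.mk_out y, Submodule.Quotient.eq,
    Submodule.mem_span_singleton]
  refine ⟨d, ?_⟩
  have h1 : a • (d • s - (x.out - y.out)) = 0 := by
    rw [smul_sub, smul_sub, ← hc x.out, ← hc y.out, ← sub_smul, ← hd, smul_smul, mul_comm, sub_self]
  exact sub_eq_zero.1 ((hM _ _ h1).resolve_left ha)

end IndexOfSections

section SectionsOfLineBundles

universe u

variable {X : Scheme.{u}} {L : X.Modules}

theorem eq_of_forall_resSection_eq (L : X.Modules) {U : X.Opens} {s t : Γ(L, U)}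
    (h : ∀ x ∈ U, ∃ (V : X.Opens) (hV : V ≤ U), x ∈ V ∧ resSection L hV s = resSection L hV t) :
    s = t := by
  choose V hV hx hst using h
  refine TopCat.Sheaf.eq_of_locally_eq' ⟨L.presheaf, L.isSheaf⟩ (fun x : U ↦ V x.1 x.2) U
    (fun x ↦ homOfLE (hV x.1 x.2)) (fun x hxU ↦ ?_) s t fun x ↦ hst x.1 x.2
  exact TopologicalSpace.Opens.mem_iSup.2 ⟨⟨x, hxU⟩, hx x hxU⟩

/-- A line bundle is generated by a section near each point. -/
theorem IsLineBundle.exists_isGenerator_le (hL : IsLineBundle L) {U : X.Opens} (x : X)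
    (hx : x ∈ U) :
    ∃ (V : X.Opens) (_ : V ≤ U) (e : Γ(L, V)), x ∈ V ∧ IsGenerator L e := by
  obtain ⟨V, e, hxV, he⟩ := (isLineBundle_iff L).1 hL x
  exact ⟨U ⊓ V, inf_le_left, _, ⟨hx, hxV⟩, he.resSection inf_le_right⟩

theorem map_injective_of_nonempty [IsIntegral X] {U V : X.Opens} (h : V ≤ U)
    (hV : (V : Set X).Nonempty) {r : Γ(X, U)} (hr : X.presheaf.map (homOfLE h).op r = 0) :
    r = 0 := by
  have : Nonempty V := hV.to_subtype
  exact (injective_iff_map_eq_zero _).1 (map_injective_of_isIntegral X (homOfLE h)) r hr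

theorem IsLineBundle.resSection_injective [IsIntegral X] (hL : IsLineBundle L) {U V : X.Opens}
    (h : V ≤ U) (hV : (V : Set X).Nonempty) : Function.Injective (resSection L h) := by
  refine (injective_iff_map_eq_zero _).2 fun s hs ↦ eq_of_forall_resSection_eq L fun x hx ↦ ?_
  obtain ⟨W, hW, e, hxW, he⟩ := hL.exists_isGenerator_le x hx
  refine ⟨W, hW, hxW, ?_⟩
  obtain ⟨r, hr⟩ := (he W le_rfl).2 (resSection L hW s)
  have hr' : r • e = resSection L hW s := by rw [← hr, resSection_self]
  have h1 : X.presheaf.map (homOfLE (inf_le_left : W ⊓ V ≤ W)).op r = 0 := by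
    refine (he (W ⊓ V) inf_le_left).1 ?_
    change _ • resSection L inf_le_left e = (0 : Γ(X, W ⊓ V)) • _
    rw [← resSection_smul, hr', resSection_resSection, zero_smul,
      ← resSection_resSection L h inf_le_right, hs, map_zero]
  have h2 : ((W ⊓ V : X.Opens) : Set X).Nonempty :=
    nonempty_preirreducible_inter W.isOpen V.isOpen ⟨x, hxW⟩ hV
  rw [← hr', map_injective_of_nonempty _ h2 h1, zero_smul, map_zero]

theorem IsLineBundle.smul_eq_zero [IsIntegral X] (hL : IsLineBundle L) {U : X.Opens}
    (a : Γ(X, U)) (s : Γ(L, U)) (h : a • s = 0) : a = 0 ∨ s = 0 := by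
  by_cases hs : s = 0
  · exact .inr hs
  refine .inl ?_
  obtain ⟨x, hx⟩ : (U : Set X).Nonempty := by
    by_contra hU
    exact hs (eq_of_forall_resSection_eq L fun x hx ↦ (hU ⟨x, hx⟩).elim)
  obtain ⟨W, hW, e, hxW, he⟩ := hL.exists_isGenerator_le x hx
  obtain ⟨r, hr⟩ := (he W le_rfl).2 (resSection L hW s)
  have hr' : r • e = resSection L hW s := by rw [← hr, resSection_self]
  have h1 : X.presheaf.map (homOfLE hW).op a * r = 0 := by
    refine (he W le_rfl).1 ?_
    change _ • resSection L le_rfl e = (0 : Γ(X, W)) • _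
    rw [resSection_self, zero_smul, mul_smul, hr', ← resSection_smul, h, map_zero]
  have : Nonempty W := ⟨⟨x, hxW⟩⟩
  rcases mul_eq_zero.1 h1 with h2 | h2
  · exact map_injective_of_nonempty hW ⟨x, hxW⟩ h2
  · refine (hs (hL.resSection_injective hW ⟨x, hxW⟩ ?_)).elim
    rw [← hr', h2, zero_smul, map_zero]

theorem exists_basicOpen_le [IsAffine X] {U : X.Opens} {x : X} (hx : x ∈ U) :
    ∃ f : Γ(X, ⊤), x ∈ X.basicOpen f ∧ X.basicOpen f ≤ U := by
  obtain ⟨_, ⟨_, ⟨f, rfl⟩, rfl⟩, h1, h2⟩ :=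
    (isBasis_basicOpen X).exists_subset_of_mem_open hx U.isOpen
  exact ⟨f, h1, h2⟩

theorem exists_pow_mul_eq [IsAffine X] (f : Γ(X, ⊤)) (r : Γ(X, X.basicOpen f)) :
    ∃ (k : ℕ) (a : Γ(X, ⊤)), (X.presheaf.map (homOfLE le_top).op f) ^ k * r =
      X.presheaf.map (homOfLE le_top).op a := by
  have := (isAffineOpen_top X).isLocalization_basicOpen f
  obtain ⟨k, a, h⟩ := IsLocalization.Away.surj f r
  exact ⟨k, a, (mul_comm _ _).trans h⟩

/-- Over an integral affine scheme, any non-zero global section of a line bundle generates it up to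
a non-zero function. -/
theorem IsLineBundle.exists_smul_mem_span [IsIntegral X] [IsAffine X] (hL : IsLineBundle L)
    {s : Γ(L, ⊤)} (hs : s ≠ 0) :
    ∃ a : Γ(X, ⊤), a ≠ 0 ∧ ∀ m : Γ(L, ⊤), a • m ∈ Submodule.span Γ(X, ⊤) {s} := by
  classical
  let T : Set Γ(X, ⊤) := {f | (X.basicOpen f : Set X).Nonempty ∧
    ∃ e : Γ(L, X.basicOpen f), IsGenerator L e}
  have hT : Ideal.span T = ⊤ := by
    rw [← (isAffineOpen_top X).iSup_basicOpen_eq_self_iff, eq_top_iff]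
    intro x _
    obtain ⟨W, hW, e, hxW, he⟩ := hL.exists_isGenerator_le (U := ⊤) x trivial
    obtain ⟨f, hxf, hf⟩ := exists_basicOpen_le hxW
    exact TopologicalSpace.Opens.mem_iSup.2 ⟨⟨f, ⟨x, hxf⟩, _, he.resSection hf⟩, hxf⟩
  obtain ⟨t, htT, ht⟩ := (Ideal.span_eq_top_iff_finite T).1 hT
  -- On a basic open subset `X_f` where `L` is free, the coordinate of `s` is, up to a power of `f`,
  -- a function `a`, and `a` multiplies each section into the multiples of `s`, up to a power of
  -- `f`.
  have key (f : Γ(X, ⊤)) (hf : f ∈ T) : ∃ a : Γ(X, ⊤), a ≠ 0 ∧ ∀ m : Γ(L, ⊤), ∃ k : ℕ,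
      (f ^ k * a) • m ∈ Submodule.span Γ(X, ⊤) {s} := by
    obtain ⟨hne, e, he⟩ := hf
    have hcoord (m : Γ(L, ⊤)) : ∃ (k : ℕ) (c : Γ(X, ⊤)),
        resSection L (le_top : X.basicOpen f ≤ ⊤) (f ^ k • m) =
          X.presheaf.map (homOfLE (le_top : X.basicOpen f ≤ ⊤)).op c • e := by
      obtain ⟨r, hr⟩ := (he _ le_rfl).2 (resSection L le_top m)
      obtain ⟨k, c, h⟩ := exists_pow_mul_eq f r
      refine ⟨k, c, ?_⟩
      rw [resSection_smul, ← hr, ← h, map_pow, mul_smul, resSection_self]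
    obtain ⟨k, a, ha⟩ := hcoord s
    have hfne : f ≠ 0 := by
      rintro rfl
      rw [Scheme.basicOpen_zero] at hne
      exact hne.ne_empty rfl
    refine ⟨a, ?_, fun m ↦ ?_⟩
    · rintro rfl
      rw [map_zero, zero_smul, ← map_zero (resSection L (U := ⊤) le_top)] at ha
      rcases hL.smul_eq_zero _ _ (hL.resSection_injective le_top hne ha) with h | h
      · exact pow_ne_zero k hfne h
      · exact hs h
    · obtain ⟨l, c, hc⟩ := hcoord m
      refine ⟨l, Submodule.mem_span_singleton.2 ⟨c * f ^ k, ?_⟩⟩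
      refine hL.resSection_injective (le_top : X.basicOpen f ≤ ⊤) hne ?_
      rw [mul_smul, resSection_smul, ha, mul_comm, mul_smul, resSection_smul, hc, smul_smul,
        smul_smul, mul_comm]
  choose! a ha hak using key
  refine ⟨∏ f ∈ t, a f, Finset.prod_ne_zero_iff.2 fun f hf ↦ ha f (htT hf), fun m ↦ ?_⟩
  let J : Ideal Γ(X, ⊤) := (Submodule.span Γ(X, ⊤) {s}).comap
    (LinearMap.toSpanSingleton Γ(X, ⊤) _ ((∏ f ∈ t, a f) • m))
  -- The `f ∈ t` generate the unit ideal, and so do their powers.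
  have hJ : J = ⊤ := by
    rw [← Ideal.radical_eq_top, eq_top_iff, ← ht, Ideal.span_le]
    intro f hf
    obtain ⟨k, hk⟩ := hak f (htT hf) m
    refine ⟨k, ?_⟩
    suffices h : f ^ k • (∏ f ∈ t, a f) • m ∈ Submodule.span Γ(X, ⊤) {s} from h
    rw [← Finset.prod_erase_mul t a hf, smul_smul, mul_left_comm, mul_smul]
    exact Submodule.smul_mem _ _ hk
  have h1 : (1 : Γ(X, ⊤)) ∈ J := hJ ▸ Submodule.mem_top
  have h2 : (1 : Γ(X, ⊤)) • (∏ f ∈ t, a f) • m ∈ Submodule.span Γ(X, ⊤) {s} := h1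
  rwa [one_smul] at h2

end SectionsOfLineBundles

/-! ### The Arakelov degree does not depend on the section -/

section Degree

variable {K : Type} [Field K] {X Y : Scheme.{0}} {str : X ⟶ specInt K}

theorem ΓSpecIso_specEmbedding (σ : K →+* ℂ) (a : Γ(specInt K, ⊤)) :
    (Scheme.ΓSpecIso (.of ℂ)).hom ((specEmbedding σ).appLE ⊤ ⊤ (top_le_preimage _) a) =
      σ ((Scheme.ΓSpecIso (.of (𝓞 K))).hom a : 𝓞 K) := by
  have h2 := Scheme.ΓSpecIso_naturality (CommRingCat.ofHom (σ.comp (algebraMap (𝓞 K) K)))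
  have h3 : (specEmbedding σ).appLE ⊤ ⊤ (top_le_preimage _) = (specEmbedding σ).appTop :=
    Scheme.Hom.appLE_eq_app _
  rw [h3]
  exact ConcreteCategory.congr_hom h2 a

theorem specEmbedding_injective (σ : K →+* ℂ) {a : Γ(specInt K, ⊤)} (ha : a ≠ 0) :
    σ ((Scheme.ΓSpecIso (.of (𝓞 K))).hom a : 𝓞 K) ≠ 0 := by
  rw [map_ne_zero]
  refine (map_ne_zero_iff (algebraMap (𝓞 K) K) (FaithfulSMul.algebraMap_injective _ _)).2 ?_
  have : Function.Injective (Scheme.ΓSpecIso (.of (𝓞 K))).hom :=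
    (ConcreteCategory.bijective_of_isIso _).1
  exact (map_ne_zero_iff _ this).2 ha

theorem mem_specEmbedding (σ : K →+* ℂ) {V : (specInt K).Opens}
    (hV : (V : Set (specInt K)).Nonempty) :
    ⊤ ≤ (specEmbedding σ) ⁻¹ᵁ V := by
  obtain ⟨x, hx⟩ := hV
  obtain ⟨f, hxf, hf⟩ := exists_basicOpen_le hx
  refine le_trans ?_ ((specEmbedding σ).preimage_mono hf)
  have hf0 : f ≠ 0 := by
    rintro rfl
    rw [Scheme.basicOpen_zero] at hxf
    exact hxf
  have h1 : IsUnit ((specEmbedding σ).app ⊤ f) := by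
    have h2 := ΓSpecIso_specEmbedding σ f
    have h3 : (specEmbedding σ).appLE ⊤ ⊤ (top_le_preimage _) = (specEmbedding σ).app ⊤ :=
      Scheme.Hom.appLE_eq_app _
    rw [h3] at h2
    refine (MulEquiv.isUnit_map (Scheme.ΓSpecIso (.of ℂ)).commRingCatIsoToRingEquiv).1 ?_
    refine IsUnit.mk0 (G₀ := ℂ) _ ?_
    exact h2.trans_ne (specEmbedding_injective σ hf0)
  rw [Scheme.preimage_basicOpen, Scheme.basicOpen_of_isUnit _ h1]
  exact le_rfl

namespace HermitianLineBundle

variable (H : HermitianLineBundle str) (P : IntPoint str) (σ : K →+* ℂ)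

theorem sectionNorm_smul (a : Γ(specInt K, ⊤)) (s : P.sections H.L) :
    H.sectionNorm P σ (a • s) =
      ‖σ ((Scheme.ΓSpecIso (.of (𝓞 K))).hom a : 𝓞 K)‖ * H.sectionNorm P σ s := by
  rw [← ΓSpecIso_specEmbedding]
  refine Eq.trans (congrArg (H.norm σ (P.complexPoint σ)) ?_) (H.norm_smul σ (P.complexPoint σ) _ _)
  refine (congrArg _ (pullbackSection_smul (specEmbedding σ) _ (top_le_preimage _) a s)).trans ?_
  exact Scheme.Modules.Hom.app_smul _ _ _

/-- The norm of a section of `P^* H`, computed on an open subset on which it is a multiple of the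
pull-back of a section of `H`. -/
theorem sectionNorm_eq {U : X.Opens} {V : (specInt K).Opens} (hV : V ≤ P.1 ⁻¹ᵁ U)
    (h : (P.complexPoint σ).Mem U)
    (hσ : ⊤ ≤ (specEmbedding σ) ⁻¹ᵁ V) (s : P.sections H.L) (e : Γ(H.L, U)) (r : Γ(specInt K, V))
    (hs : resSection _ le_top s = r • pullbackSection P.1 H.L U V hV e) :
    H.sectionNorm P σ s = ‖(Scheme.ΓSpecIso (.of ℂ)).hom ((specEmbedding σ).appLE V ⊤ hσ r)‖ *
      H.norm σ (P.complexPoint σ) ((P.complexPoint σ).value H.L h e) := by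
  have h1 : pullbackSection (specEmbedding σ) _ ⊤ ⊤ (top_le_preimage _) s =
      (specEmbedding σ).appLE V ⊤ hσ r •
        pullbackSection (specEmbedding σ) _ V ⊤ hσ (pullbackSection P.1 H.L U V hV e) := by
    rw [← pullbackSection_smul, ← hs, pullbackSection_resSection]
  refine Eq.trans (congrArg (H.norm σ (P.complexPoint σ)) ?_) (H.norm_smul σ (P.complexPoint σ) _ _)
  refine (congrArg _ h1).trans ?_
  refine (Scheme.Modules.Hom.app_smul _ _ _).trans (congrArg _ ?_)
  exact pullbackComp_pullbackSection (specEmbedding σ) P.1 H.L hV hσ h e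

/-- A non-zero section of `P^* L` has non-zero norm at each embedding: it does not vanish at the
generic point of `Spec 𝒪_K`, and `σ` factors through the generic point. -/
theorem sectionNorm_ne_zero {s : P.sections H.L} (hs : s ≠ 0) : H.sectionNorm P σ s ≠ 0 := by
  obtain ⟨U, e, hx, he⟩ := (isLineBundle_iff H.L).1 H.isLineBundle
    ((P.complexPoint σ).1 (IsLocalRing.closedPoint ℂ))
  have hmem : (P.complexPoint σ).Mem U := (ComplexPoints.mem_iff _ U).2 hx
  have hxV : specEmbedding σ (IsLocalRing.closedPoint ℂ) ∈ P.1 ⁻¹ᵁ U := hx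
  obtain ⟨f, hxf, hf⟩ := exists_basicOpen_le hxV
  have hσ := mem_specEmbedding σ ⟨_, hxf⟩
  have hL := H.isLineBundle.pullback P.1
  have he' := he.pullbackSection P.1 hf
  obtain ⟨r, hr⟩ := (he' _ le_rfl).2 (resSection _ le_top s)
  have hr' : resSection _ le_top s = r • pullbackSection P.1 H.L U _ hf e := by
    rw [← hr, resSection_self]
  have hr0 : r ≠ 0 := by
    rintro rfl
    refine hs (hL.resSection_injective le_top ⟨_, hxf⟩ ?_)
    rw [hr', zero_smul, map_zero]
  rw [H.sectionNorm_eq P σ hf hmem hσ s e r hr']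
  refine mul_ne_zero (norm_ne_zero_iff.2 fun h ↦ ?_) fun h ↦ ?_
  · obtain ⟨k, a, ha⟩ := exists_pow_mul_eq f r
    have : Nonempty ((specInt K).basicOpen f) := ⟨⟨_, hxf⟩⟩
    have hf0 : (specInt K).presheaf.map (homOfLE (le_top : (specInt K).basicOpen f ≤ ⊤)).op f ≠ 0 :=
      by
      intro h0
      rw [map_injective_of_nonempty le_top ⟨_, hxf⟩ h0, Scheme.basicOpen_zero] at hxf
      exact hxf
    have ha0 : a ≠ 0 := by
      rintro rfl
      rw [map_zero] at ha
      exact mul_ne_zero (pow_ne_zero k hf0) hr0 ha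
    refine specEmbedding_injective σ ha0 ?_
    rw [← ΓSpecIso_specEmbedding]
    have h1 : (specEmbedding σ).appLE ⊤ ⊤ (top_le_preimage _) a =
        (specEmbedding σ).appLE _ ⊤ hσ
          ((specInt K).presheaf.map (homOfLE (le_top : (specInt K).basicOpen f ≤ ⊤)).op a) :=
      (ConcreteCategory.congr_hom (Scheme.Hom.map_appLE (specEmbedding σ) hσ (homOfLE _).op) a).symm
    rw [h1, ← ha, map_mul, map_mul, h, mul_zero]
  · have h0 := H.eq_zero_of_norm _ _ _ h
    have h1 := ((he.pullbackSection (P.complexPoint σ).1 hmem) ⊤ le_rfl).1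
    have h2 : (1 : Γ(Spec (.of ℂ), ⊤)) = 0 := by
      refine h1 ?_
      change (1 : Γ(Spec (.of ℂ), ⊤)) • resSection _ le_rfl ((P.complexPoint σ).value H.L hmem e) =
        (0 : Γ(Spec (.of ℂ), ⊤)) • resSection _ le_rfl ((P.complexPoint σ).value H.L hmem e)
      rw [h0, map_zero, smul_zero, smul_zero]
    exact one_ne_zero h2

end HermitianLineBundle

section Norm

/-- The product formula for an algebraic integer `a`: both sides are the absolute value of its norm.
For `a = 0` both sides vanish, as `𝓞 K` is infinite and `Nat.card` is `0` on infinite types. -/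
theorem prod_norm_embeddings [NumberField K] (a : 𝓞 K) :
    ∏ σ : K →+* ℂ, ‖σ a‖ = Nat.card (𝓞 K ⧸ Ideal.span {a}) := by
  have h1 := Algebra.norm_eq_prod_embeddings ℚ ℂ (a : K)
  have h2 : ‖algebraMap ℚ ℂ (Algebra.norm ℚ (a : K))‖ = ∏ σ : K →+* ℂ, ‖σ a‖ := by
    rw [h1, norm_prod]
    exact Fintype.prod_equiv (RingHom.equivRatAlgHom K ℂ).symm _ _ fun σ ↦ rfl
  have h3 : Nat.card (𝓞 K ⧸ Ideal.span {a}) = (Algebra.norm ℤ a).natAbs := by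
    rw [← Ideal.absNorm_span_singleton]
    rfl
  rw [← h2, h3, ← Algebra.coe_norm_int, Nat.cast_natAbs]
  simp

theorem card_quotient_specInt (a : Γ(specInt K, ⊤)) :
    Nat.card (Γ(specInt K, ⊤) ⧸ Ideal.span {a}) =
      Nat.card (𝓞 K ⧸ Ideal.span {((Scheme.ΓSpecIso (.of (𝓞 K))).hom a : 𝓞 K)}) := by
  let e := (Scheme.ΓSpecIso (.of (𝓞 K))).commRingCatIsoToRingEquiv
  refine Nat.card_congr (Ideal.quotientEquiv _ _ e ?_).toEquiv
  rw [Ideal.map_span, Set.image_singleton]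
  rfl

theorem finite_quotient_specInt [NumberField K] {a : Γ(specInt K, ⊤)} (ha : a ≠ 0) :
    Finite (Γ(specInt K, ⊤) ⧸ Ideal.span {a}) := by
  refine Nat.finite_of_card_ne_zero fun h ↦ ?_
  rw [card_quotient_specInt] at h
  have h1 := prod_norm_embeddings ((Scheme.ΓSpecIso (.of (𝓞 K))).hom a : 𝓞 K)
  rw [h, Nat.cast_zero] at h1
  obtain ⟨σ, -, hσ⟩ := Finset.prod_eq_zero_iff.1 h1
  exact specEmbedding_injective σ ha (norm_eq_zero.1 hσ)

end Norm

namespace HermitianLineBundle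

variable [NumberField K] (H : HermitianLineBundle str) (P : IntPoint str)

/-- The Arakelov degree of `P^* H`, computed with the section `s`. -/
noncomputable def degreeOf (s : P.sections H.L) : ℝ :=
  Real.log (Nat.card (P.sections H.L ⧸ Submodule.span Γ(specInt K, ⊤) {s})) -
    ∑ σ : K →+* ℂ, Real.log (H.sectionNorm P σ s)

/-- Multiplying the section by `a` changes the two terms of the degree by `log #(𝒪_K / a)` and
`∑_σ log |σ(a)|`, which are equal. -/
theorem degreeOf_smul {s : P.sections H.L} (hs : s ≠ 0) {a : Γ(specInt K, ⊤)} (ha : a ≠ 0) :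
    H.degreeOf P (a • s) = H.degreeOf P s := by
  have hL := H.isLineBundle.pullback P.1
  have htf : ∀ (a : Γ(specInt K, ⊤)) (m : P.sections H.L), a • m = 0 → a = 0 ∨ m = 0 :=
    fun a m ↦ hL.smul_eq_zero a m
  obtain ⟨b, hb, hbs⟩ := hL.exists_smul_mem_span hs
  have := finite_quotient_specInt hb
  have hfin : Finite (P.sections H.L ⧸ Submodule.span Γ(specInt K, ⊤) {s}) :=
    finite_quotient_span_of_smul_mem htf hb hbs
  have h1 : (Nat.card (P.sections H.L ⧸ Submodule.span Γ(specInt K, ⊤) {s}) : ℝ) ≠ 0 :=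
    Nat.cast_ne_zero.2 Nat.card_pos.ne'
  have h2 : ∀ σ : K →+* ℂ, ‖σ ((Scheme.ΓSpecIso (.of (𝓞 K))).hom a : 𝓞 K)‖ ≠ 0 :=
    fun σ ↦ norm_ne_zero_iff.2 (specEmbedding_injective σ ha)
  rw [degreeOf, degreeOf, card_quotient_span_smul htf hs, card_quotient_specInt, Nat.cast_mul,
    ← prod_norm_embeddings, Real.log_mul (Finset.prod_ne_zero_iff.2 fun σ _ ↦ h2 σ) h1,
    Real.log_prod fun σ _ ↦ h2 σ]
  simp_rw [sectionNorm_smul]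
  rw [Finset.sum_congr rfl fun σ _ ↦ Real.log_mul (h2 σ) (H.sectionNorm_ne_zero P σ hs),
    Finset.sum_add_distrib]
  ring

/-- The degree does not depend on the section: `s` and `s'` have a common multiple, as `P^* L` has
rank one. -/
theorem degreeOf_eq {s s' : P.sections H.L} (hs : s ≠ 0) (hs' : s' ≠ 0) :
    H.degreeOf P s = H.degreeOf P s' := by
  have hL := H.isLineBundle.pullback P.1
  obtain ⟨a, ha, has⟩ := hL.exists_smul_mem_span hs
  obtain ⟨c, hc⟩ := Submodule.mem_span_singleton.1 (has s')
  have hc0 : c ≠ 0 := by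
    rintro rfl
    rw [zero_smul] at hc
    exact (hL.smul_eq_zero a s' hc.symm).elim ha hs'
  rw [← H.degreeOf_smul P hs hc0, hc, H.degreeOf_smul P hs' ha]

/-- The degree can be computed with any non-zero section. If there is none, the section chosen in
`degree` is zero, like any other. -/
theorem degree_eq_degreeOf {s : P.sections H.L} (hs : s ≠ 0 ∨ Subsingleton (P.sections H.L)) :
    H.degree P = H.degreeOf P s := by
  change H.degreeOf P (Classical.epsilon fun s ↦ s ≠ 0) = _
  rcases hs with hs | hs
  · exact H.degreeOf_eq P (Classical.epsilon_spec (p := fun s : P.sections H.L ↦ s ≠ 0) ⟨s, hs⟩) hs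
  · exact congrArg _ (Subsingleton.elim _ _)

end HermitianLineBundle

end Degree

/-! ### Functoriality of heights -/

section Height

variable {K : Type} [Field K] {X Y : Scheme.{0}} {str : X ⟶ specInt K} (g : Y ⟶ X)

/-- The image of an `𝒪_K`-point under a morphism of `𝒪_K`-schemes. -/
noncomputable def IntPoint.map (P : IntPoint (g ≫ str)) : IntPoint str :=
  ⟨P.1 ≫ g, by rw [Category.assoc, P.2]⟩

namespace HermitianLineBundle

variable (H : HermitianLineBundle str) (P : IntPoint (g ≫ str))

theorem sectionNorm_pullback (σ : K →+* ℂ) (s : P.sections (H.pullback g).L) :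
    H.sectionNorm (P.map g) σ (((Scheme.Modules.pullbackComp P.1 g).hom.app H.L).app ⊤ s) =
      (H.pullback g).sectionNorm P σ s := by
  obtain ⟨U, e, hx, he⟩ := (isLineBundle_iff H.L).1 H.isLineBundle
    (((P.map g).complexPoint σ).1 (IsLocalRing.closedPoint ℂ))
  have hmem : ((P.map g).complexPoint σ).Mem U := (ComplexPoints.mem_iff _ U).2 hx
  have hmem' : (P.complexPoint σ).Mem (g ⁻¹ᵁ U) := hmem
  have hV : P.1 ⁻¹ᵁ g ⁻¹ᵁ U ≤ (P.map g).1 ⁻¹ᵁ U := le_rfl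
  have hxV : specEmbedding σ (IsLocalRing.closedPoint ℂ) ∈ P.1 ⁻¹ᵁ g ⁻¹ᵁ U := hx
  have hσ := mem_specEmbedding σ ⟨_, hxV⟩
  have he' := (he.pullbackSection g le_rfl).pullbackSection P.1 (le_refl (P.1 ⁻¹ᵁ g ⁻¹ᵁ U))
  obtain ⟨r, hr⟩ := (he' _ le_rfl).2 (resSection _ le_top s)
  have hr' : resSection _ le_top s = r • pullbackSection P.1 (H.pullback g).L _ _ le_rfl
      (pullbackSection g H.L U (g ⁻¹ᵁ U) le_rfl e) :=
    hr.symm.trans (congrArg (r • ·) (resSection_self _ le_rfl _))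
  have hr2 : resSection _ le_top (((Scheme.Modules.pullbackComp P.1 g).hom.app H.L).app ⊤ s) =
      r • pullbackSection (P.map g).1 H.L U _ hV e := by
    refine (app_resSection _ le_top s).symm.trans ?_
    rw [hr']
    refine (Scheme.Modules.Hom.app_smul _ _ _).trans (congrArg _ ?_)
    exact pullbackComp_pullbackSection P.1 g H.L le_rfl le_rfl hV e
  rw [H.sectionNorm_eq (P.map g) σ hV hmem hσ _ e r hr2,
    (H.pullback g).sectionNorm_eq P σ le_rfl hmem' hσ s _ r hr']
  refine congrArg _ (Eq.trans ?_ (H.pullbackNorm_value g (P.complexPoint σ) le_rfl hmem' e).symm)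
  exact H.norm_value_congr (Subtype.ext (Category.assoc (specEmbedding σ) P.1 g).symm) _ _ e

variable [NumberField K]

theorem degreeOf_pullback (s : P.sections (H.pullback g).L) :
    H.degreeOf (P.map g) (((Scheme.Modules.pullbackComp P.1 g).hom.app H.L).app ⊤ s) =
      (H.pullback g).degreeOf P s := by
  let φ := ((Scheme.Modules.pullbackComp P.1 g).hom.app H.L).app ⊤
  have hφ : Function.Bijective φ := ConcreteCategory.bijective_of_isIso _
  let e : P.sections (H.pullback g).L ≃ₗ[Γ(specInt K, ⊤)] (P.map g).sections H.L :=
    LinearEquiv.ofBijective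
      { toFun := φ
        map_add' := map_add φ.hom
        map_smul' := fun a m ↦ Scheme.Modules.Hom.app_smul _ a m } hφ
  have h1 : Nat.card (P.sections (H.pullback g).L ⧸ Submodule.span Γ(specInt K, ⊤) {s}) =
      Nat.card ((P.map g).sections H.L ⧸ Submodule.span Γ(specInt K, ⊤) {e s}) := by
    refine Nat.card_congr (Submodule.Quotient.equiv _ _ e ?_).toEquiv
    rw [Submodule.map_span, Set.image_singleton]
    rfl
  exact congrArg₂ (· - ·) (congrArg (fun n : ℕ ↦ Real.log n) h1.symm)
    (Finset.sum_congr rfl fun σ _ ↦ congrArg Real.log (H.sectionNorm_pullback g P σ s))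

theorem degree_pullback : (H.pullback g).degree P = H.degree (P.map g) := by
  let φ := ((Scheme.Modules.pullbackComp P.1 g).hom.app H.L).app ⊤
  have hφ : Function.Bijective φ := ConcreteCategory.bijective_of_isIso _
  rcases subsingleton_or_nontrivial (P.sections (H.pullback g).L) with h | h
  · have h' : Subsingleton ((P.map g).sections H.L) :=
      @Function.Surjective.subsingleton _ _ _ h hφ.2
    exact ((H.pullback g).degree_eq_degreeOf P (s := 0) (.inr h)).trans
      ((H.degreeOf_pullback g P 0).symm.trans (H.degree_eq_degreeOf (P.map g) (.inr h')).symm)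
  · obtain ⟨s, hs⟩ := exists_ne (0 : P.sections (H.pullback g).L)
    refine ((H.pullback g).degree_eq_degreeOf P (.inl hs)).trans
      ((H.degreeOf_pullback g P s).symm.trans (H.degree_eq_degreeOf (P.map g) (.inl fun h0 ↦
        ?_)).symm)
    exact hs (hφ.1 (h0.trans (map_zero φ.hom).symm))

end HermitianLineBundle

end Height

/-! ### Lifting integral points along finite morphisms -/

section Lifting

/-- Integral points lift along integral morphisms, as soon as the generic point does. -/
theorem exists_lift_of_isIntegralHom {R K : Type} [CommRing R] [Field K] [Algebra R K]
    (hinj : Function.Injective (algebraMap R K))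
    (hint : ∀ x : K, IsIntegral R x → x ∈ (algebraMap R K).range)
    {X Y : Scheme.{0}} (g : Y ⟶ X) [IsIntegralHom g] (Q : Spec (.of R) ⟶ X)
    (P : Spec (.of K) ⟶ Y) (h : P ≫ g = Spec.map (CommRingCat.ofHom (algebraMap R K)) ≫ Q) :
    ∃ Q' : Spec (.of R) ⟶ Y, Q' ≫ g = Q ∧
      Spec.map (CommRingCat.ofHom (algebraMap R K)) ≫ Q' = P := by
  have hZ : IsAffine (pullback g Q) := isAffine_of_isAffineHom (pullback.snd g Q)
  let Z := pullback g Q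
  let i := Z.isoSpec
  let φ := Spec.preimage (i.inv ≫ pullback.snd g Q)
  have hφ : Spec.map φ = i.inv ≫ pullback.snd g Q := Spec.map_preimage _
  let ψ := Spec.preimage (pullback.lift P _ h ≫ i.hom)
  have hψ : Spec.map ψ = pullback.lift P _ h ≫ i.hom := Spec.map_preimage _
  have hφi : φ.hom.IsIntegral := by
    rw [← IsIntegralHom.SpecMap_iff, hφ]
    infer_instance
  have hφψ : φ ≫ ψ = CommRingCat.ofHom (algebraMap R K) := by
    apply Spec.map_injective
    rw [Spec.map_comp, hφ, hψ, Category.assoc, Iso.hom_inv_id_assoc]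
    exact pullback.lift_snd _ _ _
  have hφψ' (r : R) : ψ (φ r) = algebraMap R K r := ConcreteCategory.congr_hom hφψ r
  -- The fibre product `Z = Spec B` of `Y` and `Spec R` over `X` is integral over `R`, so the
  -- `K`-point of `Z` given by `P` takes values in elements of `K` which are integral over `R`.
  have hrange (b : Γ(Z, ⊤)) : ψ b ∈ (algebraMap R K).range := by
    refine hint _ ?_
    obtain ⟨p, hp, hpb⟩ := hφi b
    refine ⟨p, hp, ?_⟩
    have h1 : Polynomial.eval₂ (ψ.hom.comp φ.hom) (ψ b) p = 0 := by
      rw [← Polynomial.hom_eval₂, hpb, map_zero]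
    have h2 : ψ.hom.comp φ.hom = algebraMap R K := RingHom.ext hφψ'
    rwa [h2] at h1
  let eR : R ≃+* (algebraMap R K).range := RingEquiv.ofBijective (algebraMap R K).rangeRestrict
    ⟨fun a b hab ↦ hinj (congrArg Subtype.val hab), (algebraMap R K).rangeRestrict_surjective⟩
  let χ : Γ(Z, ⊤) ⟶ .of R := CommRingCat.ofHom
    (eR.symm.toRingHom.comp (ψ.hom.codRestrict (algebraMap R K).range hrange))
  have hχ' (b : Γ(Z, ⊤)) : algebraMap R K (χ b) = ψ b :=
    congrArg Subtype.val (eR.apply_symm_apply ⟨ψ b, hrange b⟩)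
  have hχ : χ ≫ CommRingCat.ofHom (algebraMap R K) = ψ := by
    ext b
    exact hχ' b
  have hφχ : φ ≫ χ = 𝟙 _ := by
    ext r
    exact hinj ((hχ' (φ r)).trans (hφψ' r))
  refine ⟨Spec.map χ ≫ i.inv ≫ pullback.fst g Q, ?_, ?_⟩
  · rw [Category.assoc, Category.assoc, pullback.condition, ← Category.assoc i.inv, ← hφ,
      ← Category.assoc, ← Spec.map_comp, hφχ, Spec.map_id, Category.id_comp]
  · rw [← Category.assoc, ← Spec.map_comp, hχ, hψ, Category.assoc, Iso.hom_inv_id_assoc]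
    exact pullback.lift_fst _ _ _

theorem isDominant_SpecMap_of_injective {R S : Type} [CommRing R] [CommRing S] {φ : R →+* S}
    (h : Function.Injective φ) : IsDominant (Spec.map (CommRingCat.ofHom φ)) :=
  ⟨PrimeSpectrum.denseRange_comap_iff_ker_le_nilRadical _ |>.2 (by
    have h1 : RingHom.ker φ = ⊥ := (RingHom.injective_iff_ker_eq_bot φ).1 h
    exact h1.le.trans bot_le)⟩

variable {K : Type} [Field K] {X Y : Scheme.{0}} {str : X ⟶ specInt K}

instance isDominant_specFieldToInt : IsDominant (specFieldToInt K) :=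
  isDominant_SpecMap_of_injective (FaithfulSMul.algebraMap_injective (𝓞 K) K)

/-- An integral point of a separated scheme is determined by its generic point. -/
theorem IntPoint.ext_of_generic [IsSeparated str] {P Q : IntPoint str}
    (h : specFieldToInt K ≫ P.1 = specFieldToInt K ≫ Q.1) : P = Q := by
  refine Subtype.ext ?_
  exact ext_of_isDominant_of_isSeparated str (P.2.trans Q.2.symm) (specFieldToInt K) h

/-- The `R`-points of `𝒰` whose generic point lifts along a finite morphism `g` lift to `R`-points
of `g⁻¹ 𝒰`. -/
theorem RingPoints.exists_lift (g : Y ⟶ X) [IsIntegralHom g] (U : X.Opens) {R : Subalgebra (𝓞 K) K}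
    (hR : ∀ x : K, IsIntegral R x → x ∈ R) (P : RingPoints str U R) (P' : Spec (.of K) ⟶ Y)
    (h : P' ≫ g = P.generic) :
    ∃ Q : RingPoints (g ≫ str) (g ⁻¹ᵁ U) R, Q.generic = P' := by
  obtain ⟨Q, hQ, hP'⟩ := exists_lift_of_isIntegralHom (R := R) (K := K)
    (FaithfulSMul.algebraMap_injective _ _) (fun x hx ↦ ⟨⟨x, hR x hx⟩, rfl⟩) g (P.1 ≫ U.ι) P' h
  have hrange : Set.range Q ⊆ Set.range (g ⁻¹ᵁ U).ι := by
    rintro _ ⟨x, rfl⟩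
    rw [Scheme.Opens.range_ι]
    change (Q ≫ g) x ∈ U
    rw [hQ]
    exact (P.1 x).2
  refine ⟨⟨IsOpenImmersion.lift (g ⁻¹ᵁ U).ι Q hrange, ?_⟩, ?_⟩
  · rw [IsOpenImmersion.lift_fac_assoc, ← Category.assoc, hQ, Category.assoc]
    exact P.2
  · exact (congrArg (specFieldToSubring R ≫ ·) (IsOpenImmersion.lift_fac _ _ hrange)).trans hP'

variable [NumberField K]

/-- Heights are functorial for finite morphisms `g`. Both sides are given by the extension of the
rational point to an `𝒪_K`-point, or are zero if there is no such extension; the point extends to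
`Y` if and only if its image extends to `X`. -/
theorem HermitianLineBundle.height_pullback (H : HermitianLineBundle str) [IsSeparated str]
    (g : Y ⟶ X) [IsIntegralHom g] (P : Spec (.of K) ⟶ Y) :
    (H.pullback g).height P = H.height (P ≫ g) := by
  by_cases h : ∃ Q : IntPoint (g ≫ str), specFieldToInt K ≫ Q.1 = P
  · have h' : ∃ Q : IntPoint str, specFieldToInt K ≫ Q.1 = P ≫ g := by
      obtain ⟨Q, rfl⟩ := h
      exact ⟨Q.map g, (Category.assoc _ _ _).symm⟩
    rw [height, height, dif_pos h, dif_pos h', degree_pullback]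
    congr 2
    refine IntPoint.ext_of_generic ?_
    refine Eq.trans ?_ h'.choose_spec.symm
    exact (Category.assoc _ _ _).symm.trans (congrArg (· ≫ g) h.choose_spec)
  · have h' : ¬ ∃ Q : IntPoint str, specFieldToInt K ≫ Q.1 = P ≫ g := by
      rintro ⟨Q, hQ⟩
      obtain ⟨Q', hQ', hP⟩ := exists_lift_of_isIntegralHom (R := 𝓞 K)
        (FaithfulSMul.algebraMap_injective (𝓞 K) K)
        (fun x hx ↦ IsIntegrallyClosed.isIntegral_iff.1 hx) g Q.1 P hQ.symm
      refine h ⟨⟨Q', ?_⟩, hP⟩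
      rw [← Category.assoc, hQ', Q.2]
    rw [height, height, dif_neg h, dif_neg h']

/-- The ring of `S`-integers is integrally closed in `K`. -/
theorem mem_integer_of_isIntegral (S : Set (IsDedekindDomain.HeightOneSpectrum (𝓞 K))) (x : K)
    (hx : IsIntegral (S.integer K) x) : x ∈ S.integer K := by
  intro v hv
  obtain ⟨p, hp, hpx⟩ := hx
  have h1 : IsIntegral (v.valuation K).valuationSubring x := by
    refine ⟨p.map (Subring.inclusion (S := (S.integer K).toSubring)
      (T := (v.valuation K).valuationSubring.toSubring) fun y hy ↦ hy v hv), hp.map _, ?_⟩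
    rw [Polynomial.eval₂_map]
    exact hpx
  obtain ⟨y, rfl⟩ := IsIntegrallyClosed.isIntegral_iff.1 h1
  exact y.2

end Lifting

/-! ### Pull-back of models along finite morphisms -/

section PullbackModel

variable {K : Type} [Field K] {X : Scheme.{0}}

theorem RingPoints.generic_injective {str : X ⟶ specInt K} [IsSeparated str] {U : X.Opens}
    {R : Subalgebra (𝓞 K) K} :
    Function.Injective (RingPoints.generic : RingPoints str U R → (Spec (.of K) ⟶ X)) := by
  intro P Q h
  have : IsDominant (specFieldToSubring R) :=
    isDominant_SpecMap_of_injective (FaithfulSMul.algebraMap_injective R K)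
  refine Subtype.ext ((cancel_mono U.ι).1 ?_)
  refine ext_of_isDominant_of_isSeparated str ?_ (specFieldToSubring R) h
  rw [Category.assoc, Category.assoc]
  exact P.2.trans Q.2.symm

variable [NumberField K] {p : X ⟶ Spec (.of K)} {L : X.Modules} {U : X.Opens}

/-- The pull-back of a model along a finite morphism `a` to the generic fibre: integral points of
the original model whose generic point lifts along `a` are counted by the integral points of the new
model. -/
theorem Model.exists_pullback (M : Model p L U) {T : Scheme.{0}} (a : T ⟶ X) [IsFinite a] :
    ∃ N : Model (a ≫ p) ((Scheme.Modules.pullback a).obj L) (a ⁻¹ᵁ U),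
      ∀ (S : Finset (IsDedekindDomain.HeightOneSpectrum (𝓞 K))) (c : ℝ),
        {P : RingPoints M.str M.𝒰 ((S : Set (IsDedekindDomain.HeightOneSpectrum (𝓞 K))).integer K) |
          (∃ P' : Spec (.of K) ⟶ T, P' ≫ a ≫ M.j = P.generic) ∧ M.ℒ.height P.generic ≤ c}.encard ≤
        {Q : RingPoints N.str N.𝒰 ((S : Set (IsDedekindDomain.HeightOneSpectrum (𝓞 K))).integer K) |
          N.ℒ.height Q.generic ≤ c}.encard := by
  have := M.isProper
  obtain ⟨𝒴, g, j', hg, hflat, H⟩ := exists_finite_extension M.isPullback a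
  obtain ⟨φ⟩ := M.iso
  refine ⟨⟨𝒴, g ≫ M.str, inferInstance, hflat, j', H.paste_vert M.isPullback, M.ℒ.pullback g, ⟨?_⟩,
    g ⁻¹ᵁ M.𝒰, ?_⟩, fun S c ↦ ?_⟩
  · exact (Scheme.Modules.pullbackComp j' g).app _ ≪≫ (Scheme.Modules.pullbackCongr H.w).app _ ≪≫
      ((Scheme.Modules.pullbackComp a M.j).app _).symm ≪≫ (Scheme.Modules.pullback a).mapIso φ
  · rw [← Scheme.Hom.comp_preimage, H.w, Scheme.Hom.comp_preimage, M.preimage]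
  · let R := (S : Set (IsDedekindDomain.HeightOneSpectrum (𝓞 K))).integer K
    have key (P : RingPoints M.str M.𝒰 R) (hP : ∃ P' : Spec (.of K) ⟶ T, P' ≫ a ≫ M.j = P.generic) :
        ∃ Q : RingPoints (g ≫ M.str) (g ⁻¹ᵁ M.𝒰) R, Q.generic ≫ g = P.generic := by
      obtain ⟨P', hP'⟩ := hP
      obtain ⟨Q, hQ⟩ := RingPoints.exists_lift g M.𝒰
        (fun x hx ↦ mem_integer_of_isIntegral _ x hx) P (P' ≫ j')
        (by rw [Category.assoc, H.w, hP'])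
      exact ⟨Q, by rw [hQ, Category.assoc, H.w, hP']⟩
    -- The choice of lifts for all points requires a default value.
    by_cases hne : Nonempty (RingPoints (g ≫ M.str) (g ⁻¹ᵁ M.𝒰) R)
    · choose! Q hQ using key
      refine Set.encard_le_encard_of_injOn (f := Q) (fun P hP ↦ ?_) fun P hP P' hP' h ↦ ?_
      · change (M.ℒ.pullback g).height _ ≤ c
        rw [HermitianLineBundle.height_pullback, hQ P hP.1]
        exact hP.2
      · refine RingPoints.generic_injective ?_
        rw [← hQ P hP.1, ← hQ P' hP'.1, h]
    · refine le_of_eq_of_le (Set.encard_eq_zero.2 (Set.eq_empty_of_forall_notMem fun P hP ↦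
        ?_)) bot_le
      obtain ⟨Q, -⟩ := key P hP.1
      exact hne ⟨Q⟩

end PullbackModel

/-! ### Growth of finite unions -/

section LimsupOfCounts

open Filter

theorem tendsto_const_div_atTop_ereal (r : ℝ) :
    Tendsto (fun c : ℝ ↦ (r : EReal) / (c : EReal)) atTop (𝓝 0) := by
  have h : Tendsto (fun c : ℝ ↦ ((r / c : ℝ) : EReal)) atTop (𝓝 ((0 : ℝ) : EReal)) :=
    (continuous_coe_real_ereal.tendsto 0).comp (tendsto_const_nhds.div_atTop tendsto_id)
  exact h.congr fun c ↦ EReal.coe_div r c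

/-- If a counting function is bounded by a finite sum of counting functions, then its exponential
rate of growth is at most that of one of them. -/
theorem exists_limsup_log_le {ι : Type*} [Fintype ι] [Nonempty ι] (A : ℝ → ℕ∞) (B : ι → ℝ → ℕ∞)
    (h : ∀ c, A c ≤ ∑ i, B i c) :
    ∃ i, limsup (fun c : ℝ ↦ ENNReal.log (max 1 ((A c : ℕ∞) : ENNReal)) / (c : EReal)) atTop ≤
      limsup (fun c : ℝ ↦ ENNReal.log (max 1 ((B i c : ℕ∞) : ENNReal)) / (c : EReal)) atTop := by
  let u (i : ι) (c : ℝ) : EReal := ENNReal.log (max 1 ((B i c : ℕ∞) : ENNReal)) / (c : EReal)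
  let n : ℕ := Fintype.card ι
  have hn : 0 < n := Fintype.card_pos
  obtain ⟨i, -, hi⟩ := Finset.exists_mem_eq_sup' (Finset.univ_nonempty (α := ι))
    fun i ↦ limsup (u i) atTop
  refine ⟨i, ?_⟩
  have hlog : ENNReal.log (n : ENNReal) = (Real.log n : ℝ) := by
    rw [ENNReal.log_pos_real (by simp [hn.ne']) (by simp), ENNReal.toReal_natCast]
  have hlim := (tendsto_const_div_atTop_ereal (Real.log n)).limsup_eq
  have hle : ∀ᶠ c : ℝ in atTop, ENNReal.log (max 1 ((A c : ℕ∞) : ENNReal)) / (c : EReal) ≤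
      ((Real.log n : ℝ) : EReal) / (c : EReal) +
        Finset.univ.sup' Finset.univ_nonempty fun i ↦ u i c := by
    -- If `B k c` is the largest of the `n` terms, then `A c ≤ n * B k c`, and the contribution of
    -- `log n` tends to zero after division by `c`.
    filter_upwards [eventually_gt_atTop 0] with c hc
    obtain ⟨k, -, hk⟩ := Finset.exists_mem_eq_sup' (Finset.univ_nonempty (α := ι)) fun i ↦ B i c
    have h1 : A c ≤ n * B k c := by
      refine (h c).trans ?_
      refine (Finset.sum_le_card_nsmul _ _ (B k c) fun j _ ↦ ?_).trans_eq ?_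
      · rw [← hk]
        exact Finset.le_sup' (fun i ↦ B i c) (Finset.mem_univ j)
      · rw [nsmul_eq_mul]
        rfl
    have h2 : max 1 ((A c : ℕ∞) : ENNReal) ≤ n * max 1 ((B k c : ℕ∞) : ENNReal) := by
      refine max_le ?_ ?_
      · calc (1 : ENNReal) = 1 * 1 := (one_mul 1).symm
          _ ≤ n * max 1 ((B k c : ℕ∞) : ENNReal) :=
            mul_le_mul' (by exact_mod_cast hn) (le_max_left _ _)
      · calc ((A c : ℕ∞) : ENNReal) ≤ ((n * B k c : ℕ∞) : ENNReal) := by exact_mod_cast h1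
          _ = n * ((B k c : ℕ∞) : ENNReal) := by simp
          _ ≤ _ := mul_le_mul' le_rfl (le_max_right _ _)
    have h3 := ENNReal.log_le_log h2
    rw [ENNReal.log_mul_add, hlog] at h3
    have hc' : (0 : EReal) ≤ (c : EReal) := by exact_mod_cast hc.le
    refine (EReal.div_le_div_right_of_nonneg hc' h3).trans ?_
    rw [EReal.add_div_of_nonneg_right hc']
    exact add_le_add le_rfl (Finset.le_sup' (fun i ↦ u i c) (Finset.mem_univ k))
  refine (limsup_le_limsup hle).trans ?_
  refine (EReal.limsup_add_le (.inl (by rw [hlim]; simp)) (.inl (by rw [hlim]; simp))).trans ?_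
  rw [hlim, zero_add, limsup_finset_sup', hi]

end LimsupOfCounts

/-! ### Good reduction outside a finite set of primes -/

section GoodReduction

open IsDedekindDomain IsDedekindDomain.HeightOneSpectrum

variable {K : Type} [Field K]

variable {X Y 𝒳 : Scheme.{0}}

/-- If the closed point of the spectrum of a local ring `R` is mapped to `V`, then the functions on
`V` take values in `R` at the generic point. -/
theorem exists_appLE_eq_algebraMap {R : Type} [CommRing R] [IsLocalRing R] [Algebra R K]
    (Q : Spec (.of R) ⟶ 𝒳) {V : 𝒳.Opens} (hQ : Q (IsLocalRing.closedPoint R) ∈ V) :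
    ⊤ ≤ (Spec.map (CommRingCat.ofHom (algebraMap R K)) ≫ Q) ⁻¹ᵁ V ∧
    ∃ χ : Γ(𝒳, V) →+* R, ∀ (h : ⊤ ≤ (Spec.map (CommRingCat.ofHom (algebraMap R K)) ≫
      Q) ⁻¹ᵁ V) (b : Γ(𝒳, V)),
      (Scheme.ΓSpecIso (.of K)).hom
        ((Spec.map (CommRingCat.ofHom (algebraMap R K)) ≫ Q).appLE V ⊤ h b) =
          algebraMap R K (χ b) := by
  have hV : ⊤ ≤ Q ⁻¹ᵁ V := (Scheme.preimage_eq_top_of_closedPoint_mem Q hQ).ge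
  refine ⟨fun z _ ↦ hV (Set.mem_univ _), (Q.appLE V ⊤ hV ≫ (Scheme.ΓSpecIso (.of R)).hom).hom,
    fun h b ↦ ?_⟩
  have h1 : (Spec.map (CommRingCat.ofHom (algebraMap R K)) ≫ Q).appLE V ⊤ h =
      Q.appLE V ⊤ hV ≫ (Spec.map (CommRingCat.ofHom (algebraMap R K))).appLE ⊤ ⊤ (top_le_preimage _)
        :=
    (Scheme.Hom.appLE_comp_appLE _ _ _ _ _ _ _).symm
  have h3 : (Spec.map (CommRingCat.ofHom (algebraMap R K))).appLE ⊤ ⊤ (top_le_preimage _) =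
      (Spec.map (CommRingCat.ofHom (algebraMap R K))).appTop := Scheme.Hom.appLE_eq_app _
  have h2 := Scheme.ΓSpecIso_naturality (CommRingCat.ofHom (algebraMap R K))
  rw [h1, h3]
  exact ConcreteCategory.congr_hom h2 _

variable [NumberField K]

/-- An element which is integral over the localization of `𝓞 K` at a prime `v`, divided by an
integer which is a unit at `v`, is integral at `v`. -/
theorem isIntegralAtPrime_of_isIntegral {Ω : Type} [Field Ω] [Algebra K Ω]
    (v : HeightOneSpectrum (𝓞 K)) {z : Ω}
    (hz : ((algebraMap K Ω).comp (algebraMap (valuationSubringAtPrime K v) K)).IsIntegralElem z)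
    {N : ℕ} (hN : (N : 𝓞 K) ∉ v.asIdeal) {w : Ω} (hw : z = N * w) :
    IsIntegralAtPrime v.asIdeal w := by
  let : Algebra (valuationSubringAtPrime K v) Ω :=
    ((algebraMap K Ω).comp (algebraMap (valuationSubringAtPrime K v) K)).toAlgebra
  let : Algebra (𝓞 K) Ω := ((algebraMap K Ω).comp (algebraMap (𝓞 K) K)).toAlgebra
  have : IsScalarTower (𝓞 K) (valuationSubringAtPrime K v) Ω := .of_algebraMap_eq fun x ↦ rfl
  have : Algebra.IsIntegral ℤ (𝓞 K) := inferInstance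
  obtain ⟨m, hm⟩ := IsIntegral.exists_multiple_integral_of_isLocalization (R := 𝓞 K)
    (Rₘ := valuationSubringAtPrime K v) v.asIdeal.primeCompl z hz
  refine ⟨m.1 * N, v.isPrime.mul_notMem m.2 hN, ?_⟩
  have h1 : algebraMap K Ω ((m.1 * N : 𝓞 K) : K) * w = m • z := by
    rw [Submonoid.smul_def, Algebra.smul_def, hw]
    push_cast
    exact mul_assoc _ _ _
  rw [h1]
  exact isIntegral_trans _ hm

/-- An `S`-integral point of `U` extends to a point of `U` with values in the local ring at each
prime which is not in `S`. -/
theorem RingPoints.exists_localPoint {str : 𝒳 ⟶ specInt K} {U : 𝒳.Opens}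
    {S : Set (HeightOneSpectrum (𝓞 K))} (P : RingPoints str U (S.integer K))
    {v : HeightOneSpectrum (𝓞 K)} (hv : v ∉ S) :
    ∃ Q : Spec (.of (valuationSubringAtPrime K v)) ⟶ 𝒳, (∀ z, Q z ∈ U) ∧
      Spec.map (CommRingCat.ofHom (algebraMap (valuationSubringAtPrime K v) K)) ≫ Q =
        P.generic := by
  let ι : S.integer K →+* valuationSubringAtPrime K v :=
    Subring.inclusion (S := (S.integer K).toSubring) (T := (valuationSubringAtPrime K v).toSubring)
      fun x hx ↦ by
        rw [valuationSubringAtPrime_eq_valuationSubring]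
        exact hx v hv
  refine ⟨Spec.map (CommRingCat.ofHom ι) ≫ P.1 ≫ U.ι, fun z ↦ ?_, ?_⟩
  · exact ((Spec.map (CommRingCat.ofHom ι) ≫ P.1) z).2
  · rw [← Spec.map_comp_assoc]
    rfl

/-- The restriction to the fibre at `x` of a function `u` which is integral, up to an integer `N`,
over the functions on `V`, is integral at the primes where `x` specializes to `V` and which do not
contain `N`. -/
theorem isIntegralAtPrime_fibreRestrict (f : Y ⟶ X) (j : X ⟶ 𝒳) (x : Spec (.of K) ⟶ X)
    {v : HeightOneSpectrum (𝓞 K)} (Q : Spec (.of (valuationSubringAtPrime K v)) ⟶ 𝒳)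
    (hQ : Spec.map (CommRingCat.ofHom (algebraMap (valuationSubringAtPrime K v) K)) ≫ Q = x ≫ j)
    {V : 𝒳.Opens} (hV : Q (IsLocalRing.closedPoint _) ∈ V) (hx : ⊤ ≤ x ⁻¹ᵁ j ⁻¹ᵁ V) {N : ℕ}
    (hN : (N : 𝓞 K) ∉ v.asIdeal) {u : Γ(Y, f ⁻¹ᵁ j ⁻¹ᵁ V)}
    (hu : ((f.app (j ⁻¹ᵁ V)).hom.comp (j.app V).hom).IsIntegralElem (N * u)) {Ω : Type} [Field Ω]
    [Algebra K Ω] {ψ : Γ(pullback f x, ⊤) →+* Ω} (hψ : ∀ k, ψ (fibreMap f x k) =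
      algebraMap K Ω k) :
    IsIntegralAtPrime v.asIdeal (ψ (fibreRestrict f x (j ⁻¹ᵁ V) hx u)) := by
  obtain ⟨-, χ, hχ⟩ := exists_appLE_eq_algebraMap (K := K) Q hV
  rw [hQ] at hχ
  have h1 (b : Γ(𝒳, V)) : ψ (fibreRestrict f x (j ⁻¹ᵁ V) hx (f.app _ (j.app V b))) =
      algebraMap K Ω (algebraMap _ K (χ b)) := by
    rw [← hχ hx b, ← hψ]
    congr 1
    have h2 : f.app (j ⁻¹ᵁ V) ≫ (pullback.fst f x).appLE _ ⊤ (le_preimage_fibre f x hx) =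
        x.appLE (j ⁻¹ᵁ V) ⊤ hx ≫ (pullback.snd f x).appTop := by
      refine (Scheme.Hom.comp_appLE (pullback.fst f x) f _ _
        (le_preimage_fibre f x hx)).symm.trans ?_
      have h4 : (pullback.snd f x).appTop = (pullback.snd f x).appLE ⊤ ⊤ le_top :=
        Scheme.Hom.app_eq_appLE _
      have h7 : x.appLE (j ⁻¹ᵁ V) ⊤ hx ≫ (pullback.snd f x).appLE ⊤ ⊤ le_top = _ :=
        Scheme.Hom.appLE_comp_appLE _ _ _ _ _ _ _
      rw [h4, h7]
      simp only [pullback.condition]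
    have h5 := ConcreteCategory.congr_hom h2 (j.app V b)
    refine h5.trans ?_
    have h6 : (x ≫ j).appLE V ⊤ hx b = x.appLE (j ⁻¹ᵁ V) ⊤ hx (j.app V b) :=
      ConcreteCategory.congr_hom (Scheme.Hom.comp_appLE x j _ _ _) b
    rw [h6]
    change _ = (pullback.snd f x).appTop (((Scheme.ΓSpecIso (.of K)).hom ≫
      (Scheme.ΓSpecIso (.of K)).inv) _)
    rw [Iso.hom_inv_id]
    rfl
  obtain ⟨p, hp, hpu⟩ := hu
  refine isIntegralAtPrime_of_isIntegral (z := ψ (fibreRestrict f x (j ⁻¹ᵁ V) hx (N * u))) v ?_ hN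
    ?_
  · refine ⟨p.map χ, hp.map _, ?_⟩
    rw [Polynomial.eval₂_map]
    have h2 : ((algebraMap K Ω).comp (algebraMap (valuationSubringAtPrime K v) K)).comp χ =
        (ψ.comp (fibreRestrict f x (j ⁻¹ᵁ V) hx)).comp ((f.app (j ⁻¹ᵁ V)).hom.comp (j.app V).hom) :=
      RingHom.ext fun b ↦ (h1 b).symm
    rw [h2]
    change Polynomial.eval₂ _ ((ψ.comp (fibreRestrict f x (j ⁻¹ᵁ V) hx)) (N * u)) p = 0
    rw [← Polynomial.hom_eval₂, hpu, map_zero]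
  · rw [map_mul, map_mul, map_natCast, map_natCast]

theorem finite_setOf_natCast_mem {N : ℕ} (hN : N ≠ 0) :
    {𝔭 : Ideal (𝓞 K) | 𝔭.IsPrime ∧ 𝔭 ≠ ⊥ ∧ (N : 𝓞 K) ∈ 𝔭}.Finite := by
  have h1 : Ideal.span {(N : 𝓞 K)} ≠ 0 := by
    rw [Ideal.zero_eq_bot, Ne, Ideal.span_singleton_eq_bot]
    exact_mod_cast hN
  refine ((Ideal.finite_factors h1).image fun v ↦ v.asIdeal).subset ?_
  rintro 𝔭 ⟨hp, hp0, hN⟩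
  exact ⟨⟨𝔭, hp, hp0⟩, by
    rw [Set.mem_ofPred_eq, Ideal.dvd_span_singleton]
    exact hN, rfl⟩

/-- The restrictions of a finite étale Galois cover to integral points are unramified outside a
finite set of primes which does not depend on the point: finitely many affine open subsets cover
`𝒰`, over each of them there is a system of elements which shows that the action is free, and the
denominators of these elements involve finitely many primes. -/
theorem exists_finset_isIntegralAtPrime {f : Y ⟶ X} {p : X ⟶ Spec (.of K)} [IsFinite f]
    [Surjective f] [IsIntegral Y] {str : 𝒳 ⟶ specInt K} [IsProper str] {j : X ⟶ 𝒳}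
    (H : IsPullback j p str (specFieldToInt K)) (𝒰 : 𝒳.Opens) [Etale (f ∣_ (j ⁻¹ᵁ 𝒰))]
    (S : Finset (HeightOneSpectrum (𝓞 K))) :
    ∃ B : Finset (Ideal (𝓞 K)), ⊥ ∉ B ∧ ∀ (x : Spec (.of K) ⟶ X)
      (P : RingPoints str 𝒰 ((S : Set (HeightOneSpectrum (𝓞 K))).integer K)), x ≫ j = P.generic →
      ∀ (Ω : Type) [Field Ω] [Algebra K Ω] (ψ : Γ(pullback f x, ⊤) →+* Ω),
      (∀ k, ψ (fibreMap f x k) = algebraMap K Ω k) →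
      ∀ 𝔭 : Ideal (𝓞 K), 𝔭.IsPrime → 𝔭 ≠ ⊥ → 𝔭 ∉ B →
      ∃ (n : ℕ) (u v : Fin n → Γ(pullback f x, ⊤)), ∑ i, u i * v i = 1 ∧
        (∀ g, g ≠ 1 → ∑ i, u i * fibreAction f x g (v i) = 0) ∧
        ∀ i, IsIntegralAtPrime 𝔭 (ψ (u i)) ∧ IsIntegralAtPrime 𝔭 (ψ (v i)) := by
  classical
  have hsp : IsAffineHom (specFieldToInt K) := inferInstanceAs (IsAffineHom (Spec.map _))
  have : IsAffineHom j := MorphismProperty.of_isPullback (P := @IsAffineHom) H.flip hsp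
  have : IsLocallyNoetherian 𝒳 := LocallyOfFiniteType.isLocallyNoetherian str
  have : CompactSpace 𝒳 := QuasiCompact.compactSpace_of_compactSpace str
  have : IsNoetherian 𝒳 := {}
  -- a system of elements with denominator `N` over each non-empty affine open subset
  have key (V : 𝒳.Opens) (hV : IsAffineOpen V) (hVU : V ≤ 𝒰)
      (hne : ((j ⁻¹ᵁ V : X.Opens) : Set X).Nonempty) :
      ∃ (n : ℕ) (u v : Fin n → Γ(Y, f ⁻¹ᵁ j ⁻¹ᵁ V)) (N : ℕ), N ≠ 0 ∧ ∑ i, u i * v i = 1 ∧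
        (∀ g, g ≠ 1 → ∑ i, u i * autSections f (j ⁻¹ᵁ V) g (v i) = 0) ∧
        ∀ i, ((f.app (j ⁻¹ᵁ V)).hom.comp (j.app V).hom).IsIntegralElem (N * u i) ∧
          ((f.app (j ⁻¹ᵁ V)).hom.comp (j.app V).hom).IsIntegralElem (N * v i) := by
    obtain ⟨n, u, v, h1, h0⟩ := isFreeRingAction_autSections f (U := j ⁻¹ᵁ 𝒰) (hV.preimage j)
      (j.preimage_mono hVU) hne
    have hint (w : Γ(Y, f ⁻¹ᵁ j ⁻¹ᵁ V)) : ∃ n : ℕ, n ≠ 0 ∧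
        ((f.app (j ⁻¹ᵁ V)).hom.comp (j.app V).hom).IsIntegralElem (n * w) :=
      exists_isIntegralElem_natCast_mul (j.app V).hom (f.app (j ⁻¹ᵁ V)).hom
        (fun x ↦ exists_app_eq_natCast_mul H hV.isCompact hV.isQuasiSeparated x)
        ((IsFinite.finite_app f _ (hV.preimage j)).to_isIntegral w)
    choose m hm hmi using hint
    have hmul (w : Γ(Y, f ⁻¹ᵁ j ⁻¹ᵁ V)) {l : ℕ} (hl : m w ∣ l) :
        ((f.app (j ⁻¹ᵁ V)).hom.comp (j.app V).hom).IsIntegralElem (l * w) := by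
      obtain ⟨c, rfl⟩ := hl
      have h2 : ((m w * c : ℕ) : Γ(Y, f ⁻¹ᵁ j ⁻¹ᵁ V)) * w =
          ((f.app (j ⁻¹ᵁ V)).hom.comp (j.app V).hom) (c : Γ(𝒳, V)) * (m w * w) := by
        rw [map_natCast, Nat.cast_mul]
        ring
      rw [h2]
      exact RingHom.IsIntegralElem.mul _ (RingHom.isIntegralElem_map _) (hmi w)
    refine ⟨n, u, v, (∏ i, m (u i)) * ∏ i, m (v i), mul_ne_zero
      (Finset.prod_ne_zero_iff.2 fun i _ ↦ hm _) (Finset.prod_ne_zero_iff.2 fun i _ ↦ hm _), h1, h0,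
      fun i ↦ ⟨hmul _ ?_, hmul _ ?_⟩⟩
    · exact (Finset.dvd_prod_of_mem _ (Finset.mem_univ i)).mul_right _
    · exact (Finset.dvd_prod_of_mem _ (Finset.mem_univ i)).mul_left _
  choose! n u v N hN h1 h0 hint using key
  obtain ⟨t, htf, htU⟩ : ∃ t : Set 𝒳.affineOpens, t.Finite ∧ 𝒰 = ⨆ V ∈ t, (V : 𝒳.Opens) := by
    exact (isCompact_iff_finite_and_eq_biUnion_affineOpens).1
      (TopologicalSpace.NoetherianSpace.isCompact _)
  have hB : (⋃ V ∈ t, {𝔭 : Ideal (𝓞 K) | 𝔭.IsPrime ∧ 𝔭 ≠ ⊥ ∧ (N V.1 : 𝓞 K) ∈ 𝔭 ∧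
    N V.1 ≠ 0}).Finite := by
    refine htf.biUnion fun V _ ↦ ?_
    by_cases h : N V.1 = 0
    · simp [h]
    · exact (finite_setOf_natCast_mem h).subset fun 𝔭 h ↦ ⟨h.1, h.2.1, h.2.2.1⟩
  refine ⟨hB.toFinset ∪ S.image HeightOneSpectrum.asIdeal, ?_, ?_⟩
  · rw [Finset.mem_union, not_or]
    refine ⟨fun h ↦ ?_, fun h ↦ ?_⟩
    · obtain ⟨V, -, h2⟩ := Set.mem_iUnion₂.1 (hB.mem_toFinset.1 h)
      exact h2.2.1 rfl
    · obtain ⟨v, -, hv⟩ := Finset.mem_image.1 h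
      exact v.ne_bot hv
  · intro x P hxP Ω _ _ ψ hψ 𝔭 hp hp0 hpB
    rw [Finset.mem_union, not_or] at hpB
    let w : HeightOneSpectrum (𝓞 K) := ⟨𝔭, hp, hp0⟩
    have hw : w ∉ (S : Set (HeightOneSpectrum (𝓞 K))) := fun h ↦
      hpB.2 (Finset.mem_image.2 ⟨w, h, rfl⟩)
    obtain ⟨Q, hQU, hQ⟩ := P.exists_localPoint hw
    have hQ0 := hQU (IsLocalRing.closedPoint _)
    rw [htU] at hQ0
    obtain ⟨V, hV⟩ := TopologicalSpace.Opens.mem_iSup.1 hQ0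
    obtain ⟨hVt, hQV⟩ := TopologicalSpace.Opens.mem_iSup.1 hV
    have hVU : V.1 ≤ 𝒰 := htU ▸ le_iSup₂_of_le V hVt le_rfl
    have hxV : ⊤ ≤ x ⁻¹ᵁ j ⁻¹ᵁ V.1 := by
      obtain ⟨h2, -⟩ := exists_appLE_eq_algebraMap (K := K) Q hQV
      rw [hQ, ← hxP] at h2
      exact h2
    have hne : ((j ⁻¹ᵁ V.1 : X.Opens) : Set X).Nonempty :=
      ⟨x default, hxV (Set.mem_univ (default : Spec (.of K)))⟩
    have hNp : (N V.1 : 𝓞 K) ∉ w.asIdeal := fun h ↦ hpB.1 (hB.mem_toFinset.2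
      (Set.mem_iUnion₂.2 ⟨V, hVt, hp, hp0, h, hN V.1 V.2 hVU hne⟩))
    have hQx := hQ.trans hxP.symm
    refine ⟨n V.1, fun i ↦ fibreRestrict f x _ hxV (u V.1 i), fun i ↦
      fibreRestrict f x _ hxV (v V.1 i),
      ?_, fun g hg ↦ ?_, fun i ↦ ⟨?_, ?_⟩⟩
    · simp only [← map_mul, ← map_sum, h1 V.1 V.2 hVU hne, map_one]
    · simp only [fibreAction_fibreRestrict, ← map_mul, ← map_sum, h0 V.1 V.2 hVU hne g hg, map_zero]
    · exact isIntegralAtPrime_fibreRestrict f j x Q hQx hQV hxV hNp (hint V.1 V.2 hVU hne i).1 hψ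
    · exact isIntegralAtPrime_fibreRestrict f j x Q hQx hQV hxV hNp (hint V.1 V.2 hVU hne i).2 hψ

end GoodReduction

/-! ### Rational points lift to the twist by the class of their fibre -/

section LiftToTwist

/-- A Galois algebra has a point with values in any algebraically closed extension of `K`. -/
theorem IsGaloisExtension.exists_hom_algClosed {G K A Ω : Type} [Group G] [Finite G] [Field K]
    [CommRing A] [Nontrivial A] {φ : K →+* A} {σ : G → A →+* A} (h : IsGaloisExtension φ σ)
    [Field Ω] [Algebra K Ω] [IsAlgClosed Ω] : ∃ ψ : A →+* Ω, ∀ k, ψ (φ k) = algebraMap K Ω k := by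
  have hint := h.finite.to_isIntegral
  algebraize [φ]
  obtain ⟨m, hm⟩ := Ideal.exists_maximal A
  let := Ideal.Quotient.field m
  have hint' : Algebra.IsIntegral K (A ⧸ m) :=
    Algebra.IsIntegral.of_surjective (Ideal.Quotient.mkₐ K m) Ideal.Quotient.mk_surjective
  let ψ : A ⧸ m →ₐ[K] Ω := IsAlgClosed.lift
  exact ⟨(ψ.comp (Ideal.Quotient.mkₐ K m) : A →+* Ω), (ψ.comp (Ideal.Quotient.mkₐ K m)).commutes⟩

theorem IsGaloisExtension.isLocallyGalois {G K A : Type} [Group G] [Field K] [CommRing A]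
    {φ : K →+* A} {σ : G → A →+* A} (h : IsGaloisExtension φ σ) :
    IsLocallyGalois (Spec.map (CommRingCat.ofHom φ)) fun g ↦ Spec.map (CommRingCat.ofHom (σ g)) :=
  fun t ↦ ⟨.of K, .of A, CommRingCat.ofHom φ, fun g ↦ CommRingCat.ofHom (σ g), 𝟙 _, 𝟙 _, h,
    .of_id_fst, inferInstance, ⟨t, rfl⟩, fun g ↦ by rw [Category.comp_id, Category.id_comp]⟩

variable {K : Type} [Field K] {X Y : Scheme.{0}} {pX : X ⟶ Spec (.of K)} {pY : Y ⟶ Spec (.of K)}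
  {f : Y ⟶ X} {hf : f ≫ pX = pY}

/-- If the bundle `t` is equivariantly isomorphic to a `K`-scheme `Q` which maps equivariantly to
the fibre of `f` at a rational point `x`, then `x` lifts to the twist by `t`: the resulting
equivariant map `t ⟶ Y` defines an equivariant section `m` of `Y ×_K t` over `t`, and the
composition of `m` with the quotient morphism is invariant, so it descends to `Spec K`, the quotient
of `t`. -/
theorem CoverTwist.exists_lift_of_iso [Finite (AutOver f)] (x : Spec (.of K) ⟶ X)
    (hx : x ≫ pX = 𝟙 _) {t : H1 (AutOver f) (Spec (.of K))} (T : CoverTwist f hf t)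
    (hT : T.q ≫ T.toBase = pullback.fst pY t.bundle.π ≫ f) {Q : Scheme.{0}} (π : Q ⟶ Spec (.of K))
    [QuasiCompact π] (ρ : AutOver f → (Q ⟶ Q)) (hρ : ∀ g, ρ g ≫ π = π) (hQ : IsLocallyGalois π ρ)
    (i : Q ⟶ pullback f x) (hi : i ≫ pullback.snd f x = π)
    (hi' : ∀ g, ρ g ≫ i = i ≫ fibreAut f x g) (e : t.bundle.P ≅ Q) (he : e.hom ≫ π = t.bundle.π)
    (he' : ∀ g, (t.bundle.act g).hom ≫ e.hom = e.hom ≫ ρ g) :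
    ∃ P : Spec (.of K) ⟶ T.T, P ≫ T.toBase = x := by
  have hm : (e.hom ≫ i ≫ pullback.fst f x) ≫ pY = 𝟙 _ ≫ t.bundle.π := by
    rw [← hf, Category.assoc, Category.assoc, ← Category.assoc (pullback.fst f x),
      pullback.condition,
      Category.assoc, hx, Category.comp_id, hi, he, Category.id_comp]
  let m : t.bundle.P ⟶ pullback pY t.bundle.π := pullback.lift _ _ hm
  have hmfst : m ≫ pullback.fst _ _ = e.hom ≫ i ≫ pullback.fst f x := pullback.lift_fst _ _ _
  have hmsnd : m ≫ pullback.snd _ _ = 𝟙 _ := pullback.lift_snd _ _ _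
  have hequiv (g : AutOver f) : (t.bundle.act g).hom ≫ m =
      m ≫ diagonalAction pY (autAction f) (autAction_comp_of_comp hf) t.bundle g := by
    have hsnd : diagonalAction pY (autAction f) (autAction_comp_of_comp hf) t.bundle g ≫
      pullback.snd pY t.bundle.π =
      pullback.snd pY t.bundle.π ≫ (t.bundle.act g).hom := pullback.lift_snd _ _ _
    have hfst : diagonalAction pY (autAction f) (autAction_comp_of_comp hf) t.bundle g ≫
      pullback.fst pY t.bundle.π =
      pullback.fst pY t.bundle.π ≫ (autAction f g).hom := pullback.lift_fst _ _ _
    refine pullback.hom_ext ?_ ?_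
    · rw [Category.assoc, Category.assoc, hfst, hmfst, ← Category.assoc m, hmfst, ← Category.assoc,
        he',
        Category.assoc, ← Category.assoc (ρ g), hi', Category.assoc, fibreAut_fst, Category.assoc,
        Category.assoc]
    · rw [Category.assoc, Category.assoc, hsnd, hmsnd, ← Category.assoc m, hmsnd, Category.comp_id,
        Category.id_comp]
  have hinv (g : AutOver f) : ρ g ≫ e.inv ≫ m ≫ T.q = e.inv ≫ m ≫ T.q := by
    have h1 : ρ g ≫ e.inv = e.inv ≫ (t.bundle.act g).hom := by
      rw [Iso.eq_inv_comp, ← Category.assoc, ← he', Category.assoc, Iso.hom_inv_id,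
        Category.comp_id]
    rw [← Category.assoc, h1, Category.assoc, ← Category.assoc _ m, hequiv, Category.assoc,
      T.invariant]
  obtain ⟨P, hP, -⟩ := hQ.existsUnique_desc _ hinv
  have hx' : π ≫ P ≫ T.toBase = π ≫ x := by
    rw [← Category.assoc, hP, Category.assoc, Category.assoc, hT, ← Category.assoc m, hmfst,
      Category.assoc, Category.assoc, Iso.inv_hom_id_assoc, pullback.condition, ← Category.assoc,
        hi]
  refine ⟨P, (hQ.existsUnique_desc (π ≫ x) fun g ↦ ?_).unique hx' rfl⟩
  rw [← Category.assoc, hρ]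

/-- A rational point lifts to the twist of a cover by the class of its fibre. -/
theorem CoverTwist.exists_lift [IsAffineHom f] [Finite (AutOver f)] (x : Spec (.of K) ⟶ X)
    (hx : x ≫ pX = 𝟙 _) (h : IsGaloisExtension (fibreMap f x) (fibreAction f x))
    {t : H1 (AutOver f) (Spec (.of K))} (ht : t = Quotient.mk _ h.bundle) (T : CoverTwist f hf t)
    (hT : T.q ≫ T.toBase = pullback.fst pY t.bundle.π ≫ f) :
    ∃ P : Spec (.of K) ⟶ T.T, P ≫ T.toBase = x := by
  obtain ⟨e, he, he'⟩ := Quotient.exact ((Quotient.out_eq t).trans ht)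
  have hZ : IsAffine (pullback f x) := isAffine_of_isAffineHom (pullback.snd f x)
  refine T.exists_lift_of_iso x hx hT (Spec.map (CommRingCat.ofHom (fibreMap f x)))
    (fun g ↦ Spec.map (CommRingCat.ofHom (fibreAction f x g))) h.bundle.act_comp h.isLocallyGalois
    (pullback f x).isoSpec.inv ?_ (fun g ↦ Scheme.isoSpec_inv_naturality _) e he he'
  rw [← Scheme.isoSpec_inv_naturality, Scheme.isoSpec_Spec_inv, ← Spec.map_comp]
  rfl

end LiftToTwist

/-! ### Finiteness of the set of classes of the fibres -/

section FiniteClasses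

open IsDedekindDomain

variable {K : Type} [Field K] [NumberField K] {X Y 𝒳 : Scheme.{0}} {f : Y ⟶ X}
  {p : X ⟶ Spec (.of K)}

/-- Only finitely many principal bundles are fibres of `f` at `S`-integral points of `𝒰`: these
bundles are unramified outside a fixed finite set of primes. -/
theorem finite_setOf_bundle_fibre [IsFinite f] [Surjective f] [Finite (AutOver f)]
    [IsIntegral Y] {str : 𝒳 ⟶ specInt K} [IsProper str] {j : X ⟶ 𝒳}
    (H : IsPullback j p str (specFieldToInt K)) (𝒰 : 𝒳.Opens) [Etale (f ∣_ (j ⁻¹ᵁ 𝒰))]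
    (S : Finset (HeightOneSpectrum (𝓞 K))) :
    {t : H1 (AutOver f) (Spec (.of K)) | ∃ (x : Spec (.of K) ⟶ X)
      (P : RingPoints str 𝒰 ((S : Set (HeightOneSpectrum (𝓞 K))).integer K))
      (h : IsGaloisExtension (fibreMap f x) (fibreAction f x)), x ≫ j = P.generic ∧
        t = Quotient.mk _ h.bundle}.Finite := by
  obtain ⟨B, hB, hint⟩ := exists_finset_isIntegralAtPrime (f := f) H 𝒰 S
  let Ω := AlgebraicClosure K
  have key (t : H1 (AutOver f) (Spec (.of K))) (ht : ∃ (x : Spec (.of K) ⟶ X)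
      (P : RingPoints str 𝒰 ((S : Set (HeightOneSpectrum (𝓞 K))).integer K))
      (h : IsGaloisExtension (fibreMap f x) (fibreAction f x)), x ≫ j = P.generic ∧
        t = Quotient.mk _ h.bundle) : ∃ (I : Set (AutOver f → Ω)) (x : Spec (.of K) ⟶ X)
      (P : RingPoints str 𝒰 ((S : Set (HeightOneSpectrum (𝓞 K))).integer K))
      (h : IsGaloisExtension (fibreMap f x) (fibreAction f x)) (ψ : Γ(pullback f x, ⊤) →+* Ω),
      x ≫ j = P.generic ∧ t = Quotient.mk _ h.bundle ∧
      (∀ k, ψ (fibreMap f x k) = algebraMap K Ω k) ∧ I = orbitRange (fibreAction f x) ψ := by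
    obtain ⟨x, P, h, hxP, ht⟩ := ht
    have : Nontrivial Γ(pullback f x, ⊤) := h.injective.nontrivial
    obtain ⟨ψ, hψ⟩ := h.exists_hom_algClosed (Ω := Ω)
    exact ⟨_, x, P, h, ψ, hxP, ht, hψ, rfl⟩
  choose! I hI using key
  refine Set.Finite.of_injOn (f := I) (fun t ht ↦ ?_) (fun t ht t' ht' hII ↦ ?_)
    (finite_setOf_orbitRange (AutOver f) K Ω B hB)
  · obtain ⟨x, P, h, ψ, hxP, -, hψ, hIt⟩ := hI t ht
    exact ⟨_, _, _, _, ψ, h, hψ, hint x P hxP Ω ψ hψ, hIt⟩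
  · obtain ⟨x, P, h, ψ, -, rfl, hψ, hIt⟩ := hI t ht
    obtain ⟨x', P', h', ψ', -, rfl, hψ', hIt'⟩ := hI t' ht'
    obtain ⟨e, he, he'⟩ := h.exists_ringEquiv_of_orbitRange_eq hψ h' hψ' (hIt.symm.trans (hII.trans
      hIt'))
    exact h.bundle_equiv h' e he he'

end FiniteClasses

/-! ### Counting points through the twists -/

section Counting

open IsDedekindDomain

variable {K : Type} [Field K] {X Y : Scheme.{0}} {pX : X ⟶ Spec (.of K)}
  {pY : Y ⟶ Spec (.of K)} {f : Y ⟶ X} {hf : f ≫ pX = pY} {U : X.Opens} {L : X.Modules}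

/-- An `S`-integral point of a model of `(X, L, U)` gives a rational point of `U`. -/
theorem Model.exists_point (M : Model pX L U) {R : Subalgebra (𝓞 K) K}
    (P : RingPoints M.str M.𝒰 R) :
    ∃ x : Spec (.of K) ⟶ X, x ≫ M.j = P.generic ∧ x ≫ pX = 𝟙 _ ∧ ⊤ ≤ x ⁻¹ᵁ U := by
  have hP : P.generic ≫ M.str = 𝟙 _ ≫ specFieldToInt K := by
    rw [RingPoints.generic, Category.assoc, Category.assoc, P.2, Category.id_comp,
      specFieldToSubring,
      specSubringToInt, ← Spec.map_comp]
    rfl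
  refine ⟨M.isPullback.lift _ _ hP, M.isPullback.lift_fst _ _ _, M.isPullback.lift_snd _ _ _,
    fun z _ ↦ ?_⟩
  have hz : M.isPullback.lift _ _ hP z ∈ M.j ⁻¹ᵁ M.𝒰 := by
    change M.j (M.isPullback.lift _ _ hP z) ∈ M.𝒰
    rw [← Scheme.Hom.comp_apply, M.isPullback.lift_fst]
    exact (P.1 (specFieldToSubring R z)).2
  exact M.preimage.le hz

theorem Model.isLocallyNoetherian (M : Model pX L U) : IsLocallyNoetherian X := by
  have := M.isProper
  have : LocallyOfFiniteType pX := MorphismProperty.of_isPullback M.isPullback inferInstance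
  exact LocallyOfFiniteType.isLocallyNoetherian pX

variable [NumberField K]

/-- The form of `Model.exists_pullback` in which the structure morphism of `T` is given separately.
-/
theorem Model.exists_encard_le (M : Model pX L U) {T : Scheme.{0}} (a : T ⟶ X) [IsFinite a]
    {q : T ⟶ Spec (.of K)} (hq : a ≫ pX = q) (S : Finset (HeightOneSpectrum (𝓞 K))) :
    ∃ N : Model q ((Scheme.Modules.pullback a).obj L) (a ⁻¹ᵁ U), ∀ c : ℝ,
      {P : RingPoints M.str M.𝒰 ((S : Set (HeightOneSpectrum (𝓞 K))).integer K) |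
        (∃ P' : Spec (.of K) ⟶ T, P' ≫ a ≫ M.j = P.generic) ∧ M.ℒ.height P.generic ≤ c}.encard ≤
      {Q : RingPoints N.str N.𝒰 ((S : Set (HeightOneSpectrum (𝓞 K))).integer K) |
        N.ℒ.height Q.generic ≤ c}.encard := by
  subst hq
  obtain ⟨N, hN⟩ := M.exists_pullback a
  exact ⟨N, hN S⟩

/-- The growth rate of `S`-integral points of a model is at most the growth rate of integral points
of a single twist. The twists by the classes of the fibres of `f` at the `S`-integral points are
finite in number and every `S`-integral point lifts to one of them. The trivial class `t₀` is
included in case there is no such point. -/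
theorem Model.exists_growth_le [IsIntegral Y] [IsFinite f] [Surjective f] (hgal : IsGaloisCover f)
    [Etale (f ∣_ U)] (M : Model pX L U) (S : Finset (HeightOneSpectrum (𝓞 K))) :
    ∃ (t : H1 (AutOver f) (Spec (.of K))) (T : CoverTwist f hf t),
      M.growth S ≤ grint T.str ((Scheme.Modules.pullback T.toBase).obj L) (T.toBase ⁻¹ᵁ U) := by
  have := M.isProper
  have := M.isLocallyNoetherian
  have := finite_autOver f
  have : Etale (f ∣_ (M.j ⁻¹ᵁ M.𝒰)) := by rwa [M.preimage]
  let R := (S : Set (HeightOneSpectrum (𝓞 K))).integer K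
  let t₀ : H1 (AutOver f) (Spec (.of K)) := Quotient.mk _ (isGaloisExtension_pi (AutOver f)
    K).bundle
  let C : Set (H1 (AutOver f) (Spec (.of K))) := insert t₀ {t | ∃ (x : Spec (.of K) ⟶ X)
    (P : RingPoints M.str M.𝒰 R) (h : IsGaloisExtension (fibreMap f x) (fibreAction f x)),
      x ≫ M.j = P.generic ∧ t = Quotient.mk _ h.bundle}
  have hC : C.Finite := (finite_setOf_bundle_fibre M.isPullback M.𝒰 S).insert _
  have := hC.fintype
  have : Nonempty C := ⟨⟨t₀, Set.mem_insert _ _⟩⟩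
  have htwist (t : C) : ∃ T : CoverTwist f hf t.1, IsFinite T.toBase ∧
      T.q ≫ T.toBase = pullback.fst pY t.1.bundle.π ≫ f := by
    have ht : t.1.bundle.IsGaloisAlgebra := by
      obtain ⟨t, rfl | ⟨x, P, h, -, rfl⟩⟩ := t
      · exact (isGaloisExtension_pi (AutOver f) K).isGaloisAlgebra_bundle
      · exact h.isGaloisAlgebra_bundle
    obtain ⟨T, hT, hT', -⟩ := exists_coverTwist (hf := hf) t.1 ht
    exact ⟨T, hT, hT'⟩
  choose T hfin hT using htwist
  have hstr (t : C) : (T t).toBase ≫ pX = (T t).str :=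
    ((T t).exists_map pX f hf (autAction_comp f)).choose_spec.1.1
  choose N hN using fun t : C ↦ M.exists_encard_le (T t).toBase (hstr t) S
  obtain ⟨t, ht⟩ := exists_limsup_log_le
    (fun c ↦ {P : RingPoints M.str M.𝒰 R | M.ℒ.height P.generic ≤ c}.encard)
    (fun t c ↦ {Q : RingPoints (N t).str (N t).𝒰 R | (N t).ℒ.height Q.generic ≤ c}.encard) fun c ↦
      by
      refine le_trans (Set.encard_le_encard fun P hP ↦ ?_)
        ((Set.encard_iUnion_le_of_fintype _).trans
        (Finset.sum_le_sum fun t _ ↦ hN t c))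
      obtain ⟨x, hxP, hx, hxU⟩ := M.exists_point P
      have h := isGaloisExtension_fibre f x hgal hxU
      let t : C := ⟨Quotient.mk _ h.bundle, Set.mem_insert_of_mem _ ⟨x, P, h, hxP, rfl⟩⟩
      obtain ⟨P', hP'⟩ := CoverTwist.exists_lift x hx h rfl (T t) (hT t)
      exact Set.mem_iUnion.mpr ⟨t, ⟨P', by rw [← Category.assoc, hP', hxP]⟩, hP⟩
  exact ⟨t, T t, le_trans ht (le_iSup₂ (f := fun (N : Model _ _ _) S ↦ N.growth S) (N t) S)⟩

end Counting

end GrowthRates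

theorem mainTheorem5 (K : Type) [Field K] [NumberField K] {X Y : Scheme.{0}}
    (pX : X ⟶ Spec (.of K)) (pY : Y ⟶ Spec (.of K)) [IsIntegral X] [IsIntegral Y]
    (hX : GrowthRates.IsProjective pX) (hY : GrowthRates.IsProjective pY)
    (f : Y ⟶ X) (hf : f ≫ pX = pY) [IsFinite f] [Surjective f]
    (hgal : GrowthRates.IsGaloisCover f)
    (U : X.Opens) [Etale (f ∣_ U)]
    (L : X.Modules) (hL : GrowthRates.IsAmple L) :
    (GrowthRates.grint pX L U ≤
      ⨆ (t : GrowthRates.H1 (GrowthRates.AutOver f) (Spec (.of K)))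
        (T : GrowthRates.CoverTwist f hf t),
        GrowthRates.grint T.str ((Scheme.Modules.pullback T.toBase).obj L) (T.toBase ⁻¹ᵁ U)) ∧
    ∀ (M : GrowthRates.Model pX L U)
      (S : Finset (IsDedekindDomain.HeightOneSpectrum (𝓞 K))),
      ∃ (t : GrowthRates.H1 (GrowthRates.AutOver f) (Spec (.of K)))
        (T : GrowthRates.CoverTwist f hf t),
        M.growth S ≤
          GrowthRates.grint T.str ((Scheme.Modules.pullback T.toBase).obj L)
            (T.toBase ⁻¹ᵁ U) := by
  refine ⟨iSup₂_le fun M S ↦ ?_, fun M S ↦ M.exists_growth_le hgal S⟩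
  obtain ⟨t, T, h⟩ := M.exists_growth_le (hf := hf) hgal S
  exact le_iSup₂_of_le t T h
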